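/- Let $k$ be a field. For finite-dimensional $k$-algebras $R$, $S$ and a finite-dimensional $R$-$S$-bimodule $M$ on which $k$ acts centrally, let $\Lambda=\begin{pmatrix} R & M\\ 0 & S\end{pmatrix}$ be the triangular matrix algebra and let $\widetilde\Lambda=\begin{pmatrix} S & DM\\ 0 & R\end{pmatrix}$ be its \emph{mate}, where $DM=\operatorname{Hom}_k(M,k)$ with the $S$-$R$-bimodule structure $(s\varphi r)(m)=\varphi(rms)$. Two rings are \emph{derived equivalent} if the bounded derived categories of their categories of all right modules are equivalent as triangulated categories. The \emph{repetitive algebra} $\widehat A$ of a finite-dimensional $k$-algebra $A$ is the non-unital $k$-algebra of $\mathbb{Z}\times\mathbb{Z}$-matrices with finitely many nonzero entries, with entries of $A$ in the positions $(i,i)$, entries of $DA$ in the positions $(i,i+1)$ and zeros elsewhere; the multiplication is given by the multiplication of $A$, the $A$-bimodule structure of $DA$ and the zero map $DA\otimes_A DA\to 0$. The \emph{Cartan matrix} of a finite-dimensional $k$-algebra $A$ with respect to a complete list $P_1,\dots,P_n$ of pairwise non-isomorphic indecomposable finitely generated projective right $A$-modules is $(\dim_k\operatorname{Hom}_A(P_i,P_j))_{i,j}$.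 Integer matrices $C,C'$ are \emph{congruent over $\mathbb{Z}$} if $P^tCP=C'$ for some $P$ invertible over $\mathbb{Z}$. Let $R=k[x]/(x^2)$, $S=k[y]/(y^3)$ and $M=k$, with $x$ and $y$ acting on $k$ as zero. Then: (1) $\Lambda$ and its mate $\widetilde\Lambda$ are not derived equivalent; (2) the repetitive algebras of $\Lambda$ and $\widetilde\Lambda$ are isomorphic as $k$-algebras; (3) $\widetilde\Lambda$ is isomorphic as a $k$-algebra to $\begin{pmatrix} k[y]/(y^3) & k\\ 0 & k[x]/(x^2)\end{pmatrix}$, with $x$ and $y$ acting on $k$ as zero; (4) for suitable orderings of the indecomposable projectives, the Cartan matrices of $\Lambda$ and $\widetilde\Lambda$ are $\begin{pmatrix} 2&0\\1&3\end{pmatrix}$ and $\begin{pmatrix} 3&0\\1&2\end{pmatrix}$, and these two matrices are not congruent over $\mathbb{Z}$; (5) $R$ and $S$ are self-injective (injective as right modules over themselves), and the right $S$-module $M$ has infinite projective dimension, that is, it has no finite projective resolution. -/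

import Mathlib

open CategoryTheory MulOpposite

universe u

set_option linter.unusedSectionVars false

/-! ### Triangular matrix rings -/

/-- The triangular matrix ring `(R M; 0 S)` of an `R`-`S`-bimodule `M`. The right action of `S`
on `M` is a module structure over `Sᵐᵒᵖ`. -/
@[ext]
structure TriMat (R S M : Type u) where
  /-- the upper left entry -/
  a : R
  /-- the upper right entry -/
  m : M
  /-- the lower right entry -/
  b : S

namespace TriMat

section Additive

variable {R S M : Type u} [AddCommGroup R] [AddCommGroup S] [AddCommGroup M]

instance : Zero (TriMat R S M) := ⟨⟨0, 0, 0⟩⟩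
instance : Add (TriMat R S M) := ⟨fun x y => ⟨x.a + y.a, x.m + y.m, x.b + y.b⟩⟩
instance : Neg (TriMat R S M) := ⟨fun x => ⟨-x.a, -x.m, -x.b⟩⟩
instance : Sub (TriMat R S M) := ⟨fun x y => ⟨x.a - y.a, x.m - y.m, x.b - y.b⟩⟩
instance {k : Type*} [SMul k R] [SMul k S] [SMul k M] : SMul k (TriMat R S M) :=
  ⟨fun c x => ⟨c • x.a, c • x.m, c • x.b⟩⟩

@[simp] lemma zero_a : (0 : TriMat R S M).a = 0 := rfl
@[simp] lemma zero_m : (0 : TriMat R S M).m = 0 := rfl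
@[simp] lemma zero_b : (0 : TriMat R S M).b = 0 := rfl
@[simp] lemma add_a (x y : TriMat R S M) : (x + y).a = x.a + y.a := rfl
@[simp] lemma add_m (x y : TriMat R S M) : (x + y).m = x.m + y.m := rfl
@[simp] lemma add_b (x y : TriMat R S M) : (x + y).b = x.b + y.b := rfl
@[simp] lemma smul_a {k : Type*} [SMul k R] [SMul k S] [SMul k M] (c : k) (x : TriMat R S M) :
    (c • x).a = c • x.a := rfl
@[simp] lemma smul_m {k : Type*} [SMul k R] [SMul k S] [SMul k M] (c : k) (x : TriMat R S M) :
    (c • x).m = c • x.m := rfl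
@[simp] lemma smul_b {k : Type*} [SMul k R] [SMul k S] [SMul k M] (c : k) (x : TriMat R S M) :
    (c • x).b = c • x.b := rfl

/-- The entries of a triangular matrix. -/
def toProd (x : TriMat R S M) : R × M × S := (x.a, x.m, x.b)

lemma toProd_injective : Function.Injective (toProd : TriMat R S M → R × M × S) := by
  intro x y h
  simp only [toProd, Prod.mk.injEq] at h
  exact TriMat.ext h.1 h.2.1 h.2.2

instance : AddCommGroup (TriMat R S M) :=
  toProd_injective.addCommGroup toProd rfl (fun _ _ => rfl) (fun _ => rfl) (fun _ _ => rfl)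
    (fun _ _ => rfl) (fun _ _ => rfl)

instance {k : Type*} [Semiring k] [Module k R] [Module k S] [Module k M] :
    Module k (TriMat R S M) :=
  toProd_injective.module k
    { toFun := toProd, map_zero' := rfl, map_add' := fun _ _ => rfl } (fun _ _ => rfl)

end Additive

section Ring

variable {R S M : Type u} [Ring R] [Ring S] [AddCommGroup M] [Module R M] [Module Sᵐᵒᵖ M]

instance : One (TriMat R S M) := ⟨⟨1, 0, 1⟩⟩
instance : Mul (TriMat R S M) :=
  ⟨fun x y => ⟨x.a * y.a, x.a • y.m + op y.b • x.m, x.b * y.b⟩⟩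

@[simp] lemma one_a : (1 : TriMat R S M).a = 1 := rfl
@[simp] lemma one_m : (1 : TriMat R S M).m = 0 := rfl
@[simp] lemma one_b : (1 : TriMat R S M).b = 1 := rfl
@[simp] lemma mul_a (x y : TriMat R S M) : (x * y).a = x.a * y.a := rfl
@[simp] lemma mul_m (x y : TriMat R S M) : (x * y).m = x.a • y.m + op y.b • x.m := rfl
@[simp] lemma mul_b (x y : TriMat R S M) : (x * y).b = x.b * y.b := rfl

instance [SMulCommClass R Sᵐᵒᵖ M] : Ring (TriMat R S M) where
  __ := (inferInstance : AddCommGroup (TriMat R S M))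
  left_distrib x y z := by
    ext
    · simp [mul_add]
    · simp only [mul_m, add_m, add_b, smul_add, MulOpposite.op_add, add_smul]; abel
    · simp [mul_add]
  right_distrib x y z := by
    ext
    · simp [add_mul]
    · simp only [mul_m, add_m, add_a, smul_add, add_smul]; abel
    · simp [add_mul]
  zero_mul x := by ext <;> simp
  mul_zero x := by ext <;> simp
  mul_assoc x y z := by
    ext
    · simp [mul_assoc]
    · simp only [mul_m, mul_a, mul_b, smul_add, op_mul, mul_smul, smul_comm x.a (op z.b) y.m]
      abel
    · simp [mul_assoc]
  one_mul x := by ext <;> simp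
  mul_one x := by ext <;> simp
  neg_add_cancel x := neg_add_cancel x
  zsmul := fun n x => n • x
  zsmul_zero' x := zero_zsmul x
  zsmul_succ' n x := SubNegMonoid.zsmul_succ' n x
  zsmul_neg' n x := SubNegMonoid.zsmul_neg' n x

variable {k : Type u} [Field k] [Algebra k R] [Algebra k S] [Module k M]

instance [SMulCommClass R Sᵐᵒᵖ M] [IsScalarTower k R M] [IsScalarTower k Sᵐᵒᵖ M] :
    Algebra k (TriMat R S M) :=
  Algebra.ofModule
    (fun c x y => by
      ext
      · simp
      · simp only [mul_m, smul_m, smul_a, smul_assoc, smul_add, smul_comm (op y.b) c x.m]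
      · simp)
    (fun c x y => by
      ext
      · simp
      · simp only [mul_m, smul_m, smul_b, op_smul, smul_assoc, smul_add, smul_comm x.a c y.m]
      · simp)

instance [Module.Finite k R] [Module.Finite k S] [Module.Finite k M] :
    Module.Finite k (TriMat R S M) :=
  Module.Finite.of_injective
    ({ toFun := toProd, map_add' := fun _ _ => rfl, map_smul' := fun _ _ => rfl } :
      TriMat R S M →ₗ[k] R × M × S) toProd_injective

end Ring

end TriMat

/-! ### Dual bimodules and mates -/

/-- The `k`-dual `DM = Hom_k(M, k)` of a bimodule `M`. If `M` is an `R`-`S`-bimodule, then `DM` is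
an `S`-`R`-bimodule by `(s φ)(m) = φ(m s)` and `(φ r)(m) = φ(r m)`. -/
def DualBimod (k M : Type u) [Field k] [AddCommGroup M] [Module k M] : Type u := Module.Dual k M

namespace DualBimod

variable {k R S M : Type u} [Field k] [Ring R] [Ring S] [AddCommGroup M] [Module k M]

instance : AddCommGroup (DualBimod k M) := inferInstanceAs (AddCommGroup (Module.Dual k M))
instance : Module k (DualBimod k M) := inferInstanceAs (Module k (Module.Dual k M))
instance : FunLike (DualBimod k M) M k := inferInstanceAs (FunLike (Module.Dual k M) M k)
instance : LinearMapClass (DualBimod k M) k M k :=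
  inferInstanceAs (LinearMapClass (Module.Dual k M) k M k)
instance [Module.Finite k M] : Module.Finite k (DualBimod k M) :=
  inferInstanceAs (Module.Finite k (Module.Dual k M))

@[ext] lemma ext {φ ψ : DualBimod k M} (h : ∀ m, φ m = ψ m) : φ = ψ := DFunLike.ext _ _ h

@[simp] lemma zero_apply (m : M) : (0 : DualBimod k M) m = 0 := rfl
@[simp] lemma add_apply (φ ψ : DualBimod k M) (m : M) : (φ + ψ) m = φ m + ψ m := rfl
@[simp] lemma smul_apply (c : k) (φ : DualBimod k M) (m : M) : (c • φ) m = c • φ m := rfl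

section Left

variable [Algebra k S] [Module Sᵐᵒᵖ M] [IsScalarTower k Sᵐᵒᵖ M]

instance : SMul S (DualBimod k M) :=
  ⟨fun s φ => (φ : Module.Dual k M) ∘ₗ (DistribSMul.toLinearMap k M (op s))⟩

@[simp] lemma left_smul_apply (s : S) (φ : DualBimod k M) (m : M) : (s • φ) m = φ (op s • m) := rfl

instance : Module S (DualBimod k M) where
  one_smul φ := by ext m; simp
  mul_smul s t φ := by ext m; simp [mul_smul]
  smul_zero s := by ext m; simp
  smul_add s φ ψ := by ext m; simp
  add_smul s t φ := by ext m; simp [add_smul, map_add]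
  zero_smul φ := by ext m; simp

instance : IsScalarTower k S (DualBimod k M) :=
  ⟨fun c s φ => by ext m; simp [op_smul, smul_assoc, map_smul]⟩

end Left

section Right

variable [Algebra k R] [Module R M] [IsScalarTower k R M]

instance : SMul Rᵐᵒᵖ (DualBimod k M) :=
  ⟨fun r φ => (φ : Module.Dual k M) ∘ₗ (DistribSMul.toLinearMap k M (unop r))⟩

@[simp] lemma right_smul_apply (r : Rᵐᵒᵖ) (φ : DualBimod k M) (m : M) :
    (r • φ) m = φ (unop r • m) := rfl

instance : Module Rᵐᵒᵖ (DualBimod k M) where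
  one_smul φ := by ext m; simp
  mul_smul s t φ := by ext m; simp [mul_smul]
  smul_zero s := by ext m; simp
  smul_add s φ ψ := by ext m; simp
  add_smul s t φ := by ext m; simp [add_smul, map_add]
  zero_smul φ := by ext m; simp

instance : IsScalarTower k Rᵐᵒᵖ (DualBimod k M) :=
  ⟨fun c s φ => by ext m; simp [smul_assoc, map_smul]⟩

end Right

instance [Algebra k R] [Algebra k S] [Module R M] [Module Sᵐᵒᵖ M] [IsScalarTower k R M]
    [IsScalarTower k Sᵐᵒᵖ M] [SMulCommClass R Sᵐᵒᵖ M] : SMulCommClass S Rᵐᵒᵖ (DualBimod k M) :=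
  ⟨fun s r φ => by ext m; simp [smul_comm (unop r) (op s) m]⟩

end DualBimod

/-- The mate `(S DM; 0 R)` of the triangular matrix algebra `(R M; 0 S)`. -/
abbrev Mate (k R S M : Type u) [Field k] [AddCommGroup M] [Module k M] : Type u :=
  TriMat S R (DualBimod k M)

/-! ### Derived equivalence -/

/-- Two rings are derived equivalent if the bounded derived categories of their right modules are
equivalent as triangulated categories. -/
def DerivedEquivalent (A B : Type u) [Ring A] [Ring B] : Prop :=
  letI := HasDerivedCategory.standard (ModuleCat.{u} Aᵐᵒᵖ)
  letI := HasDerivedCategory.standard (ModuleCat.{u} Bᵐᵒᵖ)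
  ∃ (F : DerivedCategory.Bounded (ModuleCat.{u} Aᵐᵒᵖ) ⥤
      DerivedCategory.Bounded (ModuleCat.{u} Bᵐᵒᵖ)) (_ : F.CommShift ℤ),
    F.IsTriangulated ∧ F.IsEquivalence

/-! ### Repetitive algebras -/

/-- The repetitive algebra of a `k`-algebra `A`: the `ℤ × ℤ`-matrices with finitely many nonzero
entries, whose entry at `(i, i)` is `diag i ∈ A`, whose entry at `(i, i + 1)` is `off i ∈ DA`, and
whose other entries vanish. -/
@[ext]
structure RepetitiveAlgebra (k A : Type u) [Field k] [Ring A] [Algebra k A] where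
  /-- the diagonal entries -/
  diag : ℤ →₀ A
  /-- the entries above the diagonal -/
  off : ℤ →₀ DualBimod k A

namespace RepetitiveAlgebra

variable {k A : Type u} [Field k] [Ring A] [Algebra k A]

instance : Zero (RepetitiveAlgebra k A) := ⟨⟨0, 0⟩⟩
noncomputable instance : Add (RepetitiveAlgebra k A) := ⟨fun x y => ⟨x.diag + y.diag, x.off + y.off⟩⟩
noncomputable instance : Neg (RepetitiveAlgebra k A) := ⟨fun x => ⟨-x.diag, -x.off⟩⟩
noncomputable instance : Sub (RepetitiveAlgebra k A) := ⟨fun x y => ⟨x.diag - y.diag, x.off - y.off⟩⟩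
noncomputable instance : SMul ℕ (RepetitiveAlgebra k A) := ⟨fun n x => ⟨n • x.diag, n • x.off⟩⟩
noncomputable instance : SMul ℤ (RepetitiveAlgebra k A) := ⟨fun n x => ⟨n • x.diag, n • x.off⟩⟩
noncomputable instance : SMul k (RepetitiveAlgebra k A) := ⟨fun c x => ⟨c • x.diag, c • x.off⟩⟩

/-- Matrix multiplication, with the products `A × DA → DA` and `DA × A → DA` given by the bimodule
structure of `DA`, and the product `DA × DA → 0`. -/
noncomputable instance : Mul (RepetitiveAlgebra k A) where
  mul x y :=
    { diag := x.diag * y.diag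
      off := Finsupp.ofSupportFinite
        (fun i => x.diag i • y.off i + op (y.diag (i + 1)) • x.off i)
        ((x.off.support ∪ y.off.support).finite_toSet.subset (by
          intro i hi
          by_contra h
          simp only [Finset.coe_union, Set.mem_union, Finset.mem_coe, Finsupp.mem_support_iff,
            not_or, not_not] at h
          exact hi (by simp [h.1, h.2]))) }

@[simp] lemma zero_diag : (0 : RepetitiveAlgebra k A).diag = 0 := rfl
@[simp] lemma zero_off : (0 : RepetitiveAlgebra k A).off = 0 := rfl
@[simp] lemma add_diag (x y : RepetitiveAlgebra k A) : (x + y).diag = x.diag + y.diag := rfl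
@[simp] lemma add_off (x y : RepetitiveAlgebra k A) : (x + y).off = x.off + y.off := rfl
@[simp] lemma smul_diag (c : k) (x : RepetitiveAlgebra k A) : (c • x).diag = c • x.diag := rfl
@[simp] lemma smul_off (c : k) (x : RepetitiveAlgebra k A) : (c • x).off = c • x.off := rfl
@[simp] lemma mul_diag (x y : RepetitiveAlgebra k A) : (x * y).diag = x.diag * y.diag := rfl
@[simp] lemma mul_off_apply (x y : RepetitiveAlgebra k A) (i : ℤ) :
    (x * y).off i = x.diag i • y.off i + op (y.diag (i + 1)) • x.off i := rfl

/-- The entries of a matrix in the repetitive algebra. -/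
def toProd (x : RepetitiveAlgebra k A) : (ℤ →₀ A) × (ℤ →₀ DualBimod k A) := (x.diag, x.off)

lemma toProd_injective : Function.Injective (toProd (k := k) (A := A)) := by
  intro x y h
  simp only [toProd, Prod.mk.injEq] at h
  exact RepetitiveAlgebra.ext h.1 h.2

noncomputable instance : AddCommGroup (RepetitiveAlgebra k A) :=
  toProd_injective.addCommGroup toProd rfl (fun _ _ => rfl) (fun _ => rfl) (fun _ _ => rfl)
    (fun _ _ => rfl) (fun _ _ => rfl)

noncomputable instance : Module k (RepetitiveAlgebra k A) :=
  toProd_injective.module k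
    { toFun := toProd, map_zero' := rfl, map_add' := fun _ _ => rfl } (fun _ _ => rfl)

noncomputable instance : NonUnitalRing (RepetitiveAlgebra k A) where
  __ := (inferInstance : AddCommGroup (RepetitiveAlgebra k A))
  left_distrib x y z := by
    apply RepetitiveAlgebra.ext
    · simp [mul_add]
    · apply Finsupp.ext
      intro i
      simp only [mul_off_apply, add_off, add_diag, Finsupp.add_apply, smul_add,
        MulOpposite.op_add, add_smul]
      abel
  right_distrib x y z := by
    apply RepetitiveAlgebra.ext
    · simp [add_mul]
    · apply Finsupp.ext
      intro i
      simp only [mul_off_apply, add_off, add_diag, Finsupp.add_apply, smul_add, add_smul]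
      abel
  zero_mul x := by
    apply RepetitiveAlgebra.ext
    · simp
    · apply Finsupp.ext; intro i; simp
  mul_zero x := by
    apply RepetitiveAlgebra.ext
    · simp
    · apply Finsupp.ext; intro i; simp
  mul_assoc x y z := by
    apply RepetitiveAlgebra.ext
    · simp [mul_assoc]
    · apply Finsupp.ext
      intro i
      simp only [mul_off_apply, mul_diag, Finsupp.mul_apply, smul_add, op_mul, mul_smul,
        smul_comm (x.diag i) (op (z.diag (i + 1))) (y.off i)]
      abel

instance : IsScalarTower k (RepetitiveAlgebra k A) (RepetitiveAlgebra k A) where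
  smul_assoc c x y := by
    simp only [smul_eq_mul]
    apply RepetitiveAlgebra.ext
    · apply Finsupp.ext; intro i; simp
    · apply Finsupp.ext
      intro i
      simp only [mul_off_apply, smul_off, smul_diag, Finsupp.smul_apply, smul_add, smul_assoc,
        smul_comm (op (y.diag (i + 1))) c]

instance : SMulCommClass k (RepetitiveAlgebra k A) (RepetitiveAlgebra k A) where
  smul_comm c x y := by
    simp only [smul_eq_mul]
    apply RepetitiveAlgebra.ext
    · apply Finsupp.ext; intro i; simp
    · apply Finsupp.ext
      intro i
      simp only [mul_off_apply, smul_off, smul_diag, Finsupp.smul_apply, smul_add, op_smul,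
        smul_assoc, smul_comm (x.diag i) c]

end RepetitiveAlgebra

/-! ### Cartan matrices -/

/-- `C` is the Cartan matrix `C i j = dim_k Hom(P i, P j)` of the finite dimensional `k`-algebra `A`
for some numbering `P` of the isomorphism classes of indecomposable projectives in the category of
finitely generated right `A`-modules. -/
def IsCartanMatrix (k A : Type u) [Field k] [Ring A] [Algebra k A] [Module.Finite k A] {n : ℕ}
    (C : Matrix (Fin n) (Fin n) ℤ) : Prop :=
  ∃ P : Fin n → ModuleCat.{u} Aᵐᵒᵖ,
    (∀ i, Module.Finite Aᵐᵒᵖ (P i) ∧ Projective (P i) ∧ Indecomposable (P i)) ∧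
    (∀ i j, Nonempty (P i ≅ P j) → i = j) ∧
    (∀ Q : ModuleCat.{u} Aᵐᵒᵖ, Module.Finite Aᵐᵒᵖ Q → Projective Q → Indecomposable Q →
      ∃ i, Nonempty (Q ≅ P i)) ∧
    ∀ i j, C i j = (Module.finrank k (P i ⟶ P j) : ℤ)

/-- Congruence of square matrices over `ℤ`. -/
def IntCongruent {n : ℕ} (C C' : Matrix (Fin n) (Fin n) ℤ) : Prop :=
  ∃ P : Matrix (Fin n) (Fin n) ℤ, IsUnit P ∧ P.transpose * C * P = C'

/-! ### The truncated polynomial algebras and their simple bimodule -/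

/-- The algebra `k[x]/(x^n)`. -/
abbrev TruncPoly (k : Type u) [Field k] (n : ℕ) : Type u :=
  Polynomial k ⧸ Ideal.span {(Polynomial.X : Polynomial k) ^ n}

/-- The algebra homomorphism `k[x]/(x^n) → k` that sends `x` to zero. -/
noncomputable def TruncPoly.aug (k : Type u) [Field k] (n : ℕ) [NeZero n] : TruncPoly k n →ₐ[k] k :=
  Ideal.Quotient.liftₐ _ (Polynomial.aeval (0 : k)) (by
    intro p hp
    obtain ⟨q, rfl⟩ := Ideal.mem_span_singleton.mp hp
    simp [NeZero.ne n])

instance (k : Type u) [Field k] (n : ℕ) : Module.Finite k (TruncPoly k n) :=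
  (Polynomial.monic_X_pow n).finite_quotient

/-- The one-dimensional `k[x]/(x^n)`-`k[y]/(y^m)`-bimodule `k`, with `x` and `y` acting as zero. -/
def SimpleBimod (k : Type u) (_n _m : ℕ) : Type u := k

namespace SimpleBimod

variable {k : Type u} [Field k] {n m : ℕ}

instance : AddCommGroup (SimpleBimod k n m) := inferInstanceAs (AddCommGroup k)
instance : Module k (SimpleBimod k n m) := inferInstanceAs (Module k k)
instance : Module.Finite k (SimpleBimod k n m) := inferInstanceAs (Module.Finite k k)

noncomputable instance [NeZero n] : Module (TruncPoly k n) (SimpleBimod k n m) :=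
  Module.compHom k (TruncPoly.aug k n).toRingHom

noncomputable instance [NeZero m] : Module (TruncPoly k m)ᵐᵒᵖ (SimpleBimod k n m) :=
  Module.compHom k ((TruncPoly.aug k m).toRingHom.fromOpposite fun _ _ => mul_comm _ _)

lemma left_smul_def [NeZero n] (r : TruncPoly k n) (c : SimpleBimod k n m) :
    r • c = TruncPoly.aug k n r • c := rfl

lemma right_smul_def [NeZero m] (s : (TruncPoly k m)ᵐᵒᵖ) (c : SimpleBimod k n m) :
    s • c = TruncPoly.aug k m (unop s) • c := rfl

instance [NeZero n] : IsScalarTower k (TruncPoly k n) (SimpleBimod k n m) :=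
  ⟨fun c r v => by simp only [left_smul_def, map_smul, smul_assoc]⟩

instance [NeZero m] : IsScalarTower k (TruncPoly k m)ᵐᵒᵖ (SimpleBimod k n m) :=
  ⟨fun c r v => by simp only [right_smul_def, unop_smul, map_smul, smul_assoc]⟩

instance [NeZero n] [NeZero m] :
    SMulCommClass (TruncPoly k n) (TruncPoly k m)ᵐᵒᵖ (SimpleBimod k n m) :=
  ⟨fun r s v => by rw [left_smul_def, right_smul_def, right_smul_def, left_smul_def, smul_comm]⟩

end SimpleBimod

/-- The triangular matrix algebra of `R = k[x]/(x^2)`, `S = k[y]/(y^3)` and `M = k`. -/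
abbrev ExLambda (k : Type u) [Field k] : Type u :=
  TriMat (TruncPoly k 2) (TruncPoly k 3) (SimpleBimod k 2 3)

/-- The mate of `ExLambda k`. -/
abbrev ExMate (k : Type u) [Field k] : Type u :=
  Mate k (TruncPoly k 2) (TruncPoly k 3) (SimpleBimod k 2 3)

/-! ### Morphisms from projectives and to injectives in the derived category -/

namespace DerivedCategory

universe w v' u'

variable {C : Type u'} [Category.{v'} C] [Abelian C] [HasDerivedCategory.{w} C]

lemma exists_Q_map_of_isKInjective {K L : CochainComplex C ℤ} [L.IsKInjective]
    (g : Q.obj K ⟶ Q.obj L) : ∃ f : K ⟶ L, Q.map f = g := by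
  obtain ⟨g', hg'⟩ := (CochainComplex.IsKInjective.Qh_map_bijective
    ((HomotopyCategory.quotient _ _).obj K) L).2
      ((quotientCompQhIso C).hom.app K ≫ g ≫ (quotientCompQhIso C).inv.app L)
  obtain ⟨f, rfl⟩ := (HomotopyCategory.quotient _ _).map_surjective g'
  refine ⟨f, ?_⟩
  have := (quotientCompQhIso C).hom.naturality f
  simp only [Functor.comp_map] at this
  rw [hg'] at this
  simpa using this.symm

lemma homotopy_of_Q_map_eq_zero_of_isKInjective {K L : CochainComplex C ℤ} [L.IsKInjective]
    {f : K ⟶ L} (hf : Q.map f = (0 : Q.obj K ⟶ Q.obj L)) : Nonempty (Homotopy f 0) := by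
  refine ⟨HomotopyCategory.homotopyOfEq _ _ ?_⟩
  apply (CochainComplex.IsKInjective.Qh_map_bijective _ L).1
  have h := (quotientCompQhIso C).hom.naturality f
  simp only [Functor.comp_map] at h
  rw [Functor.map_zero, Functor.map_zero, ← cancel_mono ((quotientCompQhIso C).hom.app L), h, hf]
  simp

lemma exists_Q_map_of_isKProjective {K L : CochainComplex C ℤ} [K.IsKProjective]
    (g : Q.obj K ⟶ Q.obj L) : ∃ f : K ⟶ L, Q.map f = g := by
  obtain ⟨g', hg'⟩ := (CochainComplex.IsKProjective.Qh_map_bijective K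
    ((HomotopyCategory.quotient _ _).obj L)).2
      ((quotientCompQhIso C).hom.app K ≫ g ≫ (quotientCompQhIso C).inv.app L)
  obtain ⟨f, rfl⟩ := (HomotopyCategory.quotient _ _).map_surjective g'
  refine ⟨f, ?_⟩
  have := (quotientCompQhIso C).hom.naturality f
  simp only [Functor.comp_map] at this
  rw [hg'] at this
  simpa using this.symm

lemma Q_map_eq_zero_of_homotopy {K L : CochainComplex C ℤ} {f : K ⟶ L} (h : Homotopy f 0) :
    Q.map f = (0 : Q.obj K ⟶ Q.obj L) := by
  have h1 := (quotientCompQhIso C).hom.naturality f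
  simp only [Functor.comp_map] at h1
  rw [HomotopyCategory.eq_of_homotopy _ _ h, Functor.map_zero, Functor.map_zero] at h1
  rw [← cancel_epi ((quotientCompQhIso C).hom.app K), ← h1]
  simp

lemma homologyMap_eq_zero_of_Q {K L : CochainComplex C ℤ} {f : K ⟶ L} {n : ℤ}
    (h : (homologyFunctor C n).map (Q.map f) = 0) : HomologicalComplex.homologyMap f n = 0 := by
  have h1 := (homologyFunctorFactors C n).hom.naturality f
  simp only [Functor.comp_map] at h1
  rw [h, Limits.zero_comp] at h1
  change (HomologicalComplex.homologyFunctor C (ComplexShape.up ℤ) n).map f = 0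
  rw [← cancel_epi ((homologyFunctorFactors C n).hom.app K), ← h1, Limits.comp_zero]

instance isKInjective_single (I : C) [Injective I] :
    ((CochainComplex.singleFunctor C 0).obj I).IsKInjective := by
  have : ∀ n : ℤ, Injective (((CochainComplex.singleFunctor C 0).obj I).X n) := by
    intro n
    by_cases hn : n = 0
    · subst hn
      exact Injective.of_iso (HomologicalComplex.singleObjXSelf (.up ℤ) 0 I).symm inferInstance
    · have hz := HomologicalComplex.isZero_single_obj_X (.up ℤ) 0 I n hn
      exact ⟨fun g f _ => ⟨0, hz.eq_of_tgt _ _⟩⟩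
  exact CochainComplex.isKInjective_of_injective _ 0

instance isKProjective_single (I : C) [Projective I] :
    ((CochainComplex.singleFunctor C 0).obj I).IsKProjective := by
  have : ∀ n : ℤ, Projective (((CochainComplex.singleFunctor C 0).obj I).X n) := by
    intro n
    by_cases hn : n = 0
    · subst hn
      exact Projective.of_iso (HomologicalComplex.singleObjXSelf (.up ℤ) 0 I).symm inferInstance
    · have hz := HomologicalComplex.isZero_single_obj_X (.up ℤ) 0 I n hn
      exact ⟨fun g f _ => ⟨0, hz.eq_of_src _ _⟩⟩
  exact CochainComplex.isKProjective_of_projective _ 0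

/-- The complex with a single object in degree zero has this object in degree zero. -/
noncomputable def singleXIso (I : C) : ((CochainComplex.singleFunctor C 0).obj I).X 0 ≅ I :=
  HomologicalComplex.singleObjXSelf (.up ℤ) 0 I

open CochainComplex.HomComplex in
lemma Q_map_eq_zero_of_toSingle {K : CochainComplex C ℤ} {I : C}
    (f : K ⟶ (CochainComplex.singleFunctor C 0).obj I) (g : K.X 1 ⟶ I)
    (h : f.f 0 ≫ (singleXIso I).hom = K.d 0 1 ≫ g) :
    Q.map f = (0 : Q.obj K ⟶ _) := by
  refine Q_map_eq_zero_of_homotopy ((Cochain.equivHomotopy f 0).symm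
    ⟨Cochain.toSingleMk g (by norm_num), ?_⟩)
  rw [Cochain.δ_toSingleMk g _ 0 0 (by norm_num)]
  apply (Cochain.toSingleEquiv (add_zero (0 : ℤ))).injective
  rw [← h]
  simp only [Int.negOnePow_zero, one_smul, Cochain.ofHom_zero, add_zero,
    Cochain.toSingleEquiv_toSingleMk]
  exact congrArg (· ≫ (singleXIso I).hom) (Cochain.ofHom_v f 0)

open CochainComplex.HomComplex in
lemma Q_map_eq_zero_of_fromSingle {K : CochainComplex C ℤ} {I : C}
    (f : (CochainComplex.singleFunctor C 0).obj I ⟶ K) (g : I ⟶ K.X (-1))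
    (h : (singleXIso I).inv ≫ f.f 0 = g ≫ K.d (-1) 0) :
    Q.map f = (0 : _ ⟶ Q.obj K) := by
  refine Q_map_eq_zero_of_homotopy ((Cochain.equivHomotopy f 0).symm
    ⟨Cochain.fromSingleMk g (by norm_num), ?_⟩)
  rw [Cochain.δ_fromSingleMk g _ 0 0 (by norm_num)]
  apply (Cochain.fromSingleEquiv (add_zero (0 : ℤ))).injective
  rw [← h]
  simp only [Cochain.ofHom_zero, add_zero, Cochain.fromSingleEquiv_fromSingleMk]
  exact congrArg ((singleXIso I).inv ≫ ·) (Cochain.ofHom_v f 0)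

open CochainComplex.HomComplex in
lemma exists_comp_d_of_Q_map_eq_zero {K : CochainComplex C ℤ} [K.IsKInjective] {I : C}
    (f : (CochainComplex.singleFunctor C 0).obj I ⟶ K) (hf : Q.map f = (0 : _ ⟶ Q.obj K)) :
    ∃ g : I ⟶ K.X (-1), (singleXIso I).inv ≫ f.f 0 = g ≫ K.d (-1) 0 := by
  obtain ⟨h⟩ := homotopy_of_Q_map_eq_zero_of_isKInjective hf
  obtain ⟨z, hz⟩ := Cochain.equivHomotopy f 0 h
  obtain ⟨g, rfl⟩ := Cochain.fromSingleMk_surjective z (-1) (by norm_num)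
  refine ⟨g, ?_⟩
  rw [Cochain.δ_fromSingleMk g _ 0 0 (by norm_num), Cochain.ofHom_zero, add_zero] at hz
  have h2 := congrArg (Cochain.fromSingleEquiv (add_zero (0 : ℤ))) hz
  rw [Cochain.fromSingleEquiv_fromSingleMk] at h2
  exact (congrArg ((singleXIso I).inv ≫ ·) (Cochain.ofHom_v f 0)).symm.trans h2

lemma d_single_eq_zero (I : C) (i j : ℤ) : ((CochainComplex.singleFunctor C 0).obj I).d i j = 0 :=
  HomologicalComplex.single_obj_d (.up ℤ) 0 I i j

lemma isIso_pOpcycles_single (I : C) :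
    IsIso (((CochainComplex.singleFunctor C 0).obj I).pOpcycles 0) :=
  HomologicalComplex.isIso_pOpcycles _ (-1) 0 (by simp) (d_single_eq_zero I _ _)

lemma isIso_homologyπ_single (I : C) :
    IsIso (((CochainComplex.singleFunctor C 0).obj I).homologyπ 0) :=
  HomologicalComplex.isIso_homologyπ _ (-1) 0 (by simp) (d_single_eq_zero I _ _)

lemma isIso_homologyι_single (I : C) :
    IsIso (((CochainComplex.singleFunctor C 0).obj I).homologyι 0) :=
  HomologicalComplex.isIso_homologyι _ 0 1 (by simp) (d_single_eq_zero I _ _)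

lemma Q_map_eq_zero_of_homology_of_injective {K : CochainComplex C ℤ} {I : C} [Injective I]
    (f : K ⟶ (CochainComplex.singleFunctor C 0).obj I)
    (hf : HomologicalComplex.homologyMap f 0 = 0) : Q.map f = (0 : Q.obj K ⟶ _) := by
  have h2 : K.iCycles 0 ≫ f.f 0 = 0 := by
    rw [← HomologicalComplex.cyclesMap_i]
    have := isIso_homologyπ_single I
    have h3 : HomologicalComplex.cyclesMap f 0 = 0 := by
      rw [← cancel_mono (((CochainComplex.singleFunctor C 0).obj I).homologyπ 0),
        ← HomologicalComplex.homologyπ_naturality, hf]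
      simp
    rw [h3, Limits.zero_comp]
  let S : ShortComplex C := ShortComplex.mk (K.iCycles 0) (K.d 0 1) (by simp)
  have hS : S.Exact :=
    S.exact_of_f_is_kernel (K.cyclesIsKernel 0 1 (by simp))
  have h4 : S.f ≫ f.f 0 ≫ (singleXIso I).hom = 0 := by
    change K.iCycles 0 ≫ _ = 0
    rw [reassoc_of% h2, Limits.zero_comp]
  exact Q_map_eq_zero_of_toSingle f (hS.descToInjective _ h4) (hS.comp_descToInjective _ h4).symm

lemma Q_map_eq_zero_of_homology_of_projective {K : CochainComplex C ℤ} {P : C} [Projective P]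
    (f : (CochainComplex.singleFunctor C 0).obj P ⟶ K)
    (hf : HomologicalComplex.homologyMap f 0 = 0) : Q.map f = (0 : _ ⟶ Q.obj K) := by
  have h2 : f.f 0 ≫ K.pOpcycles 0 = 0 := by
    rw [← HomologicalComplex.p_opcyclesMap]
    have := isIso_homologyι_single P
    have h3 : HomologicalComplex.opcyclesMap f 0 = 0 := by
      rw [← cancel_epi (((CochainComplex.singleFunctor C 0).obj P).homologyι 0),
        ← HomologicalComplex.homologyι_naturality, hf]
      simp
    rw [h3, Limits.comp_zero]
  let S : ShortComplex C := ShortComplex.mk (K.d (-1) 0) (K.pOpcycles 0) (by simp)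
  have hS : S.Exact :=
    S.exact_of_g_is_cokernel (K.opcyclesIsCokernel (-1) 0 (by simp))
  have h4 : ((singleXIso P).inv ≫ f.f 0) ≫ S.g = 0 := by
    change (_ ≫ f.f 0) ≫ K.pOpcycles 0 = 0
    rw [Category.assoc, h2, Limits.comp_zero]
  exact Q_map_eq_zero_of_fromSingle f (hS.liftFromProjective _ h4)
    (hS.liftFromProjective_comp _ h4).symm

/-- A morphism to an injective object is zero if it is zero on cohomology. -/
lemma eq_zero_of_homology_of_injective {Y : DerivedCategory C} {I : C} [Injective I]
    (g : Y ⟶ (singleFunctor C 0).obj I) (hg : (homologyFunctor C 0).map g = 0) : g = 0 := by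
  obtain ⟨K, ⟨e⟩⟩ : ∃ K, Nonempty (Q.obj K ≅ Y) := ⟨_, ⟨Q.objObjPreimageIso Y⟩⟩
  let ε : (singleFunctor C 0).obj I ≅ Q.obj ((CochainComplex.singleFunctor C 0).obj I) :=
    (singleFunctorIsoCompQ C 0).app I
  obtain ⟨f, hf⟩ := exists_Q_map_of_isKInjective (e.hom ≫ g ≫ ε.hom)
  have h0 : (homologyFunctor C 0).map (Q.map f) = 0 := by
    rw [hf, Functor.map_comp, Functor.map_comp, hg]; simp
  have h1 := Q_map_eq_zero_of_homology_of_injective f (homologyMap_eq_zero_of_Q h0)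
  rw [← cancel_epi e.hom, ← cancel_mono ε.hom, Category.assoc, ← hf, h1]
  simp

/-- A morphism from a projective object is zero if it is zero on cohomology. -/
lemma eq_zero_of_homology_of_projective {Y : DerivedCategory C} {P : C} [Projective P]
    (g : (singleFunctor C 0).obj P ⟶ Y) (hg : (homologyFunctor C 0).map g = 0) : g = 0 := by
  obtain ⟨K, ⟨e⟩⟩ : ∃ K, Nonempty (Q.obj K ≅ Y) := ⟨_, ⟨Q.objObjPreimageIso Y⟩⟩
  let ε : (singleFunctor C 0).obj P ≅ Q.obj ((CochainComplex.singleFunctor C 0).obj P) :=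
    (singleFunctorIsoCompQ C 0).app P
  obtain ⟨f, hf⟩ := exists_Q_map_of_isKProjective (ε.inv ≫ g ≫ e.inv)
  have h0 : (homologyFunctor C 0).map (Q.map f) = 0 := by
    rw [hf, Functor.map_comp, Functor.map_comp, hg]; simp
  have h1 := Q_map_eq_zero_of_homology_of_projective f (homologyMap_eq_zero_of_Q h0)
  rw [← cancel_epi ε.inv, ← cancel_mono e.inv, Category.assoc, ← hf, h1]
  simp

lemma exists_homologyMap_eq_of_injective {K : CochainComplex C ℤ} {I : C} [Injective I]
    (ψ : K.homology 0 ⟶ ((CochainComplex.singleFunctor C 0).obj I).homology 0) :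
    ∃ f : K ⟶ (CochainComplex.singleFunctor C 0).obj I,
      HomologicalComplex.homologyMap f 0 = ψ := by
  generalize hL : (CochainComplex.singleFunctor C 0).obj I = L at ψ
  have hι : IsIso (L.homologyι 0) := hL ▸ isIso_homologyι_single I
  have hp : IsIso (L.pOpcycles 0) := hL ▸ isIso_pOpcycles_single I
  have hI : Injective (L.X 0) := hL ▸ Injective.of_iso (singleXIso I).symm inferInstance
  let h : K.opcycles 0 ⟶ L.X 0 :=
    Injective.factorThru (ψ ≫ L.homologyι 0 ≫ inv (L.pOpcycles 0)) (K.homologyι 0)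
  have hh : K.homologyι 0 ≫ h = ψ ≫ L.homologyι 0 ≫ inv (L.pOpcycles 0) :=
    Injective.comp_factorThru _ _
  obtain ⟨f, hf⟩ : ∃ f : K ⟶ L, f.f 0 = K.pOpcycles 0 ≫ h := by
    clear_value h
    subst hL
    refine ⟨HomologicalComplex.mkHomToSingle (K.pOpcycles 0 ≫ h ≫ (singleXIso I).hom) (by
      intro i _
      simp), ?_⟩
    refine (HomologicalComplex.mkHomToSingle_f _ _).trans ?_
    change (_ ≫ _ ≫ (singleXIso I).hom) ≫ (singleXIso I).inv = _
    simp
  refine ⟨f, ?_⟩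
  have h5 : HomologicalComplex.opcyclesMap f 0 = h ≫ L.pOpcycles 0 := by
    rw [← cancel_epi (K.pOpcycles 0), HomologicalComplex.p_opcyclesMap, hf, Category.assoc]
  rw [← cancel_mono (L.homologyι 0), HomologicalComplex.homologyι_naturality, h5, reassoc_of% hh]
  simp

lemma exists_homology_map_Q_map {K L : CochainComplex C ℤ}
    (φ : (homologyFunctor C 0).obj (Q.obj K) ⟶ (homologyFunctor C 0).obj (Q.obj L)) :
    ∃ ψ : K.homology 0 ⟶ L.homology 0, ∀ f : K ⟶ L, HomologicalComplex.homologyMap f 0 = ψ →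
      (homologyFunctor C 0).map (Q.map f) = φ := by
  refine ⟨((homologyFunctorFactors C 0).app K).inv ≫ φ ≫ ((homologyFunctorFactors C 0).app L).hom,
    fun f hf => ?_⟩
  have h1 := (homologyFunctorFactors C 0).hom.naturality f
  simp only [Functor.comp_map] at h1
  have h2 : (HomologicalComplex.homologyFunctor C (ComplexShape.up ℤ) 0).map f =
    ((homologyFunctorFactors C 0).app K).inv ≫ φ ≫ ((homologyFunctorFactors C 0).app L).hom := hf
  rw [h2] at h1
  rw [← cancel_mono ((homologyFunctorFactors C 0).hom.app L), h1]
  exact (((homologyFunctorFactors C 0).app K).hom_inv_id_assoc _)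

/-- Morphisms on cohomology to an injective object lift to the derived category. -/
lemma exists_homology_map_eq_of_injective {Y : DerivedCategory C} {I : C} [Injective I]
    (φ : (homologyFunctor C 0).obj Y ⟶ (homologyFunctor C 0).obj ((singleFunctor C 0).obj I)) :
    ∃ g : Y ⟶ (singleFunctor C 0).obj I, (homologyFunctor C 0).map g = φ := by
  obtain ⟨K, ⟨e⟩⟩ : ∃ K, Nonempty (Q.obj K ≅ Y) := ⟨_, ⟨Q.objObjPreimageIso Y⟩⟩
  let ε : (singleFunctor C 0).obj I ≅ Q.obj ((CochainComplex.singleFunctor C 0).obj I) :=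
    (singleFunctorIsoCompQ C 0).app I
  obtain ⟨ψ, hψ⟩ := exists_homology_map_Q_map
    ((homologyFunctor C 0).map e.hom ≫ φ ≫ (homologyFunctor C 0).map ε.hom)
  obtain ⟨f, hf⟩ := exists_homologyMap_eq_of_injective ψ
  refine ⟨e.inv ≫ Q.map f ≫ ε.inv, ?_⟩
  rw [Functor.map_comp, Functor.map_comp, hψ f hf]
  simp only [Category.assoc]
  rw [← Functor.map_comp, ← Functor.map_comp_assoc]
  simp

end DerivedCategory

/-! ### Coinduced modules -/

/-- The coinduced module `Hom_k(R, V)` of a `k`-vector space `V`. -/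
def Coind (k R V : Type u) [Field k] [Ring R] [Algebra k R] [AddCommGroup V] [Module k V] :
    Type u := R →ₗ[k] V

namespace Coind

variable {k R V W : Type u} [Field k] [Ring R] [Algebra k R] [AddCommGroup V] [Module k V]
  [AddCommGroup W] [Module k W]

instance : AddCommGroup (Coind k R V) := inferInstanceAs (AddCommGroup (R →ₗ[k] V))
instance : Module k (Coind k R V) := inferInstanceAs (Module k (R →ₗ[k] V))
instance : FunLike (Coind k R V) R V := inferInstanceAs (FunLike (R →ₗ[k] V) R V)
instance : LinearMapClass (Coind k R V) k R V :=
  inferInstanceAs (LinearMapClass (R →ₗ[k] V) k R V)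
instance [Module.Finite k R] [Module.Finite k V] : Module.Finite k (Coind k R V) :=
  inferInstanceAs (Module.Finite k (R →ₗ[k] V))

@[ext] lemma ext {φ ψ : Coind k R V} (h : ∀ x, φ x = ψ x) : φ = ψ := DFunLike.ext _ _ h

@[simp] lemma zero_apply (x : R) : (0 : Coind k R V) x = 0 := rfl
@[simp] lemma add_apply (φ ψ : Coind k R V) (x : R) : (φ + ψ) x = φ x + ψ x := rfl
@[simp] lemma ksmul_apply (c : k) (φ : Coind k R V) (x : R) : (c • φ) x = c • φ x := rfl

instance : SMul R (Coind k R V) := ⟨fun r φ => (φ : R →ₗ[k] V) ∘ₗ LinearMap.mulRight k r⟩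

@[simp] lemma smul_apply (r : R) (φ : Coind k R V) (x : R) : (r • φ) x = φ (x * r) := rfl

instance : Module R (Coind k R V) where
  one_smul φ := by ext; simp
  mul_smul r s φ := by ext; simp [mul_assoc]
  smul_zero r := by ext; simp
  smul_add r φ ψ := by ext; simp
  add_smul r s φ := by ext; simp [mul_add]
  zero_smul φ := by ext; simp

instance : IsScalarTower k R (Coind k R V) := ⟨fun c r φ => by ext; simp⟩

/-- A `k`-linear map to `V` induces an `R`-linear map to the coinduced module. -/
def lift {N : Type*} [AddCommGroup N] [Module k N] [Module R N] [IsScalarTower k R N]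
    (ψ : N →ₗ[k] V) : N →ₗ[R] Coind k R V where
  toFun n := ψ ∘ₗ (LinearMap.toSpanSingleton R N n).restrictScalars k
  map_add' m n := by ext x; exact (congrArg ψ (smul_add x m n)).trans (map_add ψ _ _)
  map_smul' r n := by ext x; exact congrArg ψ (smul_smul x r n)

@[simp] lemma lift_apply {N : Type*} [AddCommGroup N] [Module k N] [Module R N]
    [IsScalarTower k R N] (ψ : N →ₗ[k] V) (n : N) (x : R) : lift ψ n x = ψ (x • n) := rfl

/-- The coinduced module is functorial. -/
def map (f : V →ₗ[k] W) : Coind k R V →ₗ[R] Coind k R W where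
  toFun φ := f ∘ₗ (φ : R →ₗ[k] V)
  map_add' φ ψ := by ext x; exact map_add f _ _
  map_smul' r φ := by ext x; rfl

instance injective : Module.Injective R (Coind k R V) where
  out X Y _ _ _ _ f hf g := by
    let : Module k X := Module.compHom X (algebraMap k R)
    let : Module k Y := Module.compHom Y (algebraMap k R)
    have : IsScalarTower k R X := ⟨fun c r x => by
      rw [Algebra.smul_def, mul_smul]; rfl⟩
    have : IsScalarTower k R Y := ⟨fun c r x => by
      rw [Algebra.smul_def, mul_smul]; rfl⟩
    let ev : X →ₗ[k] V :=
      { toFun := fun x => g x 1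
        map_add' := fun x y => by simp
        map_smul' := fun c x => by
          have : c • x = (algebraMap k R c) • x := rfl
          rw [this, map_smul, smul_apply, one_mul, RingHom.id_apply, ← mul_one (algebraMap k R c),
            ← Algebra.smul_def, map_smul] }
    obtain ⟨l, hl⟩ := LinearMap.exists_leftInverse_of_injective (f.restrictScalars k)
      (LinearMap.ker_eq_bot.mpr hf)
    refine ⟨lift (ev ∘ₗ l), fun x => ?_⟩
    ext r
    have h2 : l (r • f x) = r • x := by
      rw [← map_smul]; exact LinearMap.congr_fun hl (r • x)
    rw [lift_apply, LinearMap.comp_apply, h2]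
    change g (r • x) 1 = _
    rw [map_smul, smul_apply, one_mul]

instance : Injective (ModuleCat.of R (Coind k R V)) :=
  Module.injective_object_of_injective_module R _ 

end Coind

/-! ### Small objects -/

/-- An object `X` is small if every morphism from `X` to an object `Y` which behaves like a
countable coproduct has only finitely many nonzero components. -/
def IsSmallObject {D : Type*} [Category D] [Limits.HasZeroMorphisms D] (X : D) : Prop :=
  ∀ (Y : D) (e : ℕ → (Y ⟶ Y)), (∀ n, e n ≫ e n = e n) → (∀ m n, m ≠ n → e m ≫ e n = 0) →
    (∀ (Z : D) (g : Y ⟶ Z), (∀ n, e n ≫ g = 0) → g = 0) →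
    ∀ f : X ⟶ Y, {n | f ≫ e n ≠ 0}.Finite

lemma IsSmallObject.map {D D' : Type*} [Category D] [Category D'] [Limits.HasZeroMorphisms D]
    [Limits.HasZeroMorphisms D'] (F : D ⥤ D') [F.IsEquivalence] [F.PreservesZeroMorphisms] {X : D}
    (hX : IsSmallObject X) : IsSmallObject (F.obj X) := by
  intro Y e hidem horth hQ f
  let Y' := F.objPreimage Y
  let ε : F.obj Y' ≅ Y := F.objObjPreimageIso Y
  let e' : ℕ → (Y' ⟶ Y') := fun n => F.preimage (ε.hom ≫ e n ≫ ε.inv)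
  have he' : ∀ n, F.map (e' n) = ε.hom ≫ e n ≫ ε.inv := fun n => F.map_preimage _
  have key := hX Y' e' (fun n => F.map_injective (by simp [he', reassoc_of% hidem n]))
    (fun m n hmn => F.map_injective (by simp [he', reassoc_of% horth m n hmn]))
    (fun Z g hg => F.map_injective (by
      have := hQ _ (ε.inv ≫ F.map g) (fun n => by
        have h := congrArg F.map (hg n)
        rw [F.map_comp, he', F.map_zero] at h
        simpa using congrArg (ε.inv ≫ ·) h)
      simpa using congrArg (ε.hom ≫ ·) this)) (F.preimage (f ≫ ε.inv))
  refine key.subset fun n hn hn' => hn ?_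
  have h := congrArg F.map hn'
  rw [F.map_comp, F.map_preimage, he', F.map_zero] at h
  simpa using congrArg (· ≫ ε.hom) h

namespace DerivedCategory

universe w v' u'

section

variable {C : Type u'} [Category.{v'} C] [Abelian C] [HasDerivedCategory.{w} C]
  [EnoughInjectives C]

/-- Morphisms in the derived category from an object `J` of the heart that behaves like a coproduct
can be tested on the summands. -/
lemma eq_zero_of_summands {J : C} (e : ℕ → (J ⟶ J)) (hidem : ∀ n, e n ≫ e n = e n)
    (hex : ∀ (N : C) (s : ℕ → (J ⟶ N)), ∃ t : J ⟶ N, ∀ n, e n ≫ t = e n ≫ s n)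
    (huniq : ∀ (N : C) (t : J ⟶ N), (∀ n, e n ≫ t = 0) → t = 0)
    {Z : DerivedCategory C} (a : ℤ) [Z.IsGE a] (g : (singleFunctor C 0).obj J ⟶ Z)
    (hg : ∀ n, (singleFunctor C 0).map (e n) ≫ g = 0) : g = 0 := by
  obtain ⟨K, _, ⟨i⟩⟩ := exists_iso_Q_obj_of_isGE Z a
  obtain ⟨L, q, hq1, hq2, hq3⟩ :=
    CochainComplex.Plus.modelCategoryQuillen.exists_quasiIso_injective K a
  have : L.IsKInjective := CochainComplex.isKInjective_of_injective L a
  let ε : (singleFunctor C 0).obj J ≅ Q.obj ((CochainComplex.singleFunctor C 0).obj J) :=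
    (singleFunctorIsoCompQ C 0).app J
  have hε : ∀ n, ε.inv ≫ (singleFunctor C 0).map (e n) =
      Q.map ((CochainComplex.singleFunctor C 0).map (e n)) ≫ ε.inv :=
    fun n => ((singleFunctorIsoCompQ C 0).inv.naturality (e n)).symm
  obtain ⟨f, hf⟩ := exists_Q_map_of_isKInjective (ε.inv ≫ g ≫ i.hom ≫ Q.map q)
  have h1 : ∀ n, Q.map ((CochainComplex.singleFunctor C 0).map (e n) ≫ f) = 0 := by
    intro n
    rw [Q.map_comp, hf, ← reassoc_of% hε n, reassoc_of% hg n]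
    simp
  choose s hs using fun n => exists_comp_d_of_Q_map_eq_zero _ (h1 n)
  have hs' : ∀ n, e n ≫ (singleXIso J).inv ≫ f.f 0 = s n ≫ L.d (-1) 0 := by
    intro n
    rw [← hs n, HomologicalComplex.comp_f, ← Category.assoc, ← Category.assoc]
    congr 1
    rw [← cancel_mono (singleXIso J).hom]
    simp only [Category.assoc, Iso.inv_hom_id, Category.comp_id]
    rw [Iso.eq_inv_comp]
    exact (HomologicalComplex.single_map_f_self (.up ℤ) 0 (e n) =≫ (singleXIso J).hom).trans
      (by
        change ((singleXIso J).hom ≫ e n ≫ (singleXIso J).inv) ≫ (singleXIso J).hom = _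
        simp) |>.symm
  obtain ⟨t, ht⟩ := hex _ s
  have h2 : (singleXIso J).inv ≫ f.f 0 = t ≫ L.d (-1) 0 := by
    rw [← sub_eq_zero]
    refine huniq _ _ fun n => ?_
    rw [Preadditive.comp_sub, reassoc_of% ht n, ← hs' n, reassoc_of% hidem n, sub_self]
  have h3 := Q_map_eq_zero_of_fromSingle f t h2
  rw [h3] at hf
  have : IsIso (Q.map q) := inferInstance
  rw [← cancel_epi ε.inv, ← cancel_mono i.hom, ← cancel_mono (Q.map q)]
  simpa using hf.symm

end

end DerivedCategory

namespace DerivedCategory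

universe w

section

variable {C : Type*} [Category C] [Abelian C] [HasDerivedCategory.{w} C]

/-- An object of an abelian category as an object of its bounded derived category. -/
noncomputable def boundedSingle (M : C) : Bounded C :=
  ⟨(singleFunctor C 0).obj M, ⟨0, inferInstance⟩, ⟨0, inferInstance⟩⟩

end

section

variable {R : Type u} [Ring R] [HasDerivedCategory.{w} (ModuleCat.{u} R)]

/-- Finitely generated projective modules are small in the bounded derived category. -/
lemma isSmallObject_boundedSingle (P : ModuleCat.{u} R) [Projective P] [Module.Finite R P] :
    IsSmallObject (boundedSingle P) := by
  intro Y e hidem horth hQ f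
  let H := homologyFunctor (ModuleCat.{u} R) 0
  let E : ℕ → (H.obj Y.obj ⟶ H.obj Y.obj) := fun n => H.map (e n).hom
  let H' : Submodule R (H.obj Y.obj) := ⨆ n, LinearMap.range (E n).hom
  have hEE : ∀ m n, m ≠ n → E m ≫ E n = 0 := by
    intro m n hmn
    have h := congrArg (fun x => H.map x.hom) (horth m n hmn)
    simpa [E] using h
  have htop : H' = ⊤ := by
    let q : H.obj Y.obj ⟶ ModuleCat.of R (H.obj Y.obj ⧸ H') := ModuleCat.ofHom H'.mkQ
    let I := Injective.under (ModuleCat.of R (H.obj Y.obj ⧸ H'))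
    let j : I ≅ H.obj ((singleFunctor _ 0).obj I) :=
      ((singleFunctorCompHomologyFunctorIso (ModuleCat.{u} R) 0).app I).symm
    obtain ⟨g, hg⟩ := exists_homology_map_eq_of_injective (q ≫ Injective.ι _ ≫ j.hom)
    have hqE : ∀ n, E n ≫ q = 0 := by
      intro n
      ext x
      exact (Submodule.Quotient.mk_eq_zero H').2
        ((le_iSup (fun n => LinearMap.range (E n).hom) n) ⟨x, rfl⟩)
    have h0 : (ObjectProperty.homMk g : Y ⟶ boundedSingle I) = 0 := by
      refine hQ _ _ fun n => ?_
      apply ObjectProperty.hom_ext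
      refine eq_zero_of_homology_of_injective _ ?_
      change H.map ((e n).hom ≫ g) = 0
      rw [H.map_comp, hg]
      change E n ≫ _ = 0
      rw [reassoc_of% hqE n, Limits.zero_comp]
    have h1 : g = 0 := congrArg (fun x => x.hom) h0
    rw [h1, Functor.map_zero] at hg
    have h2 : q = 0 := by
      rw [← cancel_mono (Injective.ι _ ≫ j.hom), ← hg, Limits.zero_comp]
    have h3 : H'.mkQ = 0 := by
      have := congrArg ModuleCat.Hom.hom h2
      exact this
    rw [← H'.ker_mkQ, h3, LinearMap.ker_zero]
  let φ := H.map f.hom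
  have hfin : (LinearMap.range φ.hom).FG := by
    have hP : Module.Finite R (H.obj (boundedSingle P).obj) :=
      Module.Finite.equiv (M := P) (((singleFunctorCompHomologyFunctorIso (ModuleCat.{u} R) 0).app P).symm
        |>.toLinearEquiv)
    exact LinearMap.range_eq_map φ.hom ▸ (hP.fg_top.map φ.hom)
  obtain ⟨s, hs⟩ := CompleteLattice.IsCompactElement.exists_finset_of_le_iSup _
    ((Submodule.fg_iff_compact _).1 hfin) (fun n => LinearMap.range (E n).hom) (by rw [show ⨆ n, _ = H' from rfl, htop]; exact le_top)
  refine s.finite_toSet.subset fun n hn => ?_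
  by_contra hns
  refine hn ?_
  apply ObjectProperty.hom_ext
  refine eq_zero_of_homology_of_projective _ ?_
  change H.map (f.hom ≫ (e n).hom) = 0
  rw [H.map_comp]
  ext x
  have h4 : ⨆ m ∈ s, LinearMap.range (E m).hom ≤ LinearMap.ker (E n).hom := by
    refine iSup₂_le fun m hm => ?_
    rintro _ ⟨y, rfl⟩
    have hmn : m ≠ n := fun h => hns (h ▸ hm)
    exact congrArg (fun t => t.hom y) (hEE m n hmn)
  exact h4 (hs ⟨x, rfl⟩)

end

lemma exists_hom_of_locally_finite {R J N : Type*} [Ring R] [AddCommGroup J] [Module R J]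
    [AddCommGroup N] [Module R N] (e : ℕ → (J →ₗ[R] J))
    (hfin : ∀ x, {n | e n x ≠ 0}.Finite) (hidem : ∀ n x, e n (e n x) = e n x)
    (horth : ∀ m n x, m ≠ n → e m (e n x) = 0) (s : ℕ → (J →ₗ[R] N)) :
    ∃ t : J →ₗ[R] N, ∀ n x, t (e n x) = s n (e n x) := by
  have hfin' : ∀ x, (Function.support fun n => s n (e n x)).Finite := fun x =>
    (hfin x).subset fun n hn h => hn (by simp only [h, map_zero])
  refine ⟨{ toFun := fun x => ∑ᶠ n, s n (e n x), map_add' := ?_, map_smul' := ?_ }, ?_⟩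
  · intro x y
    rw [← finsum_add_distrib (hfin' x) (hfin' y)]
    simp
  · intro r x
    simp only [map_smul, RingHom.id_apply]
    exact (smul_finsum' r (hfin' x)).symm
  · intro n x
    change ∑ᶠ m, s m (e m (e n x)) = _
    rw [finsum_eq_single _ n (fun m hm => by rw [horth m n x hm, map_zero]), hidem]

section

variable {k R : Type u} [Field k] [Ring R] [Algebra k R] [Module.Finite k R]

/-- The idempotent endomorphisms of `Hom_k(R, k^(ℕ))`. -/
noncomputable def Coind.component (k R : Type u) [Field k] [Ring R] [Algebra k R] (n : ℕ) :
    Coind k R (ℕ →₀ k) →ₗ[R] Coind k R (ℕ →₀ k) :=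
  Coind.map (Finsupp.lsingle n ∘ₗ Finsupp.lapply n)

lemma Coind.component_apply (n : ℕ) (φ : Coind k R (ℕ →₀ k)) (x : R) :
    Coind.component k R n φ x = Finsupp.single n (φ x n) := rfl

lemma Coind.exists_support (φ : Coind k R (ℕ →₀ k)) :
    ∃ s : Finset ℕ, ∀ x, (φ x).support ⊆ s := by
  classical
  obtain ⟨t, ht⟩ := (inferInstance : Module.Finite k R).fg_top
  refine ⟨t.biUnion fun x => (φ x).support, fun x => ?_⟩
  have hx : x ∈ Submodule.span k (t : Set R) := ht ▸ Submodule.mem_top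
  induction hx using Submodule.span_induction with
  | mem x hx => exact Finset.subset_biUnion_of_mem (fun x => (φ x).support) hx
  | zero => simp
  | add x y _ _ hx hy =>
    rw [map_add]
    exact Finsupp.support_add.trans (Finset.union_subset hx hy)
  | smul c x _ hx =>
    rw [map_smul]
    exact Finsupp.support_smul.trans hx

lemma Coind.component_finite (φ : Coind k R (ℕ →₀ k)) :
    {n | Coind.component k R n φ ≠ 0}.Finite := by
  obtain ⟨s, hs⟩ := Coind.exists_support φ
  refine s.finite_toSet.subset fun n hn => ?_
  by_contra h
  refine hn ?_
  ext1 x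
  rw [Coind.component_apply, Finsupp.notMem_support_iff.1 fun h' => h (hs x h')]
  simp

lemma Coind.hom_eq_zero_of_component {N : Type*} [AddCommGroup N] [Module R N]
    (t : Coind k R (ℕ →₀ k) →ₗ[R] N) (ht : ∀ n φ, t (Coind.component k R n φ) = 0) : t = 0 := by
  ext φ
  obtain ⟨s, hs⟩ := Coind.exists_support φ
  have : φ = ∑ n ∈ s, Coind.component k R n φ := by
    ext1 x
    have h1 : (∑ n ∈ s, Coind.component k R n φ) x = ∑ n ∈ s, Coind.component k R n φ x :=
      LinearMap.sum_apply s (fun n => (Coind.component k R n φ : R →ₗ[k] (ℕ →₀ k))) x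
    rw [h1]
    simp only [Coind.component_apply]
    exact (Finsupp.sum_of_support_subset _ (hs x) _ (by simp)).symm.trans (Finsupp.sum_single _) |>.symm
  rw [this, map_sum]
  simp [ht]

/-- Small objects of the bounded derived category have finite dimensional cohomology. -/
lemma finite_homology_of_isSmallObject (k : Type u) {R : Type u} [Field k] [Ring R] [Algebra k R]
    [Module.Finite k R] [HasDerivedCategory.{w} (ModuleCat.{u} R)]
    {X : Bounded (ModuleCat.{u} R)} (hX : IsSmallObject X) :
    Module.Finite R ((homologyFunctor (ModuleCat.{u} R) 0).obj X.obj) := by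
  let H := homologyFunctor (ModuleCat.{u} R) 0
  let : Module k (H.obj X.obj) := ModuleCat.moduleOfAlgebraModule _
  have : IsScalarTower k R (H.obj X.obj) := ModuleCat.isScalarTower_of_algebra_moduleCat _
  suffices Module.Finite k (H.obj X.obj) from Module.Finite.of_restrictScalars_finite k R _
  by_contra hinf
  obtain ⟨ψ, hψ⟩ : ∃ ψ : H.obj X.obj →ₗ[k] (ℕ →₀ k), ∀ n, ∃ x, ψ x n ≠ 0 := by
    let b := Module.Basis.ofVectorSpace k (H.obj X.obj)
    have : Infinite (Module.Basis.ofVectorSpaceIndex k (H.obj X.obj)) := by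
      rw [← not_finite_iff_infinite]
      intro h
      exact hinf (Module.Finite.of_basis b)
    let ι := Infinite.natEmbedding (Module.Basis.ofVectorSpaceIndex k (H.obj X.obj))
    refine ⟨Finsupp.lcomapDomain ι ι.injective ∘ₗ b.repr.toLinearMap, fun n => ⟨b (ι n), ?_⟩⟩
    simp
  let J := ModuleCat.of R (Coind k R (ℕ →₀ k))
  let e : ℕ → (J ⟶ J) := fun n => ModuleCat.ofHom (Coind.component k R n)
  have hidem : ∀ n φ, Coind.component k R n (Coind.component k R n φ) = Coind.component k R n φ := by
    intro n φ
    ext1 x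
    simp [Coind.component_apply]
  have horth : ∀ m n φ, m ≠ n → Coind.component k R m (Coind.component k R n φ) = 0 := by
    intro m n φ hmn
    ext1 x
    simp [Coind.component_apply, hmn.symm]
  let S := singleFunctor (ModuleCat.{u} R) 0
  let j : J ≅ H.obj (S.obj J) := ((singleFunctorCompHomologyFunctorIso (ModuleCat.{u} R) 0).app J).symm
  have hj : ∀ n, j.hom ≫ H.map (S.map (e n)) = e n ≫ j.hom := fun n =>
    ((singleFunctorCompHomologyFunctorIso (ModuleCat.{u} R) 0).inv.naturality (e n)).symm
  let φ : H.obj X.obj ⟶ J := ModuleCat.ofHom (Coind.lift ψ)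
  obtain ⟨g, hg⟩ := exists_homology_map_eq_of_injective (φ ≫ j.hom)
  have key := hX (boundedSingle J) (fun n => ObjectProperty.homMk (S.map (e n)))
    (fun n => by
      apply ObjectProperty.hom_ext
      change S.map (e n) ≫ S.map (e n) = S.map (e n)
      rw [← S.map_comp]
      congr 1
      ext φ : 2
      exact hidem n φ)
    (fun m n hmn => by
      apply ObjectProperty.hom_ext
      change S.map (e m) ≫ S.map (e n) = 0
      rw [← S.map_comp, show e m ≫ e n = 0 by ext φ : 2; exact horth n m φ hmn.symm, S.map_zero])
    (fun Z g hg => by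
      apply ObjectProperty.hom_ext
      obtain ⟨a, ha⟩ := Z.property.1
      have : Z.obj.IsGE a := ha
      refine eq_zero_of_summands e (fun n => by ext φ : 2; exact hidem n φ) ?_ ?_ a g.hom
        fun n => congrArg (fun t => t.hom) (hg n)
      · intro N s
        obtain ⟨t, ht⟩ := exists_hom_of_locally_finite (Coind.component k R)
          Coind.component_finite hidem horth (fun n => (s n).hom)
        exact ⟨ModuleCat.ofHom t, fun n => by ext φ : 2; exact ht n φ⟩
      · intro N t ht
        ext φ : 2
        exact LinearMap.congr_fun (Coind.hom_eq_zero_of_component t.hom fun n φ =>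
          congrArg (fun f => f.hom φ) (ht n)) φ)
    (ObjectProperty.homMk g)
  refine Set.infinite_univ (α := ℕ) (key.subset fun n _ h0 => ?_)
  have h1 : g ≫ S.map (e n) = 0 := congrArg (fun t => t.hom) h0
  have h2 : φ ≫ e n = 0 := by
    rw [← cancel_mono j.hom, Category.assoc, ← hj n, ← Category.assoc, ← hg, ← H.map_comp, h1]
    simp
  obtain ⟨x, hx⟩ := hψ n
  have h3 : Coind.component k R n (Coind.lift ψ x) = 0 := congrArg (fun f => f.hom x) h2
  have h4 := congrArg (fun f => f 1 n) h3
  simp only [Coind.component_apply, Coind.lift_apply, one_smul, Finsupp.single_eq_same] at h4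
  exact hx h4

end

end DerivedCategory

/-! ### Euler characteristics -/

section LinearAlgebra

variable {k : Type*} [Field k]

lemma Module.Finite.of_function_exact {A B C : Type*} [AddCommGroup A] [AddCommGroup B]
    [AddCommGroup C] [Module k A] [Module k B] [Module k C] {f : A →ₗ[k] B} {g : B →ₗ[k] C}
    (h : Function.Exact f g) [Module.Finite k A] [Module.Finite k C] : Module.Finite k B := by
  refine ⟨Submodule.fg_of_fg_map_of_fg_inf_ker g (IsNoetherian.noetherian _) ?_⟩
  rw [top_inf_eq, LinearMap.exact_iff.1 h]
  exact Submodule.FG.of_finite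

/-- The alternating sum of the dimensions of a graded vector space. -/
noncomputable def altSum (a : ℤ → ℕ) : ℤ := ∑ᶠ n : ℤ, (n.negOnePow : ℤ) * (a n : ℤ)

lemma altSum_support {a : ℤ → ℕ} (ha : a.support.Finite) :
    (Function.support fun n : ℤ => (n.negOnePow : ℤ) * (a n : ℤ)).Finite :=
  ha.subset fun n hn h => hn (by simp [h])

lemma altSum_eq_of_add {a b c r : ℤ → ℕ} (ha : a.support.Finite) (hc : c.support.Finite)
    (hra : ∀ n, r n ≤ a n) (h : ∀ n, b n + r n + r (n + 1) = a n + c n) :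
    b.support.Finite ∧ altSum b = altSum a + altSum c := by
  have hb : b.support.Finite := (ha.union hc).subset fun n hn => by
    by_contra h'
    simp only [Set.mem_union, Function.mem_support, not_or, not_not] at h'
    have := h n
    exact hn (by omega)
  have hr : r.support.Finite := ha.subset fun n hn h0 => hn (by have := hra n; omega)
  refine ⟨hb, ?_⟩
  let s : ℤ → ℕ := fun n => r (n + 1)
  have hs : s.support.Finite :=
    (hr.preimage (f := fun n : ℤ => n + 1) (fun x _ y _ hxy => by simpa using hxy)).subset
      fun n hn => hn
  have h1 : altSum s = - altSum r := by
    unfold altSum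
    rw [← finsum_comp_equiv (Equiv.addRight (1 : ℤ)) (f := fun n : ℤ => (n.negOnePow : ℤ) * (r n : ℤ)),
      ← finsum_neg_distrib]
    refine finsum_congr fun n => ?_
    simp [s, Int.negOnePow_succ]
  have h2 : altSum b + (altSum r + altSum s) = altSum a + altSum c := by
    unfold altSum
    rw [← finsum_add_distrib (altSum_support hr) (altSum_support hs),
      ← finsum_add_distrib (altSum_support ha) (altSum_support hc), ← finsum_add_distrib
        (altSum_support hb) ((altSum_support hr).union (altSum_support hs) |>.subset
          (Function.support_add _ _))]
    refine finsum_congr fun n => ?_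
    have : (b n : ℤ) + r n + r (n + 1) = a n + c n := by exact_mod_cast h n
    simp only [s]
    linear_combination (n.negOnePow : ℤ) * this
  rw [h1] at h2
  linarith

/-- The Euler characteristic is additive in long exact sequences. -/
theorem altSum_finrank_of_exact {A B C : ℤ → Type*} [∀ n, AddCommGroup (A n)]
    [∀ n, AddCommGroup (B n)] [∀ n, AddCommGroup (C n)] [∀ n, Module k (A n)]
    [∀ n, Module k (B n)] [∀ n, Module k (C n)] (f : ∀ n, A n →ₗ[k] B n) (g : ∀ n, B n →ₗ[k] C n)
    (d : ∀ n, C n →ₗ[k] A (n + 1)) (hfg : ∀ n, Function.Exact (f n) (g n))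
    (hgd : ∀ n, Function.Exact (g n) (d n)) (hdf : ∀ n, Function.Exact (d n) (f (n + 1)))
    [∀ n, Module.Finite k (A n)] [∀ n, Module.Finite k (C n)]
    (hA : (fun n => Module.finrank k (A n)).support.Finite)
    (hC : (fun n => Module.finrank k (C n)).support.Finite) :
    (∀ n, Module.Finite k (B n)) ∧ (fun n => Module.finrank k (B n)).support.Finite ∧
      altSum (fun n => Module.finrank k (B n)) =
        altSum (fun n => Module.finrank k (A n)) + altSum (fun n => Module.finrank k (C n)) := by
  have hB : ∀ n, Module.Finite k (B n) := fun n => Module.Finite.of_function_exact (hfg n)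
  refine ⟨hB, altSum_eq_of_add (r := fun n => Module.finrank k (LinearMap.ker (f n))) hA hC
    (fun n => Submodule.finrank_le _) fun n => ?_⟩
  have h1 := (f n).finrank_range_add_finrank_ker
  have h2 := (g n).finrank_range_add_finrank_ker
  have h3 := (d n).finrank_range_add_finrank_ker
  rw [LinearMap.exact_iff.1 (hfg n)] at h2
  rw [LinearMap.exact_iff.1 (hgd n)] at h3
  have h4 := congrArg (fun S : Submodule k (A (n + 1)) => Module.finrank k S)
    (LinearMap.exact_iff.1 (hdf n))
  beta_reduce at h4
  omega

end LinearAlgebra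

namespace CategoryTheory.Pretriangulated

open Limits

variable (k : Type*) [Field k] {D : Type*} [Category D] [Preadditive D] [Linear k D]
  [HasShift D ℤ] [∀ n : ℤ, (shiftFunctor D n).Additive] [∀ n : ℤ, (shiftFunctor D n).Linear k]
  [HasZeroObject D] [Pretriangulated D]

/-- The morphisms from `X` to all shifts of `Y` form a finite dimensional space. -/
def HomFinite (X Y : D) : Prop :=
  (∀ n : ℤ, Module.Finite k (X ⟶ Y⟦n⟧)) ∧
    (fun n : ℤ => Module.finrank k (X ⟶ Y⟦n⟧)).support.Finite

/-- The Euler characteristic of the morphisms from `X` to the shifts of `Y`. -/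
noncomputable def eulerChar (X Y : D) : ℤ := altSum fun n : ℤ => Module.finrank k (X ⟶ Y⟦n⟧)

variable {k}

lemma exact_rightComp₁₂ (X : D) (T : Triangle D) (hT : T ∈ distTriang D) (n : ℤ) :
    Function.Exact (Linear.rightComp k X (T.mor₁⟦n⟧')) (Linear.rightComp k X (T.mor₂⟦n⟧')) :=
  (ShortComplex.ab_exact_iff_function_exact _).1
    ((preadditiveCoyoneda.obj (Opposite.op X)).homologySequence_exact₂ T hT n)

lemma exact_rightComp₂₃ (X : D) (T : Triangle D) (hT : T ∈ distTriang D) (n : ℤ) :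
    Function.Exact (Linear.rightComp k X (T.mor₂⟦n⟧')) (Linear.rightComp k X
      (T.mor₃⟦n⟧' ≫ (shiftFunctorAdd' D 1 n (n + 1) (by omega)).inv.app _)) := by
  have h := (ShortComplex.ab_exact_iff_function_exact _).1
    ((preadditiveCoyoneda.obj (Opposite.op X)).homologySequence_exact₃ T hT n _ rfl)
  intro x
  refine Iff.trans ?_ (h x)
  exact Eq.congr (preadditiveCoyoneda_homologySequenceδ_apply T n _ rfl (A := Opposite.op X) x).symm
    rfl

lemma exact_rightComp₃₁ (X : D) (T : Triangle D) (hT : T ∈ distTriang D) (n : ℤ) :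
    Function.Exact (Linear.rightComp k X
      (T.mor₃⟦n⟧' ≫ (shiftFunctorAdd' D 1 n (n + 1) (by omega)).inv.app _))
      (Linear.rightComp k X (T.mor₁⟦n + 1⟧')) := by
  have h := (ShortComplex.ab_exact_iff_function_exact _).1
    ((preadditiveCoyoneda.obj (Opposite.op X)).homologySequence_exact₁ T hT n _ rfl)
  intro x
  refine (h x).trans ?_
  refine exists_congr fun y => ?_
  exact Eq.congr (preadditiveCoyoneda_homologySequenceδ_apply T n _ rfl (A := Opposite.op X) y) rfl

/-- Additivity of the Euler characteristic in the second variable. -/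
theorem eulerChar_triangle_right (X : D) (T : Triangle D) (hT : T ∈ distTriang D)
    (h₁ : HomFinite k X T.obj₁) (h₃ : HomFinite k X T.obj₃) :
    HomFinite k X T.obj₂ ∧ eulerChar k X T.obj₂ = eulerChar k X T.obj₁ + eulerChar k X T.obj₃ := by
  have := h₁.1
  have := h₃.1
  have h := altSum_finrank_of_exact _ _ _ (exact_rightComp₁₂ (k := k) X T hT)
    (exact_rightComp₂₃ X T hT) (exact_rightComp₃₁ X T hT) h₁.2 h₃.2
  exact ⟨⟨h.1, h.2.1⟩, h.2.2⟩

/-- The connecting map of the contravariant long exact sequence. -/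
noncomputable def leftConnecting (T : Triangle D) (I : D) (n : ℤ) :
    (T.obj₁ ⟶ I⟦n⟧) →ₗ[k] (T.obj₃ ⟶ I⟦n + 1⟧) :=
  Linear.rightComp k _ ((shiftFunctorAdd' D n 1 (n + 1) rfl).inv.app I) ∘ₗ
    Linear.leftComp k _ T.mor₃ ∘ₗ (shiftFunctor D (1 : ℤ)).mapLinearMap k

lemma leftConnecting_apply (T : Triangle D) (I : D) (n : ℤ) (x : T.obj₁ ⟶ I⟦n⟧) :
    leftConnecting (k := k) T I n x =
      (T.mor₃ ≫ x⟦(1 : ℤ)⟧') ≫ (shiftFunctorAdd' D n 1 (n + 1) rfl).inv.app I := rfl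

lemma exact_leftComp₂₁ (I : D) (T : Triangle D) (hT : T ∈ distTriang D) (n : ℤ) :
    Function.Exact (Linear.leftComp k (I⟦n⟧) T.mor₂) (Linear.leftComp k (I⟦n⟧) T.mor₁) := by
  intro x
  constructor
  · intro hx
    obtain ⟨g, hg⟩ := T.yoneda_exact₂ hT x hx
    exact ⟨g, hg.symm⟩
  · rintro ⟨g, rfl⟩
    change T.mor₁ ≫ T.mor₂ ≫ g = 0
    rw [comp_distTriang_mor_zero₁₂_assoc _ hT, zero_comp]

lemma exact_leftComp_connecting (I : D) (T : Triangle D) (hT : T ∈ distTriang D) (n : ℤ) :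
    Function.Exact (Linear.leftComp k (I⟦n⟧) T.mor₁) (leftConnecting (k := k) T I n) := by
  intro x
  rw [leftConnecting_apply]
  constructor
  · intro hx
    have h0 : T.mor₃ ≫ x⟦(1 : ℤ)⟧' = 0 := by
      rw [← cancel_mono ((shiftFunctorAdd' D n 1 (n + 1) rfl).inv.app I), hx, zero_comp]
    obtain ⟨g, hg⟩ := Triangle.yoneda_exact₃ _ (rot_of_distTriang _ hT) (x⟦(1 : ℤ)⟧') h0
    obtain ⟨g', rfl⟩ : ∃ g' : T.obj₂ ⟶ I⟦n⟧, (shiftFunctor D (1 : ℤ)).map g' = g :=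
      (shiftFunctor D (1 : ℤ)).map_surjective g
    refine ⟨-g', (shiftFunctor D (1 : ℤ)).map_injective ?_⟩
    change (shiftFunctor D (1 : ℤ)).map (T.mor₁ ≫ (-g')) = _
    rw [hg]
    change _ = (-(shiftFunctor D (1 : ℤ)).map T.mor₁) ≫ (shiftFunctor D (1 : ℤ)).map g'
    simp
  · rintro ⟨g, rfl⟩
    change (T.mor₃ ≫ (shiftFunctor D (1 : ℤ)).map (T.mor₁ ≫ g)) ≫ _ = 0
    rw [Functor.map_comp, comp_distTriang_mor_zero₃₁_assoc _ hT, zero_comp, zero_comp]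

lemma exact_connecting_leftComp (I : D) (T : Triangle D) (hT : T ∈ distTriang D) (n : ℤ) :
    Function.Exact (leftConnecting (k := k) T I n) (Linear.leftComp k (I⟦n + 1⟧) T.mor₂) := by
  intro x
  constructor
  · intro hx
    obtain ⟨g, hg⟩ := T.yoneda_exact₃ hT x hx
    obtain ⟨g', hg'⟩ := (shiftFunctor D (1 : ℤ)).map_surjective
      (g ≫ (shiftFunctorAdd' D n 1 (n + 1) rfl).hom.app I)
    refine ⟨g', ?_⟩
    rw [leftConnecting_apply, hg']
    simp [hg]
  · rintro ⟨g, rfl⟩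
    rw [leftConnecting_apply]
    change T.mor₂ ≫ _ = 0
    rw [Category.assoc, comp_distTriang_mor_zero₂₃_assoc _ hT, zero_comp]

/-- Additivity of the Euler characteristic in the first variable. -/
theorem eulerChar_triangle_left (I : D) (T : Triangle D) (hT : T ∈ distTriang D)
    (h₁ : HomFinite k T.obj₁ I) (h₃ : HomFinite k T.obj₃ I) :
    HomFinite k T.obj₂ I ∧ eulerChar k T.obj₂ I = eulerChar k T.obj₁ I + eulerChar k T.obj₃ I := by
  have := h₁.1
  have := h₃.1
  have h := altSum_finrank_of_exact _ _ _ (exact_leftComp₂₁ (k := k) I T hT)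
    (exact_leftComp_connecting I T hT) (exact_connecting_leftComp I T hT) h₃.2 h₁.2
  exact ⟨⟨h.1, h.2.1⟩, h.2.2.trans (add_comm _ _)⟩

end CategoryTheory.Pretriangulated

lemma altSum_shift (b : ℤ → ℕ) (a : ℤ) :
    altSum (fun n => b (n + a)) = (a.negOnePow : ℤ) * altSum b := by
  unfold altSum
  rw [← finsum_comp_equiv (Equiv.addRight a) (f := fun n : ℤ => (n.negOnePow : ℤ) * (b n : ℤ))]
  rcases Int.units_eq_one_or a.negOnePow with h | h
  · simp [Int.negOnePow_add, h]
  · simp [Int.negOnePow_add, h, finsum_neg_distrib]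

lemma support_shift_finite {b : ℤ → ℕ} (hb : b.support.Finite) (a : ℤ) :
    (fun n => b (n + a)).support.Finite :=
  (hb.preimage (f := fun n : ℤ => n + a) (fun x _ y _ hxy => by simpa using hxy)).subset
    fun _ hn => hn

namespace CategoryTheory.Pretriangulated

open Limits

variable {k : Type*} [Field k] {D : Type*} [Category D] [Preadditive D] [Linear k D]
  [HasShift D ℤ] [∀ n : ℤ, (shiftFunctor D n).Additive] [∀ n : ℤ, (shiftFunctor D n).Linear k]
  [HasZeroObject D] [Pretriangulated D]

variable (k) in
/-- Postcomposition with an isomorphism, as a linear equivalence. -/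
noncomputable def homCongrLinear {X X' Y Y' : D} (e : X ≅ X') (f : Y ≅ Y') :
    (X ⟶ Y) ≃ₗ[k] (X' ⟶ Y') where
  toFun g := e.inv ≫ g ≫ f.hom
  invFun g := e.hom ≫ g ≫ f.inv
  map_add' := by simp
  map_smul' := by simp
  left_inv g := by simp
  right_inv g := by simp

lemma HomFinite.of_equiv {X Y X' Y' : D} (e : ∀ n : ℤ, Nonempty ((X ⟶ Y⟦n⟧) ≃ₗ[k] (X' ⟶ Y'⟦n⟧)))
    (h : HomFinite k X Y) : HomFinite k X' Y' ∧ eulerChar k X' Y' = eulerChar k X Y := by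
  have h1 : (fun n : ℤ => Module.finrank k (X' ⟶ Y'⟦n⟧)) = fun n : ℤ => Module.finrank k (X ⟶ Y⟦n⟧) :=
    funext fun n => (e n).some.finrank_eq.symm
  refine ⟨⟨fun n => ?_, h1 ▸ h.2⟩, by unfold eulerChar; rw [h1]⟩
  have := h.1 n
  exact Module.Finite.equiv (e n).some

lemma HomFinite.of_iso_right {X Y Y' : D} (e : Y ≅ Y') (h : HomFinite k X Y) :
    HomFinite k X Y' ∧ eulerChar k X Y' = eulerChar k X Y :=
  h.of_equiv fun n => ⟨homCongrLinear k (Iso.refl X) ((shiftFunctor D n).mapIso e)⟩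

lemma HomFinite.of_iso_left {X X' Y : D} (e : X ≅ X') (h : HomFinite k X Y) :
    HomFinite k X' Y ∧ eulerChar k X' Y = eulerChar k X Y :=
  h.of_equiv fun _ => ⟨homCongrLinear k e (Iso.refl _)⟩

lemma HomFinite.of_equiv_shift {X Y X' Y' : D} (a : ℤ)
    (e : ∀ n : ℤ, Nonempty ((X ⟶ Y⟦n + a⟧) ≃ₗ[k] (X' ⟶ Y'⟦n⟧))) (h : HomFinite k X Y) :
    HomFinite k X' Y' ∧ eulerChar k X' Y' = (a.negOnePow : ℤ) * eulerChar k X Y := by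
  have h1 : (fun n : ℤ => Module.finrank k (X' ⟶ Y'⟦n⟧)) =
      fun n : ℤ => Module.finrank k (X ⟶ Y⟦n + a⟧) :=
    funext fun n => (e n).some.finrank_eq.symm
  refine ⟨⟨fun n => ?_, h1 ▸ support_shift_finite h.2 a⟩, ?_⟩
  · have := h.1 (n + a)
    exact Module.Finite.equiv (e n).some
  · unfold eulerChar
    rw [h1, ← altSum_shift]

lemma HomFinite.shift_right {X Y : D} (h : HomFinite k X Y) (a : ℤ) :
    HomFinite k X (Y⟦a⟧) ∧ eulerChar k X (Y⟦a⟧) = (a.negOnePow : ℤ) * eulerChar k X Y :=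
  h.of_equiv_shift a fun n => ⟨homCongrLinear k (Iso.refl X)
    ((shiftFunctorAdd' D a n (n + a) (add_comm _ _)).app Y)⟩

variable (k) in
/-- Shifting both arguments, as a linear equivalence. -/
noncomputable def homShiftLinear (X Y : D) (a : ℤ) : (X ⟶ Y) ≃ₗ[k] (X⟦a⟧ ⟶ Y⟦a⟧) :=
  LinearEquiv.ofBijective ((shiftFunctor D a).mapLinearMap k)
    ⟨(shiftFunctor D a).map_injective, (shiftFunctor D a).map_surjective⟩

variable (k) in
/-- Moving a shift from the target to the source, as a linear equivalence. -/
noncomputable def homUnshiftLinear (X Y : D) (a m n : ℤ) (h : m + a = n) :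
    (X ⟶ Y⟦m⟧) ≃ₗ[k] (X⟦a⟧ ⟶ Y⟦n⟧) :=
  homShiftLinear k X (Y⟦m⟧) a ≪≫ₗ
    homCongrLinear k (Iso.refl _) ((shiftFunctorAdd' D m a n h).symm.app Y)

lemma HomFinite.shift_left {X Y : D} (h : HomFinite k X Y) (a : ℤ) :
    HomFinite k (X⟦a⟧) Y ∧ eulerChar k (X⟦a⟧) Y = (a.negOnePow : ℤ) * eulerChar k X Y := by
  have := h.of_equiv_shift (X' := X⟦a⟧) (Y' := Y) (-a) fun n =>
    ⟨homUnshiftLinear k X Y a (n + -a) n (by omega)⟩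
  rwa [Int.negOnePow_neg] at this

end CategoryTheory.Pretriangulated

namespace DerivedCategory

universe w

open Pretriangulated

section

variable {R : Type u} [Ring R]

lemma finite_of_exact [IsNoetherianRing R] {S : ShortComplex (ModuleCat.{u} R)} (hS : S.Exact)
    (h₁ : Module.Finite R S.X₁) (h₃ : Module.Finite R S.X₃) : Module.Finite R S.X₂ := by
  refine ⟨Submodule.fg_of_fg_map_of_fg_inf_ker S.g.hom (IsNoetherian.noetherian _) ?_⟩
  rw [top_inf_eq, ← S.moduleCat_exact_iff_range_eq_ker.1 hS, LinearMap.range_eq_map]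
  exact h₁.fg_top.map _

lemma finite_of_isZero {M : ModuleCat.{u} R} (h : Limits.IsZero M) : Module.Finite R M := by
  have := ModuleCat.subsingleton_of_isZero h
  infer_instance

variable [HasDerivedCategory.{w} (ModuleCat.{u} R)]

/-- The cohomology modules of `X` are finitely generated. -/
def FiniteCohomology (X : DerivedCategory (ModuleCat.{u} R)) : Prop :=
  ∀ n, Module.Finite R ((homologyFunctor (ModuleCat.{u} R) n).obj X)

/-- The triangle of a submodule. -/
lemma exists_triangle_of_submodule {M : Type u} [AddCommGroup M] [Module R M]
    (N : Submodule R M) : ∃ T ∈ distTriang (DerivedCategory (ModuleCat.{u} R)),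
      T.obj₁ = (singleFunctor _ 0).obj (ModuleCat.of R N) ∧
      T.obj₂ = (singleFunctor _ 0).obj (ModuleCat.of R M) ∧
      T.obj₃ = (singleFunctor _ 0).obj (ModuleCat.of R (M ⧸ N)) := by
  let S : ShortComplex (ModuleCat.{u} R) :=
    ShortComplex.mk (ModuleCat.ofHom N.subtype) (ModuleCat.ofHom N.mkQ)
      (by ext x; simp)
  have hS : S.ShortExact := ModuleCat.shortComplex_shortExact S
    (LinearMap.exact_subtype_mkQ N) N.injective_subtype N.mkQ_surjective
  exact ⟨hS.singleTriangle, hS.singleTriangle_distinguished, rfl, rfl, rfl⟩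

variable {P : DerivedCategory (ModuleCat.{u} R) → Prop}

/-- Dévissage for modules of finite length. -/
lemma prop_single_of_isFiniteLength
    (htri : ∀ T ∈ distTriang (DerivedCategory (ModuleCat.{u} R)), P T.obj₁ → P T.obj₃ → P T.obj₂)
    (hzero : ∀ X, Limits.IsZero X → P X)
    (hsimple : ∀ S : ModuleCat.{u} R, IsSimpleModule R S → P ((singleFunctor _ 0).obj S))
    {M : Type u} [AddCommGroup M] [Module R M] (hM : IsFiniteLength R M) :
    P ((singleFunctor _ 0).obj (ModuleCat.of R M)) := by
  induction hM with
  | of_subsingleton =>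
    exact hzero _ (Functor.map_isZero _ (ModuleCat.isZero_of_subsingleton _))
  | @of_simple_quotient M _ _ N hs _ ih =>
    obtain ⟨T, hT, h₁, h₂, h₃⟩ := exists_triangle_of_submodule N
    rw [← h₂]
    exact htri T hT (h₁ ▸ ih) (h₃ ▸ hsimple _ hs)

/-- Dévissage for bounded complexes with finitely generated cohomology. -/
theorem prop_of_finiteCohomology [IsNoetherianRing R] [IsArtinianRing R]
    (hiso : ∀ {X Y}, (X ≅ Y) → P X → P Y)
    (htri : ∀ T ∈ distTriang (DerivedCategory (ModuleCat.{u} R)), P T.obj₁ → P T.obj₃ → P T.obj₂)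
    (hshift : ∀ X (n : ℤ), P X → P (X⟦n⟧))
    (hzero : ∀ X, Limits.IsZero X → P X)
    (hsimple : ∀ S : ModuleCat.{u} R, IsSimpleModule R S → P ((singleFunctor _ 0).obj S))
    (X : DerivedCategory (ModuleCat.{u} R)) (hX : FiniteCohomology X) (a b : ℤ) [X.IsGE a]
    [X.IsLE b] : P X := by
  obtain ⟨n, hn⟩ : ∃ n : ℕ, b < a + n := ⟨(b - a + 1).toNat, by omega⟩
  have hle : X.IsLE (a + n - 1) := TStructure.t.isLE_of_le X b (a + n - 1) (by omega)
  clear hn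
  rename_i _ hb
  clear hb
  induction n generalizing X a with
  | zero =>
    have : X.IsLE (a - 1) := by simpa using hle
    exact hzero _ (TStructure.t.isZero X (a - 1) a (by omega))
  | succ n ih =>
    obtain ⟨X', X'', hX', hX'', f, g, h, hT⟩ := TStructure.t.exists_triangle X a (a + 1) rfl
    have hX' : X'.IsLE a := ⟨hX'⟩
    have hX'' : X''.IsGE (a + 1) := ⟨hX''⟩
    have hge : X'.IsGE a := by
      rw [isGE_iff]
      intro i hi
      exact (HomologySequence.exact₁ _ hT (i - 1) i (by omega)).isZero_of_both_zeros
        ((isZero_of_isGE X'' (a + 1) (i - 1) (by omega)).eq_of_src _ _)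
        ((isZero_of_isGE X a i hi).eq_of_tgt _ _)
    have hle'' : X''.IsLE (a + 1 + n - 1) := by
      rw [isLE_iff]
      intro i hi
      exact (HomologySequence.exact₃ _ hT i (i + 1) rfl).isZero_of_both_zeros
        ((isZero_of_isLE X (a + (n + 1 : ℕ) - 1) i (by push_cast; omega)).eq_of_src _ _)
        ((isZero_of_isLE X' a (i + 1) (by omega)).eq_of_tgt _ _)
    have hf' : FiniteCohomology X' := by
      intro i
      rcases lt_or_ge a i with hi | hi
      · exact finite_of_isZero (isZero_of_isLE X' a i hi)
      · exact finite_of_exact (HomologySequence.exact₁ _ hT (i - 1) i (by omega))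
          (finite_of_isZero (isZero_of_isGE X'' (a + 1) (i - 1) (by omega))) (hX i)
    have hf'' : FiniteCohomology X'' := by
      intro i
      rcases lt_or_ge i (a + 1) with hi | hi
      · exact finite_of_isZero (isZero_of_isGE X'' (a + 1) i hi)
      · exact finite_of_exact (HomologySequence.exact₃ _ hT i (i + 1) rfl) (hX i)
          (finite_of_isZero (isZero_of_isLE X' a (i + 1) (by omega)))
    refine htri _ hT ?_ (ih X'' hf'' (a + 1) hle'')
    obtain ⟨M, ⟨e⟩⟩ := exists_iso_singleFunctor_obj_of_isGE_of_isLE X' a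
    have hM : Module.Finite R M := by
      have := hf' a
      exact Module.Finite.equiv ((homologyFunctor _ a).mapIso e ≪≫
        (singleFunctorCompHomologyFunctorIso (ModuleCat.{u} R) a).app M).toLinearEquiv
    have hl : IsFiniteLength R M :=
      isFiniteLength_iff_isNoetherian_isArtinian.2 ⟨inferInstance, inferInstance⟩
    have hp := prop_single_of_isFiniteLength htri hzero hsimple hl
    exact hiso (((singleFunctors (ModuleCat.{u} R)).shiftIso (-a) a 0 (by omega)).app M ≪≫ e.symm)
      (hshift _ (-a) hp)

end

end DerivedCategory

lemma altSum_eq_of_concentrated {a : ℤ → ℕ} (h : ∀ n, n ≠ 0 → a n = 0) :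
    a.support.Finite ∧ altSum a = a 0 := by
  refine ⟨(Set.finite_singleton (0 : ℤ)).subset fun n hn => by_contra fun h' => hn (h n h'), ?_⟩
  unfold altSum
  rw [finsum_eq_single _ 0 fun n hn => by simp [h n hn]]
  simp

namespace CategoryTheory.Pretriangulated

variable {k : Type*} [Field k] {D : Type*} [Category D] [Preadditive D] [Linear k D]
  [HasShift D ℤ] [∀ n : ℤ, (shiftFunctor D n).Additive] [∀ n : ℤ, (shiftFunctor D n).Linear k]
  [Limits.HasZeroObject D] [Pretriangulated D]

lemma HomFinite.of_concentrated {X Y : D} (h : ∀ n : ℤ, n ≠ 0 → ∀ f : X ⟶ Y⟦n⟧, f = 0)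
    [Module.Finite k (X ⟶ Y)] :
    HomFinite k X Y ∧ eulerChar k X Y = Module.finrank k (X ⟶ Y) := by
  let e : (X ⟶ Y) ≃ₗ[k] (X ⟶ Y⟦(0 : ℤ)⟧) :=
    homCongrLinear k (Iso.refl X) ((shiftFunctorZero D ℤ).symm.app Y)
  have hsub : ∀ n : ℤ, n ≠ 0 → Subsingleton (X ⟶ Y⟦n⟧) := fun n hn =>
    ⟨fun f g => (h n hn f).trans (h n hn g).symm⟩
  have h0 := altSum_eq_of_concentrated (a := fun n : ℤ => Module.finrank k (X ⟶ Y⟦n⟧))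
    fun n hn => by
      have := hsub n hn
      exact Module.finrank_zero_of_subsingleton
  refine ⟨⟨fun n => ?_, h0.1⟩, ?_⟩
  · by_cases hn : n = 0
    · subst hn
      exact Module.Finite.equiv e
    · have := hsub n hn
      infer_instance
  · unfold eulerChar
    rw [h0.2, e.finrank_eq]

lemma HomFinite.of_isZero_right {X Y : D} (h : Limits.IsZero Y) :
    HomFinite k X Y ∧ eulerChar k X Y = 0 := by
  have hs : Subsingleton (X ⟶ Y) := ⟨fun f g => h.eq_of_tgt _ _⟩
  have h1 := HomFinite.of_concentrated (k := k) (X := X) (Y := Y)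
    fun n _ f => (Functor.map_isZero (shiftFunctor D n) h).eq_of_tgt _ _
  rw [Module.finrank_zero_of_subsingleton] at h1
  exact_mod_cast h1

lemma HomFinite.of_isZero_left {X Y : D} (h : Limits.IsZero X) :
    HomFinite k X Y ∧ eulerChar k X Y = 0 := by
  have hs : Subsingleton (X ⟶ Y) := ⟨fun f g => h.eq_of_src _ _⟩
  have h1 := HomFinite.of_concentrated (k := k) (X := X) (Y := Y) fun n _ f => h.eq_of_src _ _
  rw [Module.finrank_zero_of_subsingleton] at h1
  exact_mod_cast h1

end CategoryTheory.Pretriangulated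

open ModuleCat in
lemma ModuleCat.hom_smul_apply_algebraMap (k : Type u) {R : Type u} [Field k] [Ring R]
    [Algebra k R] {M N : ModuleCat.{u} R} (c : k) (f : M ⟶ N) (x : M) :
    (c • f).hom x = algebraMap k R c • f.hom x :=
  (algebraMap_smul R c (f.hom x)).symm

namespace DerivedCategory

universe w

open Pretriangulated

section

variable {C : Type*} [Category C] [Abelian C] [HasDerivedCategory.{w} C]

/-- Cohomology of a shift. -/
noncomputable def homologyShiftIso (X : DerivedCategory C) (n a b : ℤ) (h : n + a = b) :
    (homologyFunctor C a).obj (X⟦n⟧) ≅ (homologyFunctor C b).obj X :=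
  ((homologyFunctor C 0).shiftIso n a b h).app X

lemma isZero_homology_single (M : C) (n : ℤ) (hn : n ≠ 0) :
    Limits.IsZero ((homologyFunctor C n).obj ((singleFunctor C 0).obj M)) := by
  rcases lt_or_gt_of_ne hn with h | h
  · exact isZero_of_isGE _ 0 n h
  · exact isZero_of_isLE _ 0 n h

lemma eq_zero_of_isZero_homology_of_projective {Y : DerivedCategory C} {P : C} [Projective P]
    (n : ℤ) (h : Limits.IsZero ((homologyFunctor C n).obj Y))
    (f : (singleFunctor C 0).obj P ⟶ Y⟦n⟧) : f = 0 :=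
  eq_zero_of_homology_of_projective _
    ((h.of_iso (homologyShiftIso Y n 0 n (add_zero n))).eq_of_tgt _ _)

lemma eq_zero_of_isZero_homology_of_injective {Y : DerivedCategory C} {I : C} [Injective I]
    (n : ℤ) (h : Limits.IsZero ((homologyFunctor C (-n)).obj Y))
    (f : Y ⟶ ((singleFunctor C 0).obj I)⟦n⟧) : f = 0 := by
  have h1 : (shiftFunctor (DerivedCategory C) (-n)).map f ≫
      (shiftFunctorCompIsoId (DerivedCategory C) n (-n) (by omega)).hom.app _ = 0 :=
    eq_zero_of_homology_of_injective _
      ((h.of_iso (homologyShiftIso Y (-n) 0 (-n) (add_zero _))).eq_of_src _ _)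
  rw [Preadditive.IsIso.comp_right_eq_zero] at h1
  exact (shiftFunctor (DerivedCategory C) (-n)).map_injective (by rw [h1, Functor.map_zero])

end

section

variable (k : Type u) {R : Type u} [Field k] [Ring R] [Algebra k R] [Module.Finite k R]

open ModuleCat in
lemma finite_hom (M N : ModuleCat.{u} R) [Module.Finite R M] [Module.Finite R N] :
    Module.Finite k (M ⟶ N) := by
  have : Module.Finite k M := Module.Finite.trans R M
  have : Module.Finite k N := Module.Finite.trans R N
  let f : (M ⟶ N) →ₗ[k] (M →ₗ[k] N) :=
    { toFun := fun g => g.hom.restrictScalars k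
      map_add' := fun _ _ => rfl
      map_smul' := fun _ _ => rfl }
  refine Module.Finite.of_injective f fun g g' h => ?_
  ext x
  exact LinearMap.congr_fun h x

variable [HasDerivedCategory.{w} (ModuleCat.{u} R)]

/-- The fully faithful embedding of modules, as a linear equivalence on morphisms. -/
noncomputable def singleHomLinear (M N : ModuleCat.{u} R) : (M ⟶ N) ≃ₗ[k]
    ((singleFunctor (ModuleCat.{u} R) 0).obj M ⟶ (singleFunctor (ModuleCat.{u} R) 0).obj N) :=
  LinearEquiv.ofBijective ((singleFunctor (ModuleCat.{u} R) 0).mapLinearMap k)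
    ⟨(singleFunctor (ModuleCat.{u} R) 0).map_injective,
      (singleFunctor (ModuleCat.{u} R) 0).map_surjective⟩

lemma homFinite_single_injective (N I : ModuleCat.{u} R) [Injective I] [Module.Finite R N]
    [Module.Finite R I] :
    HomFinite k ((singleFunctor _ 0).obj N) ((singleFunctor _ 0).obj I) ∧
      eulerChar k ((singleFunctor _ 0).obj N) ((singleFunctor _ 0).obj I) =
        Module.finrank k (N ⟶ I) := by
  have := finite_hom k N I
  have := Module.Finite.equiv (singleHomLinear k N I)
  rw [(singleHomLinear k N I).finrank_eq]
  exact HomFinite.of_concentrated fun n hn f => eq_zero_of_isZero_homology_of_injective n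
    (isZero_homology_single N (-n) (by omega)) f

variable [IsNoetherianRing R] [IsArtinianRing R]

/-- Dévissage of the finiteness of morphisms into an injective module. -/
lemma homFinite_injective (I : ModuleCat.{u} R) [Injective I] [Module.Finite R I]
    (Y : DerivedCategory (ModuleCat.{u} R)) (hY : FiniteCohomology Y) (a b : ℤ) [Y.IsGE a]
    [Y.IsLE b] : HomFinite k Y ((singleFunctor _ 0).obj I) := by
  refine prop_of_finiteCohomology (P := fun Y => HomFinite k Y ((singleFunctor _ 0).obj I))
    (fun e h => (h.of_iso_left e).1) (fun T hT h₁ h₃ => (eulerChar_triangle_left _ T hT h₁ h₃).1)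
    (fun X n h => (h.shift_left n).1) (fun X hX => (HomFinite.of_isZero_left hX).1)
    (fun S hS => (homFinite_single_injective k S I).1) Y hY a b

/-- Extension spaces of finite modules are finite dimensional. -/
lemma finite_hom_shift_single (Y : DerivedCategory (ModuleCat.{u} R)) (hY : FiniteCohomology Y)
    (a b : ℤ) [Y.IsGE a] [Y.IsLE b] (N : Type u) [AddCommGroup N] [Module R N] [Module.Finite R N]
    (n : ℤ) : Module.Finite k (Y ⟶ ((singleFunctor _ 0).obj (ModuleCat.of R N))⟦n⟧) := by
  obtain ⟨m, hm⟩ : ∃ m : ℕ, n < -b + m := ⟨(n + b + 1).toNat, by omega⟩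
  induction m generalizing n N with
  | zero =>
    have h1 : (((singleFunctor (ModuleCat.{u} R) 0).obj (ModuleCat.of R N))⟦n⟧).IsGE (-n) :=
      TStructure.t.isGE_shift _ 0 n (-n) (by omega)
    have : Subsingleton (Y ⟶ ((singleFunctor _ 0).obj (ModuleCat.of R N))⟦n⟧) :=
      ⟨fun f g => (TStructure.t.zero f b (-n) (by push_cast at hm; omega)).trans
        (TStructure.t.zero g b (-n) (by push_cast at hm; omega)).symm⟩
    infer_instance
  | succ m ih =>
    let : Module k N := Module.compHom N (algebraMap k R)
    have : IsScalarTower k R N := ⟨fun c r x => by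
      rw [Algebra.smul_def, mul_smul]; rfl⟩
    have : Module.Finite k N := Module.Finite.trans R N
    let S : ShortComplex (ModuleCat.{u} R) :=
      ShortComplex.mk (ModuleCat.ofHom (Coind.lift (LinearMap.id : N →ₗ[k] N)))
        (ModuleCat.ofHom (LinearMap.range (Coind.lift (R := R) (LinearMap.id : N →ₗ[k] N))).mkQ)
        (by ext x; simp)
    have hinj : Function.Injective (Coind.lift (R := R) (LinearMap.id : N →ₗ[k] N)) := by
      intro x y h
      simpa using congrArg (fun φ => φ 1) h
    have hS : S.ShortExact := ModuleCat.shortComplex_shortExact S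
      (LinearMap.exact_iff.2 (Submodule.ker_mkQ _)) hinj (Submodule.mkQ_surjective _)
    have : Module.Finite R (Coind k R N) := Module.Finite.of_restrictScalars_finite k R _
    have h1 := homFinite_injective k (ModuleCat.of R (Coind k R N)) Y hY a b
    have h2 := h1.1 n
    have h3 := ih (Coind k R N ⧸ LinearMap.range
      (Coind.lift (R := R) (LinearMap.id : N →ₗ[k] N))) (n - 1) (by push_cast at hm; omega)
    have h4 := exact_rightComp₃₁ (k := k) Y _ hS.singleTriangle_distinguished (n - 1)
    obtain ⟨n, rfl⟩ : ∃ n', n = n' + 1 := ⟨n - 1, by omega⟩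
    rw [add_sub_cancel_right] at h3 h4
    exact @Module.Finite.of_function_exact k _ _ _ _ _ _ _ _ _ _ _ _ h4 h3 h2

/-- Bilinear expansion of the Euler characteristic along the simple modules. -/
theorem eulerChar_eq_sum {ι : Type} [Fintype ι] [DecidableEq ι] (S I : ι → ModuleCat.{u} R)
    [∀ i, Injective (I i)] [∀ i, Module.Finite R (S i)] [∀ i, Module.Finite R (I i)]
    (hS : ∀ N : ModuleCat.{u} R, IsSimpleModule R N → ∃ i, Nonempty (S i ≅ N))
    (hSI : ∀ i j, Module.finrank k (S i ⟶ I j) = if i = j then 1 else 0)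
    (X : DerivedCategory (ModuleCat.{u} R))
    (hX : ∀ i, HomFinite k X ((singleFunctor _ 0).obj (S i)))
    (Y : DerivedCategory (ModuleCat.{u} R)) (hY : FiniteCohomology Y) (a b : ℤ) [Y.IsGE a]
    [Y.IsLE b] : HomFinite k X Y ∧ eulerChar k X Y = ∑ j, eulerChar k X ((singleFunctor _ 0).obj (S j)) *
      eulerChar k Y ((singleFunctor _ 0).obj (I j)) := by
  have h := prop_of_finiteCohomology (P := fun Y => HomFinite k X Y ∧
    (∀ j, HomFinite k Y ((singleFunctor _ 0).obj (I j))) ∧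
    eulerChar k X Y = ∑ j, eulerChar k X ((singleFunctor _ 0).obj (S j)) *
      eulerChar k Y ((singleFunctor _ 0).obj (I j))) ?_ ?_ ?_ ?_ ?_ Y hY a b
  · exact ⟨h.1, h.2.2⟩
  · intro Y Y' e ⟨h1, h2, h3⟩
    refine ⟨(h1.of_iso_right e).1, fun j => ((h2 j).of_iso_left e).1, ?_⟩
    simp only [(h1.of_iso_right e).2, ((h2 _).of_iso_left e).2, h3]
  · intro T hT ⟨h1, h2, h3⟩ ⟨h1', h2', h3'⟩
    refine ⟨(eulerChar_triangle_right X T hT h1 h1').1,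
      fun j => (eulerChar_triangle_left _ T hT (h2 j) (h2' j)).1, ?_⟩
    simp only [(eulerChar_triangle_right X T hT h1 h1').2,
      (eulerChar_triangle_left _ T hT (h2 _) (h2' _)).2, h3, h3', mul_add, Finset.sum_add_distrib]
  · intro Y n ⟨h1, h2, h3⟩
    refine ⟨(h1.shift_right n).1, fun j => ((h2 j).shift_left n).1, ?_⟩
    simp only [(h1.shift_right n).2, ((h2 _).shift_left n).2, h3, Finset.mul_sum]
    exact Finset.sum_congr rfl fun j _ => by ring
  · intro Y hY
    refine ⟨(HomFinite.of_isZero_right hY).1, fun j => (HomFinite.of_isZero_left hY).1, ?_⟩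
    simp only [(HomFinite.of_isZero_right hY).2, (HomFinite.of_isZero_left hY).2, mul_zero,
      Finset.sum_const_zero]
  · intro N hN
    obtain ⟨i, ⟨e⟩⟩ := hS N hN
    let e' := (singleFunctor (ModuleCat.{u} R) 0).mapIso e
    have h2 := fun j => homFinite_single_injective k (S i) (I j)
    refine ⟨((hX i).of_iso_right e').1, fun j => ((h2 j).1.of_iso_left e').1, ?_⟩
    simp only [((hX i).of_iso_right e').2, ((h2 _).1.of_iso_left e').2, (h2 _).2, hSI]
    simp

end

end DerivedCategory

/-! ### Lengths of morphism groups -/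

section Length

open IsLocalRing

lemma finrank_eq_finrank_residue_mul_length (k B : Type*) [Field k] [CommRing B] [IsLocalRing B]
    [Algebra k B] (W : Type*) [AddCommGroup W] [Module B W] [Module k W] [IsScalarTower k B W]
    [Module.Finite k W] :
    Module.finrank k W = Module.finrank k (B ⧸ maximalIdeal B) * (Module.length B W).toNat := by
  have hN : IsNoetherian B W := isNoetherian_of_tower k inferInstance
  have hA : IsArtinian B W := isArtinian_of_tower k inferInstance
  have hl : IsFiniteLength B W := isFiniteLength_iff_isNoetherian_isArtinian.2 ⟨hN, hA⟩
  rename_i hk ht hf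
  clear hN hA
  revert hk ht hf
  induction hl with
  | of_subsingleton =>
    intros
    rw [Module.finrank_zero_of_subsingleton, Module.length_eq_zero]; simp
  | @of_simple_quotient M _ _ N hs hN ih =>
    intro hk ht hf
    have h1 : Module.Finite k N :=
      Module.Finite.of_injective (N.subtype.restrictScalars k) N.injective_subtype
    have h2 := Submodule.finrank_quotient_add_finrank (N.restrictScalars k)
    have h3 : Module.finrank k (M ⧸ N.restrictScalars k) = Module.finrank k (B ⧸ maximalIdeal B) := by
      obtain ⟨m, hm, ⟨e⟩⟩ := isSimpleModule_iff_quot_maximal.1 hs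
      rw [eq_maximalIdeal hm] at e
      exact (e.restrictScalars k).finrank_eq
    have h4 := Module.length_eq_add_of_exact N.subtype N.mkQ N.injective_subtype
      N.mkQ_surjective (LinearMap.exact_subtype_mkQ N)
    have h5 : Module.length B (M ⧸ N) = 1 := Module.length_eq_one _ _
    have h6 : Module.length B N ≠ ⊤ := Module.length_ne_top_iff.2 hN
    rw [h4, h5, ENat.toNat_add h6 (by simp), mul_add, ← ih, ← h2, h3]
    simp only [ENat.toNat_one, mul_one]
    exact add_comm _ _

end Length

namespace CategoryTheory

variable {D : Type*} [Category D] [Preadditive D] {B : Type*} [CommRing B]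

/-- The module structure on the morphisms out of an object `T` for a commutative ring acting
on `T`. -/
@[reducible] def homModule {T : D} (ρ : B →+* End T) (Y : D) : Module B (T ⟶ Y) where
  smul b f := (show T ⟶ T from ρ b) ≫ f
  one_smul f := by
    change (show T ⟶ T from ρ 1) ≫ f = f
    rw [map_one]
    exact Category.id_comp f
  mul_smul b c f := by
    change (show T ⟶ T from ρ (b * c)) ≫ f = (show T ⟶ T from ρ b) ≫ (show T ⟶ T from ρ c) ≫ f
    rw [mul_comm, map_mul, End.mul_def]
    exact Category.assoc _ _ _
  smul_zero b := Limits.comp_zero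
  smul_add b f g := Preadditive.comp_add _ _ _ _ _ _
  add_smul b c f := by
    change (show T ⟶ T from ρ (b + c)) ≫ f =
      (show T ⟶ T from ρ b) ≫ f + (show T ⟶ T from ρ c) ≫ f
    rw [map_add]
    exact Preadditive.add_comp _ _ _ _ _ _
  zero_smul f := by
    change (show T ⟶ T from ρ 0) ≫ f = 0
    rw [map_zero]
    exact Limits.zero_comp

/-- The length of a group of morphisms over a commutative ring acting on the source. -/
noncomputable def homLength {T : D} (ρ : B →+* End T) (Y : D) : ℕ :=
  letI := homModule ρ Y
  (Module.length B (T ⟶ Y)).toNat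

/-- A functor as a homomorphism of endomorphism rings. -/
def Functor.endRingHom {D' : Type*} [Category D'] [Preadditive D'] (Φ : D ⥤ D') [Φ.Additive]
    (T : D) : End T →+* End (Φ.obj T) where
  toFun f := Φ.map f
  map_one' := Φ.map_id T
  map_mul' _ _ := Φ.map_comp _ _
  map_zero' := Φ.map_zero _ _
  map_add' _ _ := Φ.map_add

lemma homLength_map {D' : Type*} [Category D'] [Preadditive D'] (Φ : D ⥤ D') [Φ.Additive] [Φ.Full]
    [Φ.Faithful] {T : D} (ρ : B →+* End T) (Y : D) :
    homLength ((Φ.endRingHom T).comp ρ) (Φ.obj Y) = homLength ρ Y := by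
  let := homModule ρ Y
  let := homModule ((Φ.endRingHom T).comp ρ) (Φ.obj Y)
  let e : (T ⟶ Y) ≃ₗ[B] (Φ.obj T ⟶ Φ.obj Y) := LinearEquiv.ofBijective
    { toFun := Φ.map
      map_add' := fun f g => Φ.map_add
      map_smul' := fun b f => Φ.map_comp _ _ }
    ⟨Φ.map_injective, Φ.map_surjective⟩
  exact congrArg ENat.toNat e.length_eq.symm

lemma exists_finrank_hom_eq_mul (k : Type*) [Field k] [Linear k D] [IsLocalRing B] {T : D}
    (ρ : B →+* End T) (hρ : Function.Bijective ρ) :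
    ∃ d : ℕ, ∀ Y : D, Module.Finite k (T ⟶ Y) →
      Module.finrank k (T ⟶ Y) = d * homLength ρ Y := by
  let e := RingEquiv.ofBijective ρ hρ
  let σ : k →+* End T :=
    { toFun := fun c => c • (𝟙 T : T ⟶ T)
      map_one' := one_smul _ _
      map_mul' := fun c c' => by
        rw [End.mul_def]
        change (c * c') • 𝟙 T = (c' • 𝟙 T : T ⟶ T) ≫ (c • 𝟙 T)
        simp [mul_smul]
      map_zero' := zero_smul _ _
      map_add' := fun c c' => add_smul _ _ _ }
  let := (e.symm.toRingHom.comp σ).toAlgebra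
  refine ⟨Module.finrank k (B ⧸ IsLocalRing.maximalIdeal B), fun Y hY => ?_⟩
  let := homModule ρ Y
  have hc : ∀ (c : k) (f : T ⟶ Y), algebraMap k B c • f = c • f := by
    intro c f
    change (show T ⟶ T from e (e.symm (σ c))) ≫ f = c • f
    rw [RingEquiv.apply_symm_apply]
    change (c • 𝟙 T) ≫ f = c • f
    simp
  have : IsScalarTower k B (T ⟶ Y) := ⟨fun c b f => by
    rw [Algebra.smul_def, mul_smul, hc]⟩
  exact finrank_eq_finrank_residue_mul_length k B (T ⟶ Y)

end CategoryTheory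

/-! ### Modules attached to idempotents -/

namespace Idem

variable (k : Type u) {R : Type u} [Field k] [Ring R] [Algebra k R]

/-- The subspace of a module fixed by a ring element `e`; for an idempotent `e` this is `e N`. -/
def fixed (e : R) (N : Type*) [AddCommGroup N] [Module k N] [Module R N] [IsScalarTower k R N] :
    Submodule k N where
  carrier := {n | e • n = n}
  add_mem' {a b} ha hb := by
    change e • (a + b) = a + b
    rw [smul_add, ha, hb]
  zero_mem' := smul_zero e
  smul_mem' c n hn := by
    change e • c • n = c • n
    rw [smul_comm, hn]

lemma mem_fixed {e : R} {N : Type*} [AddCommGroup N] [Module k N] [Module R N]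
    [IsScalarTower k R N] {n : N} : n ∈ fixed k e N ↔ e • n = n := Iff.rfl

/-- The Peirce component `e R f`. -/
def corner (e f : R) : Submodule k R where
  carrier := {x | e * x = x ∧ x * f = x}
  add_mem' {a b} ha hb := ⟨by rw [mul_add, ha.1, hb.1], by rw [add_mul, ha.2, hb.2]⟩
  zero_mem' := ⟨mul_zero e, zero_mul f⟩
  smul_mem' c x hx := ⟨by rw [mul_smul_comm, hx.1], by rw [smul_mul_assoc, hx.2]⟩

lemma mem_corner {e f x : R} : x ∈ corner k e f ↔ e * x = x ∧ x * f = x := Iff.rfl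

lemma mul_self_eq_of_mem_span {e x : R} (he : e * e = e) (hx : x ∈ Submodule.span R {e}) :
    x * e = x := by
  obtain ⟨r, rfl⟩ := Submodule.mem_span_singleton.1 hx
  rw [smul_eq_mul, mul_assoc, he]

/-- The projective module `R e`. -/
def proj (e : R) : ModuleCat.{u} R := ModuleCat.of R (Submodule.span R {e})

/-- The elements of `R e`. -/
def projEquiv (e : R) : proj e ≃ₗ[R] Submodule.span R {e} := LinearEquiv.refl R _

lemma projective_proj {e : R} (he : e * e = e) : Projective (proj e) := by
  have : Module.Projective R (Submodule.span R {e}) :=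
    Module.Projective.of_split (Submodule.span R {e}).subtype
      ((LinearMap.toSpanSingleton R R e).codRestrict _
        fun x => Submodule.smul_mem _ _ (Submodule.mem_span_singleton_self e))
      (by
        ext x
        exact mul_self_eq_of_mem_span he x.2)
  exact (IsProjective.iff_projective _).1 this

instance (e : R) : Module.Finite R (proj e) := Module.Finite.span_singleton R e

/-- The generator of `R e`. -/
def projGen (e : R) : proj e := (projEquiv e).symm ⟨e, Submodule.mem_span_singleton_self e⟩

lemma smul_projGen {e : R} (he : e * e = e) (x : proj e) : (projEquiv e x : R) • projGen e = x :=
  (projEquiv e).injective (Subtype.ext (mul_self_eq_of_mem_span he (projEquiv e x).2))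

lemma self_smul_projGen {e : R} (he : e * e = e) : e • projGen e = projGen e :=
  (projEquiv e).injective (Subtype.ext he)

section

variable {N : ModuleCat.{u} R} {V : Type u} [AddCommGroup V] [Module k V] [Module R V]
  [IsScalarTower k R V]

/-- Morphisms from `R e` to `N` are elements of `e N`. -/
noncomputable def projHomEquiv {e : R} (he : e * e = e) (g : N ≃ₗ[R] V) :
    (proj e ⟶ N) ≃ₗ[k] fixed k e V where
  toFun f := ⟨g (f.hom (projGen e)), by
    rw [mem_fixed, ← map_smul, ← map_smul, self_smul_projGen he]⟩
  invFun n := ModuleCat.ofHom (g.symm.toLinearMap ∘ₗ LinearMap.toSpanSingleton R V n ∘ₗ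
    (Submodule.span R {e}).subtype ∘ₗ (projEquiv e).toLinearMap)
  map_add' f f' := Subtype.ext (map_add g _ _)
  map_smul' c f := by
    refine Subtype.ext ?_
    change g ((c • f).hom (projGen e)) = c • g (f.hom (projGen e))
    rw [ModuleCat.hom_smul_apply_algebraMap, map_smul, algebraMap_smul]
  left_inv f := by
    refine ModuleCat.hom_ext (LinearMap.ext fun x => ?_)
    change g.symm ((projEquiv e x : R) • g (f.hom (projGen e))) = f.hom x
    rw [map_smul, LinearEquiv.symm_apply_apply, ← map_smul]
    exact congrArg f.hom (smul_projGen he x)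
  right_inv n := by
    refine Subtype.ext ?_
    change g (g.symm (e • (n : V))) = n
    rw [LinearEquiv.apply_symm_apply]
    exact n.2

end

/-- The fixed elements of `R f` form the corner `e R f`. -/
noncomputable def fixedSpanEquiv {e f : R} (hf : f * f = f) :
    fixed k e (Submodule.span R {f}) ≃ₗ[k] corner k e f where
  toFun x := ⟨(x : Submodule.span R {f}), congrArg Subtype.val x.2,
    mul_self_eq_of_mem_span hf x.1.2⟩
  invFun x := ⟨⟨x, Submodule.mem_span_singleton.2 ⟨x, x.2.2⟩⟩, Subtype.ext x.2.1⟩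
  map_add' _ _ := rfl
  map_smul' _ _ := rfl
  left_inv _ := rfl
  right_inv _ := rfl

lemma finrank_proj_hom {e f : R} (he : e * e = e) (hf : f * f = f) :
    Module.finrank k (proj e ⟶ proj f) = Module.finrank k (corner k e f) :=
  ((projHomEquiv k he (projEquiv f)).trans (fixedSpanEquiv k hf)).finrank_eq

/-- The dual of `e R`, a submodule of the dual of `R`. -/
def inj (e : R) : Submodule R (Coind k R k) where
  carrier := {φ | ∀ x, φ (e * x) = φ x}
  add_mem' {a b} ha hb x := by rw [Coind.add_apply, ha, hb, Coind.add_apply]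
  zero_mem' _ := rfl
  smul_mem' r φ hφ x := by rw [Coind.smul_apply, mul_assoc, hφ, Coind.smul_apply]

/-- The injective module dual to `e R`. -/
def injMod (e : R) : ModuleCat.{u} R := ModuleCat.of R (inj k e)

/-- The elements of the dual of `e R`. -/
def injModEquiv (e : R) : injMod k e ≃ₗ[R] inj k e := LinearEquiv.refl R _

lemma finite_injMod [Module.Finite k R] (e : R) : Module.Finite R (injMod k e) := by
  have : Module.Finite k (inj k e) :=
    Module.Finite.of_injective ((inj k e).subtype.restrictScalars k) (inj k e).injective_subtype
  exact Module.Finite.of_restrictScalars_finite k R (inj k e)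

lemma injective_injMod {e : R} (he : e * e = e) : Injective (injMod k e) := by
  change Injective (ModuleCat.of R (inj k e))
  let p : Coind k R k →ₗ[R] inj k e :=
    { toFun := fun φ => ⟨(show R →ₗ[k] k from φ) ∘ₗ LinearMap.mulLeft k e, fun x => by
        change φ (e * (e * x)) = φ (e * x)
        rw [← mul_assoc, he]⟩
      map_add' := fun _ _ => rfl
      map_smul' := fun r φ => by
        refine Subtype.ext (Coind.ext fun x => ?_)
        change φ (e * x * r) = φ (e * (x * r))
        rw [mul_assoc] }
  refine ⟨fun {X Y} g f _ => ?_⟩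
  refine ⟨Injective.factorThru (g ≫ ModuleCat.ofHom (inj k e).subtype) f ≫ ModuleCat.ofHom p, ?_⟩
  have hp : ModuleCat.ofHom (inj k e).subtype ≫ ModuleCat.ofHom p = 𝟙 _ := by
    ext φ : 2
    exact Subtype.ext (Coind.ext φ.2)
  rw [← Category.assoc, Injective.comp_factorThru, Category.assoc, hp, Category.comp_id]

section

variable {N : ModuleCat.{u} R} {V : Type u} [AddCommGroup V] [Module k V] [Module R V]
  [IsScalarTower k R V]

/-- Multiplication by an idempotent, as a map to its fixed points. -/
def toFixed {e : R} (he : e * e = e) : V →ₗ[k] fixed k e V :=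
  (DistribSMul.toLinearMap k V e).codRestrict _ fun n => by
    rw [mem_fixed]
    change e • e • n = e • n
    rw [← mul_smul, he]

lemma injModEquiv_algebraMap_smul {e : R} (c : k) (φ : injMod k e) :
    (injModEquiv k e (algebraMap k R c • φ)).1 1 = c • (injModEquiv k e φ).1 1 := by
  rw [map_smul]
  change (injModEquiv k e φ).1 (1 * algebraMap k R c) = c • (injModEquiv k e φ).1 1
  rw [one_mul, Algebra.algebraMap_eq_smul_one, map_smul]

/-- Morphisms from `N` to the dual of `e R` are functionals on `e N`. -/
noncomputable def injHomEquiv {e : R} (he : e * e = e) (g : N ≃ₗ[R] V) :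
    (N ⟶ injMod k e) ≃ₗ[k] Module.Dual k (fixed k e V) where
  toFun f :=
    { toFun := fun n => (injModEquiv k e (f.hom (g.symm n))).1 1
      map_add' := fun n n' => by simp
      map_smul' := fun c n => by
        have h1 : ((c • n : fixed k e V) : V) = algebraMap k R c • (n : V) :=
          (algebraMap_smul R c _).symm
        rw [h1, map_smul, map_smul, injModEquiv_algebraMap_smul, RingHom.id_apply] }
  invFun ψ := ModuleCat.ofHom ((injModEquiv k e).symm.toLinearMap ∘ₗ
    ((Coind.lift (ψ ∘ₗ toFixed k he)).codRestrict _ fun n x => by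
      rw [Coind.lift_apply, Coind.lift_apply]
      refine congrArg ψ (Subtype.ext ?_)
      change e • (e * x) • n = e • x • n
      rw [← mul_smul, ← mul_assoc, he, mul_smul]) ∘ₗ g.toLinearMap)
  map_add' f f' := rfl
  map_smul' c f := by
    ext n
    change (injModEquiv k e ((c • f).hom (g.symm n))).1 1 =
      c • (injModEquiv k e (f.hom (g.symm n))).1 1
    rw [ModuleCat.hom_smul_apply_algebraMap, injModEquiv_algebraMap_smul]
  left_inv f := by
    ext n : 2
    refine (injModEquiv k e).injective (Subtype.ext (Coind.ext fun x => ?_))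
    change (injModEquiv k e (f.hom (g.symm (e • x • g n)))).1 1 = (injModEquiv k e (f.hom n)).1 x
    rw [map_smul, map_smul, map_smul, map_smul, LinearEquiv.symm_apply_apply, map_smul, map_smul]
    change (injModEquiv k e (f.hom n)).1 ((1 * e) * x) = _
    rw [one_mul, (injModEquiv k e (f.hom n)).2]
  right_inv ψ := by
    ext n
    change ψ (toFixed k he ((1 : R) • g (g.symm (n : V)))) = ψ n
    rw [one_smul, LinearEquiv.apply_symm_apply]
    exact congrArg ψ (Subtype.ext n.2)

lemma finrank_hom_injMod {e : R} (he : e * e = e) (g : N ≃ₗ[R] V) :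
    Module.finrank k (N ⟶ injMod k e) = Module.finrank k (fixed k e V) := by
  rw [(injHomEquiv k he g).finrank_eq, Subspace.dual_finrank_eq]

end

/-- The fixed elements of the dual of `e R` are the functionals on `e R f`. -/
noncomputable def fixedInjEquiv {e f : R} (he : e * e = e) (hf : f * f = f) :
    fixed k f (inj k e) ≃ₗ[k] Module.Dual k (corner k e f) where
  toFun φ := (show R →ₗ[k] k from φ.1.1) ∘ₗ (corner k e f).subtype
  invFun ψ := ⟨⟨ψ ∘ₗ (LinearMap.mulLeft k e ∘ₗ LinearMap.mulRight k f).codRestrict (corner k e f)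
      fun x => by
        change e * (e * (x * f)) = e * (x * f) ∧ e * (x * f) * f = e * (x * f)
        constructor
        · rw [← mul_assoc, he]
        · rw [mul_assoc, mul_assoc, hf],
    fun x => by
      refine congrArg ψ (Subtype.ext ?_)
      change e * (e * x * f) = e * (x * f)
      rw [← mul_assoc, ← mul_assoc, he, mul_assoc]⟩,
    by
      refine Subtype.ext (Coind.ext fun x => ?_)
      refine congrArg ψ (Subtype.ext ?_)
      change e * (x * f * f) = e * (x * f)
      rw [mul_assoc, hf]⟩
  map_add' _ _ := rfl
  map_smul' _ _ := rfl
  left_inv φ := by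
    refine Subtype.ext (Subtype.ext (Coind.ext fun x => ?_))
    change φ.1.1 (e * (x * f)) = φ.1.1 x
    rw [φ.1.2]
    exact congrArg (fun ψ : inj k e => ψ.1 x) φ.2
  right_inv ψ := by
    ext x
    refine congrArg ψ (Subtype.ext ?_)
    change e * ((x : R) * f) = x
    rw [x.2.2, x.2.1]

lemma finrank_injMod_hom {e f : R} (he : e * e = e) (hf : f * f = f) :
    Module.finrank k (injMod k e ⟶ injMod k f) = Module.finrank k (corner k e f) := by
  rw [finrank_hom_injMod k hf (injModEquiv k e), (fixedInjEquiv k he hf).finrank_eq,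
    Subspace.dual_finrank_eq]

end Idem

/-- The one-dimensional module of a character. -/
def CharMod {k R : Type u} [Field k] [Ring R] [Algebra k R] (_ε : R →ₐ[k] k) : Type u := k

namespace CharMod

variable {k R : Type u} [Field k] [Ring R] [Algebra k R] (ε : R →ₐ[k] k)

instance : AddCommGroup (CharMod ε) := inferInstanceAs (AddCommGroup k)
instance : Nontrivial (CharMod ε) := inferInstanceAs (Nontrivial k)
instance : Module k (CharMod ε) := inferInstanceAs (Module k k)
instance : Module.Finite k (CharMod ε) := inferInstanceAs (Module.Finite k k)
instance : Module R (CharMod ε) := Module.compHom k ε.toRingHom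

variable {ε}

lemma smul_def (r : R) (c : CharMod ε) : r • c = ε r • c := rfl

instance : IsScalarTower k R (CharMod ε) :=
  ⟨fun c r x => by rw [smul_def, smul_def, map_smul, smul_assoc]⟩

instance : Module.Finite R (CharMod ε) := Module.Finite.of_restrictScalars_finite k R _

lemma finrank_fixed_of_eq_one {e : R} (h : ε e = 1) :
    Module.finrank k (Idem.fixed k e (CharMod ε)) = 1 := by
  have : Idem.fixed k e (CharMod ε) = ⊤ := by
    refine (Submodule.eq_top_iff'.2 fun x => ?_)
    change ε e • x = x
    rw [h, one_smul]
  rw [this, finrank_top]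
  exact Module.finrank_self k

lemma finrank_fixed_of_eq_zero {e : R} (h : ε e = 0) :
    Module.finrank k (Idem.fixed k e (CharMod ε)) = 0 := by
  have : Idem.fixed k e (CharMod ε) = ⊥ := by
    refine (Submodule.eq_bot_iff _).2 fun x hx => ?_
    change ε e • x = x at hx
    rw [h, zero_smul] at hx
    exact hx.symm
  rw [this, finrank_bot]

end CharMod

/-- A complete set of idempotents whose corners are commutative local rings with residue field `k`,
together with the characters of the pairwise non-isomorphic simple modules. -/
structure BasicIdempotents (k R : Type u) [Field k] [Ring R] [Algebra k R] (ι : Type)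
    [Fintype ι] [DecidableEq ι] where
  /-- the idempotents -/
  e : ι → R
  /-- the characters -/
  ε : ι → R →ₐ[k] k
  mul_self : ∀ i, e i * e i = e i
  sum_eq_one : ∑ i, e i = 1
  ε_e : ∀ i j, ε i (e j) = if i = j then 1 else 0
  comm : ∀ i, ∀ x ∈ Idem.corner k (e i) (e i), ∀ y ∈ Idem.corner k (e i) (e i), x * y = y * x
  exists_inv : ∀ i, ∀ x ∈ Idem.corner k (e i) (e i), ε i x ≠ 0 →
    ∃ y ∈ Idem.corner k (e i) (e i), y * x = e i

namespace BasicIdempotents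

open Idem

variable {k R : Type u} [Field k] [Ring R] [Algebra k R] {ι : Type} [Fintype ι] [DecidableEq ι]
  (d : BasicIdempotents k R ι)

/-- The indecomposable projective modules. -/
abbrev P (i : ι) : ModuleCat.{u} R := proj (d.e i)

/-- The indecomposable injective modules. -/
abbrev I (i : ι) : ModuleCat.{u} R := injMod k (d.e i)

/-- The simple modules. -/
def S (i : ι) : ModuleCat.{u} R := ModuleCat.of R (CharMod (d.ε i))

/-- The elements of the simple modules. -/
def SEquiv (i : ι) : d.S i ≃ₗ[R] CharMod (d.ε i) := LinearEquiv.refl R _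

instance (i : ι) : Projective (d.P i) := projective_proj (d.mul_self i)

instance (i : ι) : Injective (d.I i) := injective_injMod k (d.mul_self i)

instance (i : ι) : Module.Finite R (d.S i) := inferInstanceAs (Module.Finite R (CharMod (d.ε i)))

lemma ε_self (i : ι) : d.ε i (d.e i) = 1 := by rw [d.ε_e, if_pos rfl]

lemma finrank_S_I (i j : ι) : Module.finrank k (d.S i ⟶ d.I j) = if i = j then 1 else 0 := by
  rw [finrank_hom_injMod k (d.mul_self j) (d.SEquiv i)]
  split_ifs with h
  · exact CharMod.finrank_fixed_of_eq_one (by rw [d.ε_e, if_pos h])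
  · exact CharMod.finrank_fixed_of_eq_zero (by rw [d.ε_e, if_neg h])

lemma finrank_P_S (i : ι) : Module.finrank k (d.P i ⟶ d.S i) = 1 := by
  rw [(projHomEquiv k (d.mul_self i) (d.SEquiv i)).finrank_eq]
  exact CharMod.finrank_fixed_of_eq_one (d.ε_self i)

lemma exists_mul_eq {i : ι} {x : R} (hx : x * d.e i = x) (h : d.ε i x ≠ 0) :
    ∃ r, r * x = d.e i := by
  obtain ⟨y, hy, hyx⟩ := d.exists_inv i (d.e i * x)
    ⟨by rw [← mul_assoc, d.mul_self], by rw [mul_assoc, hx]⟩ (by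
      rw [map_mul, ε_self, one_mul]; exact h)
  exact ⟨y * d.e i, by rw [mul_assoc, hyx]⟩

lemma mul_e_of_mem {i : ι} (x : d.P i) : (projEquiv (d.e i) x : R) * d.e i = projEquiv (d.e i) x :=
  mul_self_eq_of_mem_span (d.mul_self i) (projEquiv (d.e i) x).2

/-- Elements outside the radical generate the projective module. -/
lemma exists_smul_eq_projGen {i : ι} (x : d.P i) (h : d.ε i (projEquiv (d.e i) x : R) ≠ 0) :
    ∃ r : R, r • x = projGen (d.e i) := by
  obtain ⟨r, hr⟩ := d.exists_mul_eq (d.mul_e_of_mem x) h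
  exact ⟨r, (projEquiv (d.e i)).injective (Subtype.ext hr)⟩

/-- The character on the projective module. -/
def top (i : ι) : d.P i →ₗ[R] CharMod (d.ε i) where
  toFun x := d.ε i (projEquiv (d.e i) x : R)
  map_add' _ _ := map_add (d.ε i) _ _
  map_smul' _ _ := map_mul (d.ε i) _ _

lemma top_projGen (i : ι) : d.top i (projGen (d.e i)) = (1 : k) := d.ε_self i

lemma ext_of_projGen {i : ι} {V : Type*} [AddCommGroup V] [Module R V] {f g : d.P i →ₗ[R] V}
    (h : f (projGen (d.e i)) = g (projGen (d.e i))) : f = g := by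
  ext x
  rw [← smul_projGen (d.mul_self i) x, map_smul, map_smul, h]

/-- The projective modules are local. -/
lemma surjective_of_top_ne_zero {i : ι} {V : Type*} [AddCommGroup V] [Module R V]
    (f : V →ₗ[R] d.P i) {v : V} (h : d.top i (f v) ≠ 0) : Function.Surjective f := by
  obtain ⟨r, hr⟩ := d.exists_smul_eq_projGen (f v) h
  intro x
  refine ⟨(projEquiv (d.e i) x : R) • r • v, ?_⟩
  rw [map_smul, map_smul, hr, smul_projGen (d.mul_self i)]

/-- Every nonzero module receives a nonzero map from some `P i`. -/
lemma exists_hom_ne_zero {V : Type u} [AddCommGroup V] [Module R V] [Nontrivial V] :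
    ∃ (i : ι) (v : V), v ≠ 0 ∧ ∃ f : d.P i →ₗ[R] V, f (projGen (d.e i)) = v := by
  obtain ⟨v, hv⟩ := exists_ne (0 : V)
  have h : ∃ i, d.e i • v ≠ 0 := by
    by_contra! h
    refine hv ?_
    rw [← one_smul R v, ← d.sum_eq_one, Finset.sum_smul]
    exact Finset.sum_eq_zero fun i _ => h i
  obtain ⟨i, hi⟩ := h
  refine ⟨i, d.e i • v, hi, (LinearMap.toSpanSingleton R V v) ∘ₗ
    (Submodule.span R {d.e i}).subtype ∘ₗ (projEquiv (d.e i)).toLinearMap, rfl⟩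

lemma top_surjective (i : ι) : Function.Surjective (d.top i) := fun (c : k) => by
  refine ⟨algebraMap k R c • projGen (d.e i), ?_⟩
  change d.ε i (algebraMap k R c * d.e i) = c
  rw [map_mul, AlgHom.commutes, ε_self]
  exact mul_one c

lemma nonempty_iso_of_simple (N : ModuleCat.{u} R) (hN : IsSimpleModule R N) :
    ∃ i, Nonempty (d.S i ≅ N) := by
  have := IsSimpleModule.nontrivial R N
  obtain ⟨i, v, hv, f, hf⟩ := d.exists_hom_ne_zero (V := N)
  have hsurj : Function.Surjective f :=
    f.surjective_or_eq_zero.resolve_right fun h => hv (by rw [← hf, h, LinearMap.zero_apply])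
  have hker : LinearMap.ker f ≤ LinearMap.ker (d.top i) := by
    intro x hx
    by_contra h
    obtain ⟨r, hr⟩ := d.exists_smul_eq_projGen x h
    exact hv (by rw [← hf, ← hr, map_smul, LinearMap.mem_ker.1 hx, smul_zero])
  let g : N →ₗ[R] CharMod (d.ε i) :=
    (LinearMap.ker f).liftQ (d.top i) hker ∘ₗ (f.quotKerEquivOfSurjective hsurj).symm.toLinearMap
  have hg : Function.Surjective g := by
    intro c
    obtain ⟨x, hx⟩ := d.top_surjective i c
    refine ⟨f x, ?_⟩
    change (LinearMap.ker f).liftQ (d.top i) hker ((f.quotKerEquivOfSurjective hsurj).symm (f x)) = c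
    rw [← f.quotKerEquivOfSurjective_apply_mk hsurj x, LinearEquiv.symm_apply_apply]
    exact hx
  have hg' : Function.Injective g := by
    refine g.injective_or_eq_zero.resolve_right fun h => ?_
    obtain ⟨c, hc⟩ := exists_ne (0 : CharMod (d.ε i))
    obtain ⟨x, rfl⟩ := hg c
    exact hc (by rw [h, LinearMap.zero_apply])
  exact ⟨i, ⟨(LinearEquiv.ofBijective g ⟨hg', hg⟩).symm.toModuleIso⟩⟩

/-- The value of an endomorphism of `R e` at `e` lies in the corner ring. -/
lemma apply_projGen_mem (i : ι) (f : d.P i →ₗ[R] d.P i) :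
    (projEquiv (d.e i) (f (projGen (d.e i))) : R) ∈ corner k (d.e i) (d.e i) := by
  refine ⟨?_, d.mul_e_of_mem _⟩
  have h := congrArg f (self_smul_projGen (d.mul_self i))
  rw [map_smul] at h
  exact congrArg (fun x => (projEquiv (d.e i) x : R)) h

lemma comp_apply_projGen (i : ι) (f g : d.P i →ₗ[R] d.P i) :
    (projEquiv (d.e i) (f (g (projGen (d.e i)))) : R) =
      (projEquiv (d.e i) (g (projGen (d.e i))) : R) * projEquiv (d.e i) (f (projGen (d.e i))) := by
  conv_lhs => rw [← smul_projGen (d.mul_self i) (g (projGen (d.e i))), map_smul]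
  rfl

lemma comm_end (i : ι) (f g : d.P i →ₗ[R] d.P i) : f ∘ₗ g = g ∘ₗ f := by
  refine d.ext_of_projGen ((projEquiv (d.e i)).injective (Subtype.ext ?_))
  rw [LinearMap.comp_apply, LinearMap.comp_apply, comp_apply_projGen, comp_apply_projGen]
  exact d.comm i _ (d.apply_projGen_mem i g) _ (d.apply_projGen_mem i f)

lemma exists_inverse (i : ι) (f : d.P i →ₗ[R] d.P i) (hf : d.top i (f (projGen (d.e i))) ≠ 0) :
    ∃ g : d.P i →ₗ[R] d.P i, f ∘ₗ g = LinearMap.id ∧ g ∘ₗ f = LinearMap.id := by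
  obtain ⟨r, hr⟩ := d.exists_smul_eq_projGen _ hf
  let g : d.P i →ₗ[R] d.P i := (LinearMap.toSpanSingleton R (d.P i) (r • projGen (d.e i))) ∘ₗ
    (Submodule.span R {d.e i}).subtype ∘ₗ (projEquiv (d.e i)).toLinearMap
  have h : f ∘ₗ g = LinearMap.id := by
    refine d.ext_of_projGen ?_
    change f (d.e i • r • projGen (d.e i)) = projGen (d.e i)
    rw [map_smul, map_smul, hr, self_smul_projGen (d.mul_self i)]
  exact ⟨g, h, d.comm_end i f g ▸ h⟩

instance (i : ι) : Nontrivial (d.P i) :=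
  ⟨projGen (d.e i), 0, fun h => one_ne_zero (α := k) (by rw [← d.top_projGen i, h, map_zero]; rfl)⟩

/-- The endomorphism ring of an indecomposable projective module is commutative. -/
@[reducible] def endCommRing (i : ι) : CommRing (End (d.P i)) :=
  { (inferInstance : Ring (End (d.P i))) with
    mul_comm := fun f g => ModuleCat.hom_ext (d.comm_end i f.hom g.hom) }

lemma isUnit_end (i : ι) (f : End (d.P i)) (hf : d.top i (f.hom (projGen (d.e i))) ≠ 0) :
    IsUnit f := by
  obtain ⟨g, h1, h2⟩ := d.exists_inverse i f.hom hf
  exact ⟨⟨f, ModuleCat.ofHom g, ModuleCat.hom_ext h1, ModuleCat.hom_ext h2⟩, rfl⟩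

/-- The endomorphism ring of an indecomposable projective module is local. -/
lemma isLocalRing_end (i : ι) :
    letI := d.endCommRing i
    IsLocalRing (End (d.P i)) := by
  let := d.endCommRing i
  have : Nontrivial (End (d.P i)) := by
    refine ⟨1, 0, fun h => ?_⟩
    have h1 : projGen (d.e i) = 0 := congrArg (fun f : d.P i ⟶ d.P i => f.hom (projGen (d.e i))) h
    exact one_ne_zero (α := k) (by rw [← d.top_projGen i, h1, map_zero]; rfl)
  refine IsLocalRing.of_isUnit_or_isUnit_one_sub_self fun f => ?_
  by_cases hf : d.top i (f.hom (projGen (d.e i))) = 0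
  · refine Or.inr (d.isUnit_end i _ ?_)
    change d.top i (projGen (d.e i) - f.hom (projGen (d.e i))) ≠ 0
    rw [map_sub, hf, sub_zero, top_projGen]
    exact one_ne_zero (α := k)
  · exact Or.inl (d.isUnit_end i _ hf)

end BasicIdempotents

lemma altSum_mul (c : ℕ) (a : ℤ → ℕ) : altSum (fun n => c * a n) = c * altSum a := by
  unfold altSum
  rw [← smul_eq_mul, smul_finsum]
  refine finsum_congr fun n => ?_
  push_cast
  rw [smul_eq_mul]
  ring

namespace DerivedCategory

universe w w'

open Pretriangulated

section

variable (C : Type*) [Category C] [Abelian C] [HasDerivedCategory.{w} C]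

/-- The embedding of an abelian category in its bounded derived category. -/
noncomputable def boundedSingleFunctor : C ⥤ Bounded C :=
  TStructure.t.bounded.lift (singleFunctor C 0) fun M => (boundedSingle M).property

instance : (boundedSingleFunctor C).Full where
  map_surjective g := by
    obtain ⟨f, hf⟩ := (singleFunctor C 0).map_surjective g.hom
    exact ⟨f, ObjectProperty.hom_ext _ hf⟩

instance : (boundedSingleFunctor C).Faithful where
  map_injective h := (singleFunctor C 0).map_injective (congrArg (fun f => f.hom) h)

instance : (boundedSingleFunctor C).Additive where
  map_add {X Y f g} := by
    apply ObjectProperty.hom_ext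
    exact (singleFunctor C 0).map_add

end

section

variable {C C' : Type*} [Category C] [Abelian C] [HasDerivedCategory.{w} C]
  [Category C'] [Abelian C'] [HasDerivedCategory.{w'} C']
  (F : Bounded C ⥤ Bounded C') [F.CommShift ℤ] [F.IsTriangulated] [F.IsEquivalence]

/-- The images of objects of the abelian category under an equivalence of bounded derived
categories. -/
noncomputable def tiltFunctor : C ⥤ DerivedCategory C' := boundedSingleFunctor C ⋙ F ⋙ Bounded.ι

instance : (tiltFunctor F).Full :=
  inferInstanceAs (boundedSingleFunctor C ⋙ F ⋙ Bounded.ι).Full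

instance : (tiltFunctor F).Faithful :=
  inferInstanceAs (boundedSingleFunctor C ⋙ F ⋙ Bounded.ι).Faithful

instance : (tiltFunctor F).Additive :=
  inferInstanceAs (boundedSingleFunctor C ⋙ F ⋙ Bounded.ι).Additive

lemma exists_isGE (X : Bounded C) : ∃ a : ℤ, X.obj.IsGE a := X.property.1

lemma exists_isLE (X : Bounded C) : ∃ a : ℤ, X.obj.IsLE a := X.property.2

lemma eq_zero_of_isZero_homology_tilt {P : C} [Projective P] {Z : Bounded C} {n : ℤ}
    (h : Limits.IsZero ((homologyFunctor C n).obj Z.obj))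
    (f : (F ⋙ Bounded.ι).obj ((boundedSingleFunctor C).obj P) ⟶ ((F ⋙ Bounded.ι).obj Z)⟦n⟧) :
    f = 0 := by
  obtain ⟨g, hg⟩ := (F ⋙ Bounded.ι).map_surjective (f ≫ ((F ⋙ Bounded.ι).commShiftIso n).inv.app Z)
  have h1 : Bounded.ι.map g ≫ (Bounded.ι.commShiftIso n).hom.app Z = 0 :=
    eq_zero_of_isZero_homology_of_projective n h _
  rw [Preadditive.IsIso.comp_right_eq_zero] at h1
  have h2 : g = 0 := Bounded.ι.map_injective (by rw [h1, Functor.map_zero])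
  rw [h2, Functor.map_zero, eq_comm, Preadditive.IsIso.comp_right_eq_zero] at hg
  exact hg

lemma eq_zero_of_tilt_shift {P Q : C} [Projective P] {n : ℤ} (hn : n ≠ 0)
    (f : (tiltFunctor F).obj P ⟶ ((tiltFunctor F).obj Q)⟦n⟧) : f = 0 :=
  eq_zero_of_isZero_homology_tilt F (Z := (boundedSingleFunctor C).obj Q)
    (isZero_homology_single Q n hn) f

lemma exists_eq_zero_of_tilt (P : C) [Projective P] (Y : Bounded C') :
    ∃ a b : ℤ, ∀ n, n < a ∨ b < n → ∀ f : (tiltFunctor F).obj P ⟶ Y.obj⟦n⟧, f = 0 := by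
  let Z := F.objPreimage Y
  obtain ⟨a, ha⟩ := exists_isGE Z
  obtain ⟨b, hb⟩ := exists_isLE Z
  refine ⟨a, b, fun n hn f => ?_⟩
  have hZ : Limits.IsZero ((homologyFunctor C n).obj Z.obj) := by
    rcases hn with h | h
    · exact isZero_of_isGE Z.obj a n h
    · exact isZero_of_isLE Z.obj b n h
  let e : (F ⋙ Bounded.ι).obj Z ≅ Y.obj := Bounded.ι.mapIso (F.objObjPreimageIso Y)
  change (F ⋙ Bounded.ι).obj ((boundedSingleFunctor C).obj P) ⟶ _ at f
  have h := eq_zero_of_isZero_homology_tilt F hZ (f ≫ e.inv⟦n⟧')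
  rwa [Preadditive.IsIso.comp_right_eq_zero] at h

end

section

variable {R R' : Type u} [Ring R] [Ring R'] [HasDerivedCategory.{w} (ModuleCat.{u} R)]
  [HasDerivedCategory.{w'} (ModuleCat.{u} R')]

lemma finiteCohomology_of_isSmallObject (k : Type u) [Field k] [Algebra k R] [Module.Finite k R]
    {X : Bounded (ModuleCat.{u} R)} (hX : IsSmallObject X) :
    FiniteCohomology X.obj := by
  intro n
  have h1 := finite_homology_of_isSmallObject k
    (hX.map (shiftFunctor (Bounded (ModuleCat.{u} R)) n))
  let e : (homologyFunctor (ModuleCat.{u} R) 0).obj (X⟦n⟧).obj ≅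
      (homologyFunctor (ModuleCat.{u} R) n).obj X.obj :=
    (homologyFunctor (ModuleCat.{u} R) 0).mapIso ((Bounded.ι.commShiftIso n).app X) ≪≫
      homologyShiftIso X.obj n 0 n (add_zero n)
  exact Module.Finite.equiv e.toLinearEquiv

lemma finiteCohomology_tilt (k : Type u) [Field k] [Algebra k R'] [Module.Finite k R']
    (F : Bounded (ModuleCat.{u} R) ⥤ Bounded (ModuleCat.{u} R')) [F.CommShift ℤ]
    [F.IsTriangulated] [F.IsEquivalence]
    (P : ModuleCat.{u} R) [Projective P] [Module.Finite R P] :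
    FiniteCohomology ((tiltFunctor F).obj P) :=
  finiteCohomology_of_isSmallObject k ((isSmallObject_boundedSingle P).map F)

lemma homFinite_tilt_single (k : Type u) [Field k] [Algebra k R'] [Module.Finite k R']
    [IsNoetherianRing R'] [IsArtinianRing R']
    (F : Bounded (ModuleCat.{u} R) ⥤ Bounded (ModuleCat.{u} R')) [F.CommShift ℤ]
    [F.IsTriangulated] [F.IsEquivalence]
    (P : ModuleCat.{u} R) [Projective P] [Module.Finite R P]
    (N : ModuleCat.{u} R') [Module.Finite R' N] :
    HomFinite k ((tiltFunctor F).obj P) ((singleFunctor _ 0).obj N) := by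
  obtain ⟨a, ha⟩ := exists_isGE (F.obj ((boundedSingleFunctor _).obj P))
  obtain ⟨b, hb⟩ := exists_isLE (F.obj ((boundedSingleFunctor _).obj P))
  obtain ⟨a', b', h⟩ := exists_eq_zero_of_tilt F P (boundedSingle N)
  refine ⟨fun n => @finite_hom_shift_single k R' _ _ _ _ _ _ _ _ (finiteCohomology_tilt k F P) a b
    ha hb N _ _ _ n, (Set.finite_Icc a' b').subset fun n hn => ?_⟩
  by_contra hn'
  rw [Set.mem_Icc, not_and_or, not_le, not_le] at hn'
  have : Subsingleton ((tiltFunctor F).obj P ⟶ ((singleFunctor _ 0).obj N)⟦n⟧) :=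
    ⟨fun f g => (h n hn' f).trans (h n hn' g).symm⟩
  exact hn Module.finrank_zero_of_subsingleton

/-- An equivalence of bounded derived categories relates the Cartan matrices of the two rings up to
field extension degrees. -/
theorem exists_cartan_relation (k : Type u) [Field k] [Algebra k R] [Module.Finite k R]
    [Algebra k R'] [Module.Finite k R']
    (F : Bounded (ModuleCat.{u} R) ⥤ Bounded (ModuleCat.{u} R')) [F.CommShift ℤ]
    [F.IsTriangulated] [F.IsEquivalence]
    {ι : Type} [Fintype ι] [DecidableEq ι] (d : BasicIdempotents k R ι)
    (d' : BasicIdempotents k R' ι) : ∃ (δ : ι → ℕ) (v : ι → ι → ℤ), ∀ i l,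
      (Module.finrank k (Idem.corner k (d.e i) (d.e l)) : ℤ) =
        δ l * ∑ j, v i j * ∑ m, v l m * Module.finrank k (Idem.corner k (d'.e j) (d'.e m)) := by
  have : IsNoetherianRing R' := isNoetherian_of_tower k inferInstance
  have : IsArtinianRing R' := isArtinian_of_tower k inferInstance
  let T := fun i => (tiltFunctor F).obj (d.P i)
  let S := fun j => (singleFunctor (ModuleCat.{u} R') 0).obj (d'.S j)
  let I := fun j => (singleFunctor (ModuleCat.{u} R') 0).obj (d'.I j)
  have := fun i => Idem.finite_injMod k (d'.e i)
  have hbd : ∀ i, ∃ a b : ℤ, (T i).IsGE a ∧ (T i).IsLE b := fun i => by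
    obtain ⟨a, ha⟩ := exists_isGE (F.obj ((boundedSingleFunctor _).obj (d.P i)))
    obtain ⟨b, hb⟩ := exists_isLE (F.obj ((boundedSingleFunctor _).obj (d.P i)))
    exact ⟨a, b, ha, hb⟩
  have hTS : ∀ i j, HomFinite k (T i) (S j) := fun i j => homFinite_tilt_single k F _ _
  have hTT : ∀ i l, HomFinite k (T i) (T l) ∧
      eulerChar k (T i) (T l) = ∑ j, eulerChar k (T i) (S j) * eulerChar k (T l) (I j) := by
    intro i l
    obtain ⟨a, b, ha, hb⟩ := hbd l
    exact eulerChar_eq_sum k d'.S d'.I d'.nonempty_iso_of_simple d'.finrank_S_I (T i) (hTS i) (T l)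
      (finiteCohomology_tilt k F _) a b
  have hI : ∀ j, FiniteCohomology (I j) := by
    intro j n
    by_cases hn : n = 0
    · subst hn
      exact Module.Finite.equiv (M := d'.I j)
        (((singleFunctorCompHomologyFunctorIso (ModuleCat.{u} R') 0).app (d'.I j)).symm
          |>.toLinearEquiv)
    · exact finite_of_isZero (isZero_homology_single _ n hn)
  have hTI : ∀ l j, eulerChar k (T l) (I j) =
      ∑ m, eulerChar k (T l) (S m) * Module.finrank k (Idem.corner k (d'.e j) (d'.e m)) := by
    intro l j
    rw [(eulerChar_eq_sum k d'.S d'.I d'.nonempty_iso_of_simple d'.finrank_S_I (T l) (hTS l) (I j)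
      (hI j) 0 0).2]
    refine Finset.sum_congr rfl fun m _ => ?_
    rw [(homFinite_single_injective k (d'.I j) (d'.I m)).2,
      Idem.finrank_injMod_hom k (d'.mul_self j) (d'.mul_self m)]
  have hfin : ∀ i l, Module.Finite k (T i ⟶ T l) := fun i l => by
    have := (hTT i l).1.1 0
    exact Module.Finite.equiv (homCongrLinear k (Iso.refl (T i))
      ((shiftFunctorZero (DerivedCategory (ModuleCat.{u} R')) ℤ).app (T l)))
  have hlen : ∀ i, ∃ (δ : ℕ) (v : ι → ℤ), (δ : ℤ) ≠ 0 ∧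
      (∀ l, eulerChar k (T i) (T l) =
        δ * Module.finrank k (Idem.corner k (d.e i) (d.e l))) ∧
      ∀ j, eulerChar k (T i) (S j) = δ * v j := by
    intro i
    let := d.endCommRing i
    have := d.isLocalRing_end i
    let ρ : End (d.P i) →+* End (T i) := ((tiltFunctor F).endRingHom (d.P i)).comp (RingHom.id _)
    have hρ : Function.Bijective ρ :=
      ⟨(tiltFunctor F).map_injective, (tiltFunctor F).map_surjective⟩
    obtain ⟨δ₀, hδ₀⟩ := exists_finrank_hom_eq_mul k (RingHom.id (End (d.P i)))
      Function.bijective_id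
    obtain ⟨δ, hδ⟩ := exists_finrank_hom_eq_mul k ρ hρ
    have h1 : δ₀ = 1 := by
      have h := hδ₀ (d.S i) (finite_hom k _ _)
      rw [d.finrank_P_S] at h
      exact Nat.eq_one_of_mul_eq_one_right h.symm
    have h2 : ∀ l, Module.finrank k (T i ⟶ T l) =
        δ * Module.finrank k (Idem.corner k (d.e i) (d.e l)) := by
      intro l
      rw [hδ (T l) (hfin i l), homLength_map, ← Idem.finrank_proj_hom k (d.mul_self i)
        (d.mul_self l), hδ₀ (d.P l) (finite_hom k _ _), h1, one_mul]
    refine ⟨δ, fun j => altSum fun n => homLength ρ ((S j)⟦n⟧), ?_, fun l => ?_, fun j => ?_⟩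
    · intro h0
      have h3 := h2 i
      rw [Nat.cast_eq_zero.1 h0, zero_mul, Module.finrank_zero_iff] at h3
      have h4 : (tiltFunctor F).map (𝟙 (d.P i)) = (tiltFunctor F).map 0 := h3.elim _ _
      have h5 := (tiltFunctor F).map_injective h4
      obtain ⟨x, hx⟩ := exists_ne (0 : d.P i)
      exact hx (congrArg (fun f => f.hom x) h5)
    · have := hfin i l
      rw [(HomFinite.of_concentrated (k := k) fun n hn f => eq_zero_of_tilt_shift F hn f).2]
      exact_mod_cast h2 l
    · rw [← altSum_mul]
      exact congrArg altSum (funext fun n => hδ _ ((hTS i j).1 n))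
  choose δ v hδ hT hS using hlen
  refine ⟨δ, v, fun i l => mul_left_cancel₀ (hδ i) ?_⟩
  rw [← hT, (hTT i l).2]
  simp only [hTI, hS, Finset.mul_sum]
  exact Finset.sum_congr rfl fun j _ => Finset.sum_congr rfl fun m _ => by ring

end

end DerivedCategory

namespace BasicIdempotents

open Idem

variable {k R : Type u} [Field k] [Ring R] [Algebra k R] {ι : Type} [Fintype ι] [DecidableEq ι]
  (d : BasicIdempotents k R ι)

lemma indecomposable_P (i : ι) : Indecomposable (d.P i) := by
  refine ⟨fun h => ?_, fun Y Z e => ?_⟩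
  · have := ModuleCat.subsingleton_of_isZero h
    exact not_subsingleton (d.P i) this
  let p : d.P i ⟶ d.P i := e.hom ≫ Limits.biprod.fst ≫ Limits.biprod.inl ≫ e.inv
  let q : d.P i ⟶ d.P i := e.hom ≫ Limits.biprod.snd ≫ Limits.biprod.inr ≫ e.inv
  have hpq : p + q = 𝟙 _ := by
    have h : e.hom ≫ (Limits.biprod.fst ≫ Limits.biprod.inl +
        Limits.biprod.snd ≫ Limits.biprod.inr) ≫ e.inv = 𝟙 _ := by
      rw [Limits.biprod.total, Category.id_comp, e.hom_inv_id]
    rw [← h]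
    simp only [p, q, Preadditive.add_comp, Preadditive.comp_add, Category.assoc]
  have hpq' : p ≫ q = 0 := by simp [p, q]
  have hqp' : q ≫ p = 0 := by simp [p, q]
  have hp : p = 0 → Limits.IsZero Y := fun h => by
    rw [Limits.IsZero.iff_id_eq_zero]
    have h1 : 𝟙 Y = Limits.biprod.inl ≫ e.inv ≫ p ≫ e.hom ≫ Limits.biprod.fst := by simp [p]
    rw [h1, h]
    simp
  have hq : q = 0 → Limits.IsZero Z := fun h => by
    rw [Limits.IsZero.iff_id_eq_zero]
    have h1 : 𝟙 Z = Limits.biprod.inr ≫ e.inv ≫ q ≫ e.hom ≫ Limits.biprod.snd := by simp [q]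
    rw [h1, h]
    simp
  have hsum : d.top i (p.hom (projGen (d.e i))) + d.top i (q.hom (projGen (d.e i))) = (1 : k) := by
    rw [← map_add, ← d.top_projGen i]
    exact congrArg (fun t : d.P i ⟶ d.P i => d.top i (t.hom (projGen (d.e i)))) hpq
  by_cases h0 : d.top i (p.hom (projGen (d.e i))) = 0
  · have h1 : d.top i (q.hom (projGen (d.e i))) ≠ 0 := by
      rw [h0, zero_add] at hsum
      rw [hsum]
      exact one_ne_zero (α := k)
    have : IsIso q := (isUnit_iff_isIso q).1 (d.isUnit_end i q h1)
    exact Or.inl (hp ((cancel_epi q).1 (by rw [hqp', Limits.comp_zero])))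
  · have : IsIso p := (isUnit_iff_isIso p).1 (d.isUnit_end i p h0)
    exact Or.inr (hq ((cancel_epi p).1 (by rw [hpq', Limits.comp_zero])))

lemma eq_of_iso_P {i j : ι} (e : d.P i ≅ d.P j) : i = j := by
  by_contra h
  have h1 : d.top j ∘ₗ e.hom.hom = 0 := by
    refine d.ext_of_projGen ?_
    have h2 := congrArg (d.top j ∘ₗ e.hom.hom) (self_smul_projGen (d.mul_self i))
    rw [map_smul, CharMod.smul_def, d.ε_e, if_neg (Ne.symm h), zero_smul] at h2
    exact h2.symm
  have h3 : d.top j (projGen (d.e j)) = 0 := by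
    have h4 := LinearMap.congr_fun h1 (e.inv.hom (projGen (d.e j)))
    have h5 : e.hom.hom (e.inv.hom (projGen (d.e j))) = projGen (d.e j) :=
      congrArg (fun t : d.P j ⟶ d.P j => t.hom (projGen (d.e j))) e.inv_hom_id
    rwa [LinearMap.comp_apply, h5] at h4
  rw [top_projGen] at h3
  exact one_ne_zero (α := k) h3

lemma exists_iso_P (Q : ModuleCat.{u} R) (hf : Module.Finite R Q) (hQ : Projective Q)
    (hi : Indecomposable Q) : ∃ i, Nonempty (Q ≅ d.P i) := by
  have hnt : Nontrivial Q := by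
    by_contra h
    rw [not_nontrivial_iff_subsingleton] at h
    exact hi.1 (ModuleCat.isZero_of_subsingleton Q)
  obtain ⟨m, hm, -⟩ := (eq_top_or_exists_le_coatom (⊥ : Submodule R Q)).resolve_left bot_ne_top
  have hs : IsSimpleModule R (Q ⧸ m) := isSimpleModule_iff_isCoatom.2 hm
  obtain ⟨i, ⟨e⟩⟩ := d.nonempty_iso_of_simple (ModuleCat.of R (Q ⧸ m)) hs
  let q : Q →ₗ[R] CharMod (d.ε i) :=
    (d.SEquiv i).toLinearMap ∘ₗ e.toLinearEquiv.symm.toLinearMap ∘ₗ m.mkQ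
  have hq : Function.Surjective q :=
    (d.SEquiv i).surjective.comp (e.toLinearEquiv.symm.surjective.comp m.mkQ_surjective)
  have hQ' : Module.Projective R Q := (IsProjective.iff_projective Q).2 hQ
  obtain ⟨f, hf⟩ := Module.projective_lifting_property (d.top i) q (d.top_surjective i)
  obtain ⟨c, hc⟩ := exists_ne (0 : CharMod (d.ε i))
  obtain ⟨v, rfl⟩ := hq c
  have hsurj : Function.Surjective f := d.surjective_of_top_ne_zero f (v := v) (by
    rw [← hf] at hc
    exact hc)
  let S : ShortComplex (ModuleCat.{u} R) := ShortComplex.mk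
    (ModuleCat.ofHom (LinearMap.ker f).subtype) (ModuleCat.ofHom f) (by ext x; exact x.2)
  have hS : S.ShortExact := ModuleCat.shortComplex_shortExact S
    (LinearMap.exact_subtype_ker_map f) (LinearMap.ker f).injective_subtype hsurj
  have hP : Projective S.X₃ := inferInstanceAs (Projective (d.P i))
  have hinj : Function.Injective f := by
    rcases hi.2 _ _ hS.splittingOfProjective.isoBinaryBiproduct with h | h
    · have hsub : Subsingleton (LinearMap.ker f) := ModuleCat.subsingleton_of_isZero h
      exact LinearMap.ker_eq_bot.1 (Submodule.subsingleton_iff_eq_bot.1 hsub)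
    · exact absurd h (d.indecomposable_P i).1
  exact ⟨i, ⟨(LinearEquiv.ofBijective f ⟨hinj, hsurj⟩).toModuleIso⟩⟩

theorem isCartanMatrix {A : Type u} [Ring A] [Algebra k A] [Module.Finite k A] {n : ℕ}
    (d : BasicIdempotents k Aᵐᵒᵖ (Fin n)) (C : Matrix (Fin n) (Fin n) ℤ)
    (hC : ∀ i j, C i j = Module.finrank k (corner k (d.e i) (d.e j))) : IsCartanMatrix k A C :=
  ⟨d.P, fun i => ⟨inferInstance, inferInstance, d.indecomposable_P i⟩, fun _ _ ⟨e⟩ => d.eq_of_iso_P e,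
    d.exists_iso_P, fun i j => by rw [hC, finrank_proj_hom k (d.mul_self i) (d.mul_self j)]⟩

end BasicIdempotents

namespace TruncPoly

variable {k : Type u} [Field k] {n : ℕ}

/-- The class of the variable. -/
noncomputable def X : TruncPoly k n := Ideal.Quotient.mk _ Polynomial.X

lemma X_pow_eq_zero : (X : TruncPoly k n) ^ n = 0 := by
  rw [X, ← map_pow, Ideal.Quotient.eq_zero_iff_mem]
  exact Ideal.mem_span_singleton_self _

lemma finrank : Module.finrank k (TruncPoly k n) = n := by
  rw [finrank_quotient_span_eq_natDegree, Polynomial.natDegree_X_pow]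

variable [NeZero n]

lemma aug_mk (p : Polynomial k) : aug k n (Ideal.Quotient.mk _ p) = p.eval 0 := by
  rw [← Polynomial.coe_aeval_eq_eval]
  rfl

lemma aug_X : aug k n X = 0 := by rw [X, aug_mk, Polynomial.eval_X]

lemma exists_eq_add_X_mul (b : TruncPoly k n) :
    ∃ c, b = algebraMap k _ (aug k n b) + X * c := by
  obtain ⟨p, rfl⟩ := Ideal.Quotient.mk_surjective b
  refine ⟨Ideal.Quotient.mk _ p.divX, ?_⟩
  rw [aug_mk, X, ← map_mul, ← Polynomial.coeff_zero_eq_eval_zero]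
  conv_lhs => rw [← Polynomial.X_mul_divX_add p]
  rw [map_add, add_comm]
  rfl

lemma isUnit_of_aug_ne_zero {b : TruncPoly k n} (h : aug k n b ≠ 0) : IsUnit b := by
  obtain ⟨c, hc⟩ := exists_eq_add_X_mul b
  rw [hc]
  refine IsNilpotent.isUnit_add_left_of_commute ⟨n, ?_⟩ ((IsUnit.mk0 _ h).map _) (Commute.all _ _)
  rw [mul_pow, X_pow_eq_zero, zero_mul]

end TruncPoly

namespace TriMat

variable {k R S M : Type u} [Field k] [CommRing R] [CommRing S] [Algebra k R] [Algebra k S]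
  [AddCommGroup M] [Module k M] [Module R M] [Module Sᵐᵒᵖ M] [SMulCommClass R Sᵐᵒᵖ M]
  [IsScalarTower k R M] [IsScalarTower k Sᵐᵒᵖ M]

open Idem

/-- The diagonal idempotents of a triangular matrix algebra, in the opposite algebra. -/
def idem (R S M : Type u) [CommRing R] [CommRing S] [AddCommGroup M] (i : Fin 2) :
    (TriMat R S M)ᵐᵒᵖ :=
  if i = 0 then op ⟨1, 0, 0⟩ else op ⟨0, 0, 1⟩

lemma idem_zero : idem R S M 0 = op ⟨1, 0, 0⟩ := rfl
lemma idem_one : idem R S M 1 = op ⟨0, 0, 1⟩ := rfl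

lemma mem_corner_iff (i j : Fin 2) (x : TriMat R S M) :
    op x ∈ corner k (idem R S M i) (idem R S M j) ↔
      x * unop (idem R S M i) = x ∧ unop (idem R S M j) * x = x := by
  rw [mem_corner]
  constructor
  · exact fun h => ⟨congrArg unop h.1, congrArg unop h.2⟩
  · exact fun h => ⟨congrArg op h.1, congrArg op h.2⟩

lemma mem_corner_zero_zero (x : TriMat R S M) :
    op x ∈ corner k (idem R S M 0) (idem R S M 0) ↔ x.m = 0 ∧ x.b = 0 := by
  rw [mem_corner_iff, idem_zero]
  simp only [TriMat.ext_iff, unop_op, mul_a, mul_m, mul_b, mul_one, one_mul, smul_zero, op_zero,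
    zero_smul, mul_zero, zero_mul, add_zero, one_smul, true_and, eq_comm (a := (0 : M)),
    eq_comm (a := (0 : S))]
  tauto

lemma mem_corner_one_one (x : TriMat R S M) :
    op x ∈ corner k (idem R S M 1) (idem R S M 1) ↔ x.a = 0 ∧ x.m = 0 := by
  rw [mem_corner_iff, idem_one]
  simp only [TriMat.ext_iff, unop_op, mul_a, mul_m, mul_b, mul_one, one_mul, smul_zero,
    zero_smul, mul_zero, zero_mul, add_zero, zero_add, op_one, one_smul, and_true,
    eq_comm (a := (0 : M)), eq_comm (a := (0 : R))]
  tauto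

lemma mem_corner_one_zero (x : TriMat R S M) :
    op x ∈ corner k (idem R S M 1) (idem R S M 0) ↔ x.a = 0 ∧ x.b = 0 := by
  rw [mem_corner_iff, idem_one, idem_zero]
  simp only [TriMat.ext_iff, unop_op, mul_a, mul_m, mul_b, mul_one, one_mul, smul_zero,
    mul_zero, zero_mul, add_zero, zero_add, op_one, one_smul, true_and, and_true,
    eq_comm (a := (0 : S)), eq_comm (a := (0 : R))]

lemma mem_corner_zero_one (x : TriMat R S M) :
    op x ∈ corner k (idem R S M 0) (idem R S M 1) ↔ x = 0 := by
  rw [mem_corner_iff, idem_one, idem_zero]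
  simp only [TriMat.ext_iff, unop_op, mul_a, mul_m, mul_b, mul_one, one_mul, smul_zero, op_zero,
    zero_smul, mul_zero, zero_mul, add_zero, zero_a, zero_m, zero_b,
    eq_comm (a := (0 : S)), eq_comm (a := (0 : R)), eq_comm (a := (0 : M))]
  tauto

lemma finrank_corner_zero_zero :
    Module.finrank k (corner k (idem R S M 0) (idem R S M 0)) = Module.finrank k R :=
  LinearEquiv.finrank_eq
    { toFun := fun x => (unop (x : (TriMat R S M)ᵐᵒᵖ)).a
      invFun := fun r => ⟨op ⟨r, 0, 0⟩, (mem_corner_zero_zero _).2 ⟨rfl, rfl⟩⟩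
      map_add' := fun _ _ => rfl
      map_smul' := fun _ _ => rfl
      left_inv := fun x => by
        have h := (mem_corner_zero_zero _).1 x.2
        exact Subtype.ext (unop_injective (TriMat.ext rfl h.1.symm h.2.symm))
      right_inv := fun _ => rfl }

lemma finrank_corner_one_one :
    Module.finrank k (corner k (idem R S M 1) (idem R S M 1)) = Module.finrank k S :=
  LinearEquiv.finrank_eq
    { toFun := fun x => (unop (x : (TriMat R S M)ᵐᵒᵖ)).b
      invFun := fun r => ⟨op ⟨0, 0, r⟩, (mem_corner_one_one _).2 ⟨rfl, rfl⟩⟩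
      map_add' := fun _ _ => rfl
      map_smul' := fun _ _ => rfl
      left_inv := fun x => by
        have h := (mem_corner_one_one _).1 x.2
        exact Subtype.ext (unop_injective (TriMat.ext h.1.symm h.2.symm rfl))
      right_inv := fun _ => rfl }

lemma finrank_corner_one_zero :
    Module.finrank k (corner k (idem R S M 1) (idem R S M 0)) = Module.finrank k M :=
  LinearEquiv.finrank_eq
    { toFun := fun x => (unop (x : (TriMat R S M)ᵐᵒᵖ)).m
      invFun := fun r => ⟨op ⟨0, r, 0⟩, (mem_corner_one_zero _).2 ⟨rfl, rfl⟩⟩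
      map_add' := fun _ _ => rfl
      map_smul' := fun _ _ => rfl
      left_inv := fun x => by
        have h := (mem_corner_one_zero _).1 x.2
        exact Subtype.ext (unop_injective (TriMat.ext h.1.symm rfl h.2.symm))
      right_inv := fun _ => rfl }

lemma finrank_corner_zero_one :
    Module.finrank k (corner k (idem R S M 0) (idem R S M 1)) = 0 := by
  have : Subsingleton (corner k (idem R S M 0) (idem R S M 1)) :=
    ⟨fun x y => Subtype.ext (unop_injective
      (((mem_corner_zero_one _).1 x.2).trans ((mem_corner_zero_one _).1 y.2).symm))⟩
  exact Module.finrank_zero_of_subsingleton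

lemma finrank_corner {r s m : ℕ} (hR : Module.finrank k R = r) (hS : Module.finrank k S = s)
    (hM : Module.finrank k M = m) (i j : Fin 2) :
    (!![(r : ℤ), 0; m, s] : Matrix (Fin 2) (Fin 2) ℤ) i j =
      Module.finrank k (corner k (idem R S M i) (idem R S M j)) := by
  fin_cases i <;> fin_cases j
  · exact congrArg Nat.cast (finrank_corner_zero_zero.trans hR).symm
  · exact congrArg Nat.cast (finrank_corner_zero_one (k := k) (R := R) (S := S) (M := M)).symm
  · exact congrArg Nat.cast (finrank_corner_one_zero.trans hM).symm
  · exact congrArg Nat.cast (finrank_corner_one_one.trans hS).symm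

/-- The characters of a triangular matrix algebra given by characters of the diagonal entries. -/
def char (α : R →ₐ[k] k) (β : S →ₐ[k] k) (i : Fin 2) : (TriMat R S M)ᵐᵒᵖ →ₐ[k] k :=
  AlgHom.ofLinearMap
    { toFun := fun x => if i = 0 then α (unop x).a else β (unop x).b
      map_add' := fun x y => by split_ifs <;> simp
      map_smul' := fun c x => by split_ifs <;> simp }
    (by
      change (if i = 0 then α 1 else β 1) = 1
      split_ifs <;> simp)
    (fun x y => by
      change (if i = 0 then α ((unop y).a * (unop x).a) else β ((unop y).b * (unop x).b)) =
        (if i = 0 then α (unop x).a else β (unop x).b) *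
          (if i = 0 then α (unop y).a else β (unop y).b)
      split_ifs <;> rw [map_mul, mul_comm])

/-- The basic idempotents of a triangular matrix algebra with local commutative diagonal entries. -/
def basicIdempotents (α : R →ₐ[k] k) (β : S →ₐ[k] k) (hα : ∀ r, α r ≠ 0 → IsUnit r)
    (hβ : ∀ s, β s ≠ 0 → IsUnit s) : BasicIdempotents k (TriMat R S M)ᵐᵒᵖ (Fin 2) where
  e := idem R S M
  ε := char α β
  mul_self i := by
    fin_cases i
    · exact unop_injective (by ext <;> simp [idem_zero])
    · exact unop_injective (by ext <;> simp [idem_one])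
  sum_eq_one := by
    rw [Fin.sum_univ_two]
    exact unop_injective (by ext <;> simp [idem_zero, idem_one])
  ε_e i j := by
    fin_cases i <;> fin_cases j
    · exact map_one α
    · exact map_zero α
    · exact map_zero β
    · exact map_one β
  comm i x hx y hy := by
    fin_cases i
    · have h1 := (mem_corner_zero_zero (unop x)).1 hx
      have h2 := (mem_corner_zero_zero (unop y)).1 hy
      exact unop_injective (by ext <;> simp [h1, h2, mul_comm])
    · have h1 := (mem_corner_one_one (unop x)).1 hx
      have h2 := (mem_corner_one_one (unop y)).1 hy
      exact unop_injective (by ext <;> simp [h1, h2, mul_comm])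
  exists_inv i x hx hε := by
    fin_cases i
    · obtain ⟨r, hr⟩ := (hα _ hε).exists_right_inv
      have h1 := (mem_corner_zero_zero (unop x)).1 hx
      refine ⟨op ⟨r, 0, 0⟩, (mem_corner_zero_zero _).2 ⟨rfl, rfl⟩, unop_injective ?_⟩
      ext <;> simp [h1, hr, idem_zero]
    · obtain ⟨r, hr⟩ := (hβ _ hε).exists_right_inv
      have h1 := (mem_corner_one_one (unop x)).1 hx
      refine ⟨op ⟨0, 0, r⟩, (mem_corner_one_one _).2 ⟨rfl, rfl⟩, unop_injective ?_⟩
      ext <;> simp [h1, hr, idem_one]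

end TriMat

/-! ### Binary quadratic forms of discriminant `-23` -/

lemma form_two {a b : ℤ} (h : 3 * a ^ 2 + a * b + 2 * b ^ 2 = 2) : a = 0 ∧ (b = 1 ∨ b = -1) := by
  have hb : b ≤ 1 := by nlinarith [sq_nonneg (6 * a + b)]
  have hb' : -1 ≤ b := by nlinarith [sq_nonneg (6 * a + b)]
  have ha : a ≤ 0 := by nlinarith [sq_nonneg (a + 4 * b)]
  have ha' : 0 ≤ a := by nlinarith [sq_nonneg (a + 4 * b)]
  obtain rfl : a = 0 := le_antisymm ha ha'
  interval_cases b <;> simp_all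

lemma form_three {a b : ℤ} (h : 3 * a ^ 2 + a * b + 2 * b ^ 2 = 3) :
    (a = 1 ∨ a = -1) ∧ b = 0 := by
  have hb : b ≤ 1 := by nlinarith [sq_nonneg (6 * a + b)]
  have hb' : -1 ≤ b := by nlinarith [sq_nonneg (6 * a + b)]
  have ha : a ≤ 1 := by nlinarith [sq_nonneg (a + 4 * b)]
  have ha' : -1 ≤ a := by nlinarith [sq_nonneg (a + 4 * b)]
  interval_cases b <;> interval_cases a <;> simp_all

lemma form_ne_one {a b : ℤ} : 3 * a ^ 2 + a * b + 2 * b ^ 2 ≠ 1 := by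
  intro h
  have hb : b ≤ 0 := by nlinarith [sq_nonneg (6 * a + b)]
  have hb' : 0 ≤ b := by nlinarith [sq_nonneg (6 * a + b)]
  obtain rfl : b = 0 := le_antisymm hb hb'
  omega

lemma not_intCongruent : ¬ IntCongruent !![2, 0; 1, 3] !![3, 0; 1, 2] := by
  rintro ⟨P, -, h⟩
  have h00 := congrFun (congrFun h 0) 0
  have h01 := congrFun (congrFun h 0) 1
  have h11 := congrFun (congrFun h 1) 1
  simp only [Matrix.mul_apply, Fin.sum_univ_two, Matrix.transpose_apply, Matrix.of_apply,
    Matrix.cons_val_zero, Matrix.cons_val_one, Matrix.cons_val', Matrix.cons_val_fin_one] at h00 h01 h11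
  obtain ⟨hb, ha⟩ := form_three (a := P 1 0) (b := P 0 0) (by linarith)
  obtain ⟨hd, hc⟩ := form_two (a := P 1 1) (b := P 0 1) (by linarith)
  rw [ha, hd] at h01
  rcases hb with hb | hb <;> rcases hc with hc | hc <;> rw [hb, hc] at h01 <;> norm_num at h01

lemma not_cartan_relation {δ : Fin 2 → ℕ} {v : Fin 2 → Fin 2 → ℤ}
    (h : ∀ i l, (!![2, 0; 1, 3] : Matrix (Fin 2) (Fin 2) ℤ) i l =
      δ l * ∑ j, v i j * ∑ m, v l m * (!![3, 0; 1, 2] : Matrix (Fin 2) (Fin 2) ℤ) j m) : False := by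
  have h00 := h 0 0
  have h01 := h 0 1
  have h10 := h 1 0
  have h11 := h 1 1
  simp only [Fin.sum_univ_two, Matrix.of_apply, Matrix.cons_val_zero, Matrix.cons_val_one,
    Matrix.cons_val', Matrix.cons_val_fin_one] at h00 h01 h10 h11
  have hδ : (δ 0 : ℤ) = 1 := Int.eq_one_of_dvd_one (by positivity) ⟨_, h10⟩
  rw [hδ, one_mul] at h00
  obtain ⟨ha, hb⟩ := form_two (a := v 0 0) (b := v 0 1) (by linarith)
  have hδ1 : (δ 1 : ℤ) = 1 ∨ (δ 1 : ℤ) = 3 := by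
    have h3 : δ 1 ∣ 3 := Int.natCast_dvd_natCast.1 ⟨_, h11⟩
    rcases (Nat.dvd_prime Nat.prime_three).1 h3 with h | h
    · exact Or.inl (by rw [h]; rfl)
    · exact Or.inr (by rw [h]; rfl)
  rcases hδ1 with hδ1 | hδ1
  · rw [hδ1] at h01 h11
    obtain ⟨hc, hd⟩ := form_three (a := v 1 0) (b := v 1 1) (by linarith)
    rw [ha, hd] at h01
    rcases hb with hb | hb <;> rcases hc with hc | hc <;> rw [hb, hc] at h01 <;> norm_num at h01
  · rw [hδ1] at h11
    exact form_ne_one (a := v 1 0) (b := v 1 1) (by linarith)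

/-! ### The example -/

section

variable (k : Type u) [Field k]

lemma finrank_simpleBimod (n m : ℕ) : Module.finrank k (SimpleBimod k n m) = 1 :=
  Module.finrank_self k

/-- The dual of the simple bimodule. -/
noncomputable def dualSimpleBimodEquiv (n m : ℕ) :
    DualBimod k (SimpleBimod k n m) ≃ₗ[k] SimpleBimod k m n :=
  LinearMap.ringLmapEquivSelf k k k

lemma finrank_dual_simpleBimod (n m : ℕ) :
    Module.finrank k (DualBimod k (SimpleBimod k n m)) = 1 := by
  rw [(dualSimpleBimodEquiv k n m).finrank_eq, finrank_simpleBimod]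

/-- The idempotents of `ExLambda`. -/
noncomputable def ExLambda.basicIdempotents : BasicIdempotents k (ExLambda k)ᵐᵒᵖ (Fin 2) :=
  TriMat.basicIdempotents (TruncPoly.aug k 2) (TruncPoly.aug k 3)
    (fun _ => TruncPoly.isUnit_of_aug_ne_zero) (fun _ => TruncPoly.isUnit_of_aug_ne_zero)

/-- The idempotents of `ExMate`. -/
noncomputable def ExMate.basicIdempotents : BasicIdempotents k (ExMate k)ᵐᵒᵖ (Fin 2) :=
  TriMat.basicIdempotents (TruncPoly.aug k 3) (TruncPoly.aug k 2)
    (fun _ => TruncPoly.isUnit_of_aug_ne_zero) (fun _ => TruncPoly.isUnit_of_aug_ne_zero)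

lemma ExLambda.cartan (i j : Fin 2) : (!![2, 0; 1, 3] : Matrix (Fin 2) (Fin 2) ℤ) i j =
    Module.finrank k (Idem.corner k ((ExLambda.basicIdempotents k).e i)
      ((ExLambda.basicIdempotents k).e j)) := by
  exact TriMat.finrank_corner TruncPoly.finrank TruncPoly.finrank (finrank_simpleBimod k 2 3) i j

lemma ExMate.cartan (i j : Fin 2) : (!![3, 0; 1, 2] : Matrix (Fin 2) (Fin 2) ℤ) i j =
    Module.finrank k (Idem.corner k ((ExMate.basicIdempotents k).e i)
      ((ExMate.basicIdempotents k).e j)) := by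
  exact TriMat.finrank_corner TruncPoly.finrank TruncPoly.finrank
    (finrank_dual_simpleBimod k 2 3) i j

theorem not_derivedEquivalent : ¬ DerivedEquivalent (ExLambda k) (ExMate k) := by
  intro h
  let := HasDerivedCategory.standard (ModuleCat.{u} (ExLambda k)ᵐᵒᵖ)
  let := HasDerivedCategory.standard (ModuleCat.{u} (ExMate k)ᵐᵒᵖ)
  obtain ⟨F, hF, hF', hF''⟩ := h
  obtain ⟨δ, v, hv⟩ := DerivedCategory.exists_cartan_relation k F (ExLambda.basicIdempotents k)
    (ExMate.basicIdempotents k)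
  refine not_cartan_relation (δ := δ) (v := v) fun i l => ?_
  rw [ExLambda.cartan k, hv i l]
  simp only [ExMate.cartan k]

lemma dualSimpleBimodEquiv_left (n m : ℕ) [NeZero m] (r : TruncPoly k m)
    (φ : DualBimod k (SimpleBimod k n m)) :
    dualSimpleBimodEquiv k n m (r • φ) = r • dualSimpleBimodEquiv k n m φ := by
  rw [SimpleBimod.left_smul_def, ← map_smul]
  refine congrArg _ (DualBimod.ext fun c => ?_)
  rw [DualBimod.left_smul_apply, DualBimod.smul_apply, SimpleBimod.right_smul_def, unop_op,
    map_smul]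

lemma dualSimpleBimodEquiv_right (n m : ℕ) [NeZero n] (r : (TruncPoly k n)ᵐᵒᵖ)
    (φ : DualBimod k (SimpleBimod k n m)) :
    dualSimpleBimodEquiv k n m (r • φ) = r • dualSimpleBimodEquiv k n m φ := by
  rw [SimpleBimod.right_smul_def, ← map_smul]
  refine congrArg _ (DualBimod.ext fun c => ?_)
  rw [DualBimod.right_smul_apply, DualBimod.smul_apply, SimpleBimod.left_smul_def, map_smul]

/-- The mate of the triangular matrix algebra of a simple bimodule. -/
noncomputable def mateSimpleBimodEquiv (n m : ℕ) [NeZero n] [NeZero m] :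
    Mate k (TruncPoly k n) (TruncPoly k m) (SimpleBimod k n m) ≃ₐ[k]
      TriMat (TruncPoly k m) (TruncPoly k n) (SimpleBimod k m n) :=
  AlgEquiv.ofLinearEquiv
    { toFun := fun x => ⟨x.a, dualSimpleBimodEquiv k n m x.m, x.b⟩
      invFun := fun x => ⟨x.a, (dualSimpleBimodEquiv k n m).symm x.m, x.b⟩
      map_add' := fun x y => TriMat.ext rfl (map_add _ _ _) rfl
      map_smul' := fun c x => TriMat.ext rfl (map_smul _ _ _) rfl
      left_inv := fun x => TriMat.ext rfl (LinearEquiv.symm_apply_apply _ _) rfl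
      right_inv := fun x => TriMat.ext rfl (LinearEquiv.apply_symm_apply _ _) rfl }
    (TriMat.ext rfl (map_zero _) rfl)
    (fun x y => TriMat.ext rfl (by
      change dualSimpleBimodEquiv k n m (x.a • y.m + op y.b • x.m) =
        x.a • dualSimpleBimodEquiv k n m y.m + op y.b • dualSimpleBimodEquiv k n m x.m
      rw [map_add, dualSimpleBimodEquiv_left, dualSimpleBimodEquiv_right]) rfl)

end

/-! ### Self-injectivity and projective dimension -/

namespace TruncPoly

variable {k : Type u} [Field k] {n : ℕ}

/-- The coefficient of `x ^ (n - 1)`. -/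
noncomputable def frobeniusForm (k : Type u) [Field k] (n : ℕ) [NeZero n] : TruncPoly k n →ₗ[k] k :=
  Submodule.liftQ ((Ideal.span {(Polynomial.X : Polynomial k) ^ n}).restrictScalars k)
    (Polynomial.lcoeff k (n - 1)) (by
      intro p hp
      have h := Polynomial.X_pow_dvd_iff.1 (Ideal.mem_span_singleton.1 hp) (n - 1)
        (Nat.sub_lt (Nat.pos_of_neZero n) one_pos)
      exact h) ∘ₗ
    (Submodule.Quotient.restrictScalarsEquiv k
      (Ideal.span {(Polynomial.X : Polynomial k) ^ n})).symm.toLinearMap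

variable [NeZero n]

lemma frobeniusForm_mk (p : Polynomial k) :
    frobeniusForm k n (Ideal.Quotient.mk _ p) = p.coeff (n - 1) := rfl

lemma eq_zero_of_frobeniusForm {b : TruncPoly k n} (h : ∀ c, frobeniusForm k n (b * c) = 0) :
    b = 0 := by
  obtain ⟨p, rfl⟩ := Ideal.Quotient.mk_surjective b
  rw [Ideal.Quotient.eq_zero_iff_mem, Ideal.mem_span_singleton, Polynomial.X_pow_dvd_iff]
  intro i hi
  have h1 := h (Ideal.Quotient.mk _ (Polynomial.X ^ (n - 1 - i)))
  rw [← map_mul, frobeniusForm_mk] at h1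
  have h2 : n - 1 = i + (n - 1 - i) := by omega
  rw [h2, Nat.add_sub_cancel_left, Polynomial.coeff_mul_X_pow] at h1
  exact h1

/-- The Frobenius isomorphism with the dual. -/
noncomputable def toCoind (k : Type u) [Field k] (n : ℕ) [NeZero n] :
    TruncPoly k n →ₗ[(TruncPoly k n)ᵐᵒᵖ] Coind k (TruncPoly k n)ᵐᵒᵖ k :=
  Coind.lift (frobeniusForm k n)

lemma toCoind_bijective : Function.Bijective (toCoind k n) := by
  have hinj : Function.Injective (toCoind k n) := by
    rw [injective_iff_map_eq_zero]
    intro b hb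
    exact eq_zero_of_frobeniusForm fun c => congrArg (fun φ => φ (op c)) hb
  let f : TruncPoly k n →ₗ[k] ((TruncPoly k n)ᵐᵒᵖ →ₗ[k] k) :=
    { toFun := toCoind k n
      map_add' := map_add _
      map_smul' := fun c b => LinearMap.ext fun x => by
        change frobeniusForm k n (x • c • b) = c • frobeniusForm k n (x • b)
        rw [smul_comm, map_smul] }
  refine ⟨hinj, ?_⟩
  refine (LinearMap.injective_iff_surjective_of_finrank_eq_finrank (f := f) ?_).1 hinj
  rw [Module.finrank_linearMap_self, (opLinearEquiv k (M := TruncPoly k n)).finrank_eq]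

lemma selfInjective : Module.Injective (TruncPoly k n)ᵐᵒᵖ (TruncPoly k n) where
  out X Y _ _ _ _ f hf g := by
    let e := LinearEquiv.ofBijective (toCoind k n) toCoind_bijective
    obtain ⟨h, hh⟩ := Module.Injective.out f hf (e.toLinearMap ∘ₗ g)
    refine ⟨e.symm.toLinearMap ∘ₗ h, fun x => ?_⟩
    rw [LinearMap.comp_apply, hh]
    exact e.symm_apply_apply _

lemma X_pow_ne_zero {i : ℕ} (hi : i < n) : (X : TruncPoly k n) ^ i ≠ 0 := by
  rw [X, ← map_pow, Ne, Ideal.Quotient.eq_zero_iff_mem, Ideal.mem_span_singleton,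
    Polynomial.X_pow_dvd_iff]
  intro h
  have := h i hi
  rw [Polynomial.coeff_X_pow_self] at this
  exact one_ne_zero this

lemma X_pow_mul (b : TruncPoly k n) : X ^ (n - 1) * b = aug k n b • (X : TruncPoly k n) ^ (n - 1) := by
  obtain ⟨c, hc⟩ := exists_eq_add_X_mul b
  conv_lhs => rw [hc, mul_add, ← mul_assoc, ← pow_succ,
    Nat.sub_add_cancel (Nat.one_le_iff_ne_zero.2 (NeZero.ne n)), X_pow_eq_zero, zero_mul, add_zero,
    mul_comm, ← Algebra.smul_def]

lemma exists_of_X_mul_eq_zero {b : TruncPoly k n} (h : X * b = 0) :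
    ∃ c : k, b = c • X ^ (n - 1) := by
  obtain ⟨p, rfl⟩ := Ideal.Quotient.mk_surjective b
  rw [X, ← map_mul, Ideal.Quotient.eq_zero_iff_mem, Ideal.mem_span_singleton] at h
  have h1 : (Polynomial.X : Polynomial k) ^ n = Polynomial.X * Polynomial.X ^ (n - 1) := by
    rw [← pow_succ', Nat.sub_add_cancel (Nat.one_le_iff_ne_zero.2 (NeZero.ne n))]
  rw [h1] at h
  obtain ⟨q, hq⟩ := (mul_dvd_mul_iff_left Polynomial.X_ne_zero).1 h
  refine ⟨aug k n (Ideal.Quotient.mk _ q), ?_⟩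
  rw [← X_pow_mul, hq, map_mul, map_pow, X]

variable {m : ℕ}

/-- The regular right module. -/
noncomputable def reg (k : Type u) [Field k] (n : ℕ) : ModuleCat.{u} (TruncPoly k n)ᵐᵒᵖ :=
  ModuleCat.of _ (TruncPoly k n)

lemma projective_reg : Projective (reg k n) := by
  let e : (TruncPoly k n)ᵐᵒᵖ ≃ₗ[(TruncPoly k n)ᵐᵒᵖ] reg k n :=
    { toFun := unop
      invFun := op
      map_add' := fun _ _ => rfl
      map_smul' := fun _ _ => rfl
      left_inv := fun _ => rfl
      right_inv := fun _ => rfl }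
  have : Module.Projective (TruncPoly k n)ᵐᵒᵖ (reg k n) := Module.Projective.of_equiv e
  exact (IsProjective.iff_projective _).1 this

/-- The augmentation as a map to the simple module. -/
noncomputable def toSimple (k : Type u) [Field k] (m n : ℕ) [NeZero n] :
    reg k n →ₗ[(TruncPoly k n)ᵐᵒᵖ] SimpleBimod k m n where
  toFun := aug k n
  map_add' := map_add (aug k n)
  map_smul' s b := by
    change aug k n ((show TruncPoly k n from b) * unop s) = aug k n (unop s) * aug k n (show TruncPoly k n from b)
    rw [map_mul, mul_comm]

/-- The inclusion of the socle. -/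
noncomputable def ofSimple (k : Type u) [Field k] (m n : ℕ) [NeZero n] :
    SimpleBimod k m n →ₗ[(TruncPoly k n)ᵐᵒᵖ] reg k n where
  toFun c := ((show k from c) • X ^ (n - 1) : TruncPoly k n)
  map_add' c c' := add_smul (R := k) (M := TruncPoly k n) c c' _
  map_smul' s c := by
    change (aug k n (unop s) * (show k from c)) • (X : TruncPoly k n) ^ (n - 1) =
      ((show k from c) • X ^ (n - 1)) * unop s
    rw [smul_mul_assoc, X_pow_mul, smul_smul, mul_comm]

/-- Multiplication by the variable, as a map to the augmentation ideal. -/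
noncomputable def mulX (k : Type u) [Field k] (m n : ℕ) [NeZero n] :
    reg k n →ₗ[(TruncPoly k n)ᵐᵒᵖ] LinearMap.ker (toSimple k m n) where
  toFun b := ⟨X * (show TruncPoly k n from b), by
    change aug k n (X * (show TruncPoly k n from b)) = 0
    rw [map_mul, aug_X, zero_mul]⟩
  map_add' b c := Subtype.ext (mul_add (X : TruncPoly k n) b c)
  map_smul' s b := Subtype.ext (mul_assoc (X : TruncPoly k n) b (unop s)).symm

lemma toSimple_surjective : Function.Surjective (toSimple k m n) := fun (c : k) =>
  ⟨algebraMap k (TruncPoly k n) c, (aug k n).commutes c⟩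

lemma ofSimple_injective : Function.Injective (ofSimple k m n) := fun (_ _ : k) h =>
  smul_left_injective k (X_pow_ne_zero (k := k) (n := n)
    (Nat.sub_lt (Nat.pos_of_neZero n) one_pos)) h

lemma mulX_surjective : Function.Surjective (mulX k m n) := by
  rintro ⟨b, hb⟩
  obtain ⟨c, hc⟩ := exists_eq_add_X_mul (show TruncPoly k n from b)
  have hb' : aug k n (show TruncPoly k n from b) = 0 := hb
  rw [hb', map_zero, zero_add] at hc
  exact ⟨c, Subtype.ext hc.symm⟩

lemma exact_ofSimple_mulX : Function.Exact (ofSimple k m n) (mulX k m n) := by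
  intro b
  constructor
  · intro h
    obtain ⟨c, hc⟩ := exists_of_X_mul_eq_zero (b := (show TruncPoly k n from b))
      (congrArg Subtype.val h)
    exact ⟨c, hc.symm⟩
  · rintro ⟨c, rfl⟩
    refine Subtype.ext ?_
    change (X : TruncPoly k n) * ((show k from c) • X ^ (n - 1)) = 0
    rw [mul_smul_comm, ← pow_succ', Nat.sub_add_cancel (Nat.one_le_iff_ne_zero.2 (NeZero.ne n)),
      X_pow_eq_zero, smul_zero]

lemma not_projective_simple (hn : 1 < n) :
    ¬ Projective (ModuleCat.of (TruncPoly k n)ᵐᵒᵖ (SimpleBimod k m n)) := by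
  intro h
  have h' : Module.Projective (TruncPoly k n)ᵐᵒᵖ (SimpleBimod k m n) :=
    (IsProjective.iff_projective _).2 h
  obtain ⟨s, hs⟩ := Module.projective_lifting_property (toSimple k m n) LinearMap.id
    toSimple_surjective
  let v : SimpleBimod k m n := (1 : k)
  have h1 : aug k n (show TruncPoly k n from s v) = 1 := LinearMap.congr_fun hs v
  have h2 : (show TruncPoly k n from s v) * X = 0 := by
    have h3 : op (X : TruncPoly k n) • v = 0 := by
      rw [SimpleBimod.right_smul_def, unop_op, aug_X, zero_smul]
    have h4 := congrArg s h3
    rw [map_smul, map_zero] at h4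
    exact h4
  have h5 := isUnit_of_aug_ne_zero (b := (show TruncPoly k n from s v)) (by rw [h1]; exact one_ne_zero)
  rw [h5.mul_right_eq_zero] at h2
  exact X_pow_ne_zero (k := k) hn (by rw [pow_one, h2])

theorem not_hasProjectiveDimensionLE (hn : 1 < n) (d : ℕ) :
    ¬ HasProjectiveDimensionLE (ModuleCat.of (TruncPoly k n)ᵐᵒᵖ (SimpleBimod k m n)) d := by
  have hB : Projective (reg k n) := projective_reg
  let S₁ : ShortComplex (ModuleCat.{u} (TruncPoly k n)ᵐᵒᵖ) := ShortComplex.mk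
    (ModuleCat.ofHom (LinearMap.ker (toSimple k m n)).subtype) (ModuleCat.ofHom (toSimple k m n))
    (by ext x; exact x.2)
  have hS₁ : S₁.ShortExact := ModuleCat.shortComplex_shortExact S₁
    (LinearMap.exact_subtype_ker_map _) (Submodule.injective_subtype _) toSimple_surjective
  let S₂ : ShortComplex (ModuleCat.{u} (TruncPoly k n)ᵐᵒᵖ) := ShortComplex.mk
    (ModuleCat.ofHom (ofSimple k m n)) (ModuleCat.ofHom (mulX k m n))
    (by
      ext x : 2
      exact (exact_ofSimple_mulX (k := k) (m := m) (n := n)).apply_apply_eq_zero x)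
  have hS₂ : S₂.ShortExact := ModuleCat.shortComplex_shortExact S₂
    exact_ofSimple_mulX ofSimple_injective mulX_surjective
  have hB' : ∀ i : ℕ, HasProjectiveDimensionLT (reg k n) (i + 1) := fun i =>
    hasProjectiveDimensionLT_of_ge (reg k n) 1 (i + 1) (by omega)
  induction d with
  | zero =>
    intro h
    exact not_projective_simple hn (projective_iff_hasProjectiveDimensionLT_one.2 h)
  | succ d ih =>
    intro h
    have h1 : HasProjectiveDimensionLT S₁.X₁ (d + 1) :=
      hS₁.hasProjectiveDimensionLT_X₁ (d + 1) (hB' d) h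
    have h2 : HasProjectiveDimensionLT S₂.X₃ (d + 2) :=
      hasProjectiveDimensionLT_of_ge S₁.X₁ (d + 1) (d + 2) (by omega)
    exact ih (hS₂.hasProjectiveDimensionLT_X₁ (d + 1) (hB' d) h2)

end TruncPoly

/-! ### Repetitive algebras of mates -/

/-- A function on `ℤ` whose values are governed by finitely many values of two finitely supported
functions is finitely supported. -/
lemma Int.support_finite_of_finsupp {A B N : Type*} [Zero A] [Zero B] [Zero N] (u : ℤ →₀ A)
    (v : ℤ →₀ B) (c : ℤ) {F : ℤ → N}
    (h : ∀ i, u i = 0 → u (i + c) = 0 → v i = 0 → v (i + c) = 0 → F i = 0) :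
    F.support.Finite := by
  classical
  have hs : ∀ s : Finset ℤ, ((fun i : ℤ => i + c) ⁻¹' s).Finite := fun s =>
    s.finite_toSet.preimage (add_left_injective c).injOn
  refine (((u.support ∪ v.support).finite_toSet).union (hs (u.support ∪ v.support))).subset
    fun i hi => ?_
  by_contra h'
  simp only [Finset.coe_union, Set.mem_union, Set.mem_preimage, Finset.mem_coe,
    Finsupp.mem_support_iff, not_or, not_not] at h'
  exact hi (h i h'.1.1 h'.2.1 h'.1.2 h'.2.2)

namespace TriMat

variable (k R S M : Type u) [Field k] [CommRing R] [CommRing S] [Algebra k R] [Algebra k S]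
  [AddCommGroup M] [Module k M] [Module R M] [Module Sᵐᵒᵖ M] [SMulCommClass R Sᵐᵒᵖ M]
  [IsScalarTower k R M] [IsScalarTower k Sᵐᵒᵖ M]

/-- The inclusion of the upper left entry. -/
def inA : R →ₗ[k] TriMat R S M where
  toFun r := ⟨r, 0, 0⟩
  map_add' _ _ := TriMat.ext rfl (add_zero _).symm (add_zero _).symm
  map_smul' _ _ := TriMat.ext rfl (smul_zero _).symm (smul_zero _).symm

/-- The inclusion of the upper right entry. -/
def inM : M →ₗ[k] TriMat R S M where
  toFun m := ⟨0, m, 0⟩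
  map_add' _ _ := TriMat.ext (add_zero _).symm rfl (add_zero _).symm
  map_smul' _ _ := TriMat.ext (smul_zero _).symm rfl (smul_zero _).symm

/-- The inclusion of the lower right entry. -/
def inB : S →ₗ[k] TriMat R S M where
  toFun s := ⟨0, 0, s⟩
  map_add' _ _ := TriMat.ext (add_zero _).symm (add_zero _).symm rfl
  map_smul' _ _ := TriMat.ext (smul_zero _).symm (smul_zero _).symm rfl

/-- The functional on triangular matrices with given components. -/
def functional (α : DualBimod k R) (μ : DualBimod k M) (β : DualBimod k S) :
    DualBimod k (TriMat R S M) :=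
  ({ toFun := fun x => α x.a + μ x.m + β x.b
     map_add' := fun x y => by
       simp only [add_a, add_m, add_b, map_add]
       abel
     map_smul' := fun c x => by
       simp only [smul_a, smul_m, smul_b, map_smul, RingHom.id_apply, smul_add] } :
    TriMat R S M →ₗ[k] k)

variable {k R S M}

lemma functional_apply (α : DualBimod k R) (μ : DualBimod k M) (β : DualBimod k S)
    (x : TriMat R S M) : functional k R S M α μ β x = α x.a + μ x.m + β x.b := rfl

/-- Evaluation of functionals at a vector. -/
def evalAt (k : Type u) {M : Type u} [Field k] [AddCommGroup M] [Module k M] (m : M) :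
    DualBimod k (DualBimod k M) :=
  ({ toFun := fun φ => φ m, map_add' := fun _ _ => rfl, map_smul' := fun _ _ => rfl } :
    DualBimod k M →ₗ[k] k)

/-- The vector at which a functional on the dual is the evaluation. -/
noncomputable def unEval {k M : Type u} [Field k] [AddCommGroup M] [Module k M] [Module.Finite k M]
    (ψ : DualBimod k (DualBimod k M)) : M := (Module.evalEquiv k M).symm ψ

lemma apply_unEval {k M : Type u} [Field k] [AddCommGroup M] [Module k M] [Module.Finite k M]
    (ψ : DualBimod k (DualBimod k M)) (φ : DualBimod k M) : φ (unEval ψ) = ψ φ :=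
  LinearMap.congr_fun ((Module.evalEquiv k M).apply_symm_apply ψ) φ

lemma unEval_zero {k M : Type u} [Field k] [AddCommGroup M] [Module k M] [Module.Finite k M] :
    unEval (0 : DualBimod k (DualBimod k M)) = 0 := by
  rw [← Module.forall_dual_apply_eq_zero_iff k]
  exact fun φ => apply_unEval 0 φ

/-- The restriction of a functional along a linear map. -/
def restrict {V : Type u} [AddCommGroup V] [Module k V] (φ : DualBimod k (TriMat R S M))
    (f : V →ₗ[k] TriMat R S M) : DualBimod k V :=
  (show Module.Dual k (TriMat R S M) from φ) ∘ₗ f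

lemma restrict_apply {V : Type u} [AddCommGroup V] [Module k V] (φ : DualBimod k (TriMat R S M))
    (f : V →ₗ[k] TriMat R S M) (v : V) : restrict φ f v = φ (f v) := rfl

lemma eq_add (x : TriMat R S M) : x = inA k R S M x.a + inM k R S M x.m + inB k R S M x.b := by
  ext <;> simp [inA, inM, inB]

lemma apply_eq_add (φ : DualBimod k (TriMat R S M)) (x : TriMat R S M) :
    φ x = φ (inA k R S M x.a) + φ (inM k R S M x.m) + φ (inB k R S M x.b) := by
  conv_lhs => rw [eq_add (k := k) x]
  rw [map_add, map_add]

lemma inA_mul (r : R) (x : TriMat R S M) :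
    inA k R S M r * x = inA k R S M (r * x.a) + inM k R S M (r • x.m) := by
  ext <;> simp [inA, inM]

lemma mul_inA (r : R) (x : TriMat R S M) : x * inA k R S M r = inA k R S M (x.a * r) := by
  ext <;> simp [inA]

lemma inM_mul (m : M) (x : TriMat R S M) : inM k R S M m * x = inM k R S M (op x.b • m) := by
  ext <;> simp [inM]

lemma mul_inM (m : M) (x : TriMat R S M) : x * inM k R S M m = inM k R S M (x.a • m) := by
  ext <;> simp [inM]

lemma inB_mul (s : S) (x : TriMat R S M) : inB k R S M s * x = inB k R S M (s * x.b) := by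
  ext <;> simp [inB]

lemma mul_inB (s : S) (x : TriMat R S M) :
    x * inB k R S M s = inB k R S M (x.b * s) + inM k R S M (op s • x.m) := by
  ext <;> simp [inB, inM]

end TriMat

namespace RepetitiveAlgebra

open TriMat

lemma mul_off_apply_apply {k A : Type u} [Field k] [Ring A] [Algebra k A]
    (x y : RepetitiveAlgebra k A) (i : ℤ) (z : A) :
    (x * y).off i z = y.off i (z * x.diag i) + x.off i (y.diag (i + 1) * z) := rfl

variable {k R S M : Type u} [Field k] [CommRing R] [CommRing S] [Algebra k R] [Algebra k S]
  [AddCommGroup M] [Module k M] [Module R M] [Module Sᵐᵒᵖ M] [SMulCommClass R Sᵐᵒᵖ M]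
  [IsScalarTower k R M] [IsScalarTower k Sᵐᵒᵖ M]

/-- The diagonal entries of the matrix over the mate. -/
noncomputable def mateDiag (x : RepetitiveAlgebra k (TriMat R S M)) : ℤ →₀ Mate k R S M :=
  Finsupp.ofSupportFinite
    (fun i => ⟨(x.diag i).b, restrict (x.off i) (inM k R S M), (x.diag (i + 1)).a⟩)
    (Int.support_finite_of_finsupp x.diag x.off 1 fun i h1 h2 h3 _ => by rw [h1, h2, h3]; rfl)

/-- The entries above the diagonal of the matrix over the mate. -/
noncomputable def mateOff (x : RepetitiveAlgebra k (TriMat R S M)) :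
    ℤ →₀ DualBimod k (Mate k R S M) :=
  Finsupp.ofSupportFinite
    (fun i => functional k S R (DualBimod k M) (restrict (x.off i) (inB k R S M))
      (evalAt k (x.diag (i + 1)).m) (restrict (x.off (i + 1)) (inA k R S M)))
    (Int.support_finite_of_finsupp x.diag x.off 1 fun i _ h2 h3 h4 => by
      refine DualBimod.ext fun z => ?_
      rw [functional_apply, h2, h3, h4, zero_m]
      change (0 : k) + z.m 0 + 0 = 0
      rw [map_zero, add_zero, add_zero])

/-- The matrix over the mate corresponding to a matrix in the repetitive algebra. -/
noncomputable def mate (x : RepetitiveAlgebra k (TriMat R S M)) :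
    RepetitiveAlgebra k (Mate k R S M) := ⟨mateDiag x, mateOff x⟩

lemma mate_diag_apply (x : RepetitiveAlgebra k (TriMat R S M)) (i : ℤ) : (mate x).diag i =
    ⟨(x.diag i).b, restrict (x.off i) (inM k R S M), (x.diag (i + 1)).a⟩ := rfl

lemma mate_off_apply (x : RepetitiveAlgebra k (TriMat R S M)) (i : ℤ) (z : Mate k R S M) :
    (mate x).off i z = x.off i (inB k R S M z.a) + z.m (x.diag (i + 1)).m +
      x.off (i + 1) (inA k R S M z.b) := rfl

lemma mate_ext {A : Type u} [Ring A] [Algebra k A] {x y : RepetitiveAlgebra k A}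
    (h1 : ∀ i, x.diag i = y.diag i) (h2 : ∀ i z, x.off i z = y.off i z) : x = y :=
  RepetitiveAlgebra.ext (Finsupp.ext h1) (Finsupp.ext fun i => DualBimod.ext (h2 i))

/-- The homomorphism between the repetitive algebras of a triangular matrix algebra and its
mate. -/
noncomputable def mateHom :
    RepetitiveAlgebra k (TriMat R S M) →ₙₐ[k] RepetitiveAlgebra k (Mate k R S M) where
  toFun := mate
  map_smul' c x := mate_ext (fun i => rfl) (fun i z => by
    rw [mate_off_apply]
    change c • x.off i _ + z.m (c • (x.diag (i + 1)).m) + c • x.off (i + 1) _ =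
      c • (mate x).off i z
    rw [mate_off_apply, map_smul, smul_add, smul_add])
  map_zero' := mate_ext (fun i => rfl) (fun i z => by
    rw [mate_off_apply]
    change (0 : k) + z.m 0 + 0 = 0
    rw [map_zero, add_zero, add_zero])
  map_add' x y := mate_ext (fun i => rfl) (fun i z => by
    change _ = (mate x).off i z + (mate y).off i z
    rw [mate_off_apply, mate_off_apply, mate_off_apply]
    change (x.off i _ + y.off i _) + z.m ((x.diag (i + 1)).m + (y.diag (i + 1)).m) +
      (x.off (i + 1) _ + y.off (i + 1) _) = _
    rw [map_add]
    abel)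
  map_mul' x y := mate_ext
    (fun i => by
      change _ = (mate x).diag i * (mate y).diag i
      refine TriMat.ext rfl (DualBimod.ext fun m => ?_) rfl
      change (x * y).off i (inM k R S M m) = y.off i (inM k R S M (op (x.diag i).b • m)) +
        x.off i (inM k R S M ((y.diag (i + 1)).a • m))
      rw [mul_off_apply_apply, inM_mul, mul_inM])
    (fun i z => by
      rw [mul_off_apply_apply, mate_off_apply, mate_off_apply, mate_off_apply, mul_off_apply_apply,
        mul_off_apply_apply, inB_mul, mul_inB, inA_mul, mul_inA,
        map_add (x.off i), map_add (y.off (i + 1))]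
      change _ + _ + z.m ((x.diag (i + 1)).a • (y.diag (i + 1)).m +
        op (y.diag (i + 1)).b • (x.diag (i + 1)).m) + _ =
        (y.off i (inB k R S M (z.a * (x.diag i).b)) +
          (x.off i (inM k R S M (op z.a • (y.diag (i + 1)).m)) +
            z.m ((x.diag (i + 1)).a • (y.diag (i + 1)).m)) +
          y.off (i + 1) (inA k R S M (z.b * (x.diag (i + 1)).a))) +
        (x.off i (inB k R S M ((y.diag (i + 1)).b * z.a)) +
          (z.m (op (y.diag (i + 1)).b • (x.diag (i + 1)).m) +
            y.off (i + 1) (inM k R S M (z.b • (x.diag (i + 1)).m))) +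
          x.off (i + 1) (inA k R S M ((y.diag (i + 1 + 1)).a * z.b)))
      rw [map_add z.m]
      abel)

lemma mateHom_injective : Function.Injective (mateHom (k := k) (R := R) (S := S) (M := M)) := by
  intro x y h
  have hd : ∀ i, (mate x).diag i = (mate y).diag i := fun i => congrArg (fun t => t.diag i) h
  have ho : ∀ i z, (mate x).off i z = (mate y).off i z := fun i z => congrArg (fun t => t.off i z) h
  have hm : ∀ i, (x.diag (i + 1)).m = (y.diag (i + 1)).m := by
    intro i
    rw [← sub_eq_zero, ← Module.forall_dual_apply_eq_zero_iff k]
    intro φ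
    have h1 := ho i (inM k S R (DualBimod k M) φ)
    rw [mate_off_apply, mate_off_apply] at h1
    change x.off i (inB k R S M 0) + φ _ + x.off (i + 1) (inA k R S M 0) =
      y.off i (inB k R S M 0) + φ _ + y.off (i + 1) (inA k R S M 0) at h1
    simpa [sub_eq_zero] using h1
  have hb : ∀ i s, x.off i (inB k R S M s) = y.off i (inB k R S M s) := by
    intro i s
    have h1 := ho i (inA k S R (DualBimod k M) s)
    rw [mate_off_apply, mate_off_apply] at h1
    change x.off i (inB k R S M s) + (0 : k) + x.off (i + 1) (inA k R S M 0) =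
      y.off i (inB k R S M s) + (0 : k) + y.off (i + 1) (inA k R S M 0) at h1
    simpa using h1
  have ha : ∀ i r, x.off (i + 1) (inA k R S M r) = y.off (i + 1) (inA k R S M r) := by
    intro i r
    have h1 := ho i (inB k S R (DualBimod k M) r)
    rw [mate_off_apply, mate_off_apply] at h1
    change x.off i (inB k R S M 0) + (0 : k) + x.off (i + 1) (inA k R S M r) =
      y.off i (inB k R S M 0) + (0 : k) + y.off (i + 1) (inA k R S M r) at h1
    simpa using h1
  refine mate_ext (fun i => ?_) (fun i z => ?_)
  · have h1 := congrArg TriMat.b (hd (i - 1))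
    have h2 := hm (i - 1)
    rw [mate_diag_apply, mate_diag_apply] at h1
    rw [sub_add_cancel] at h1 h2
    exact TriMat.ext h1 h2 (congrArg TriMat.a (hd i))
  · rw [apply_eq_add, apply_eq_add (y.off i)]
    have h1 := ha (i - 1) z.a
    rw [sub_add_cancel] at h1
    have h2 : x.off i (inM k R S M z.m) = y.off i (inM k R S M z.m) :=
      congrArg (fun t => t.m z.m) (hd i)
    rw [h1, h2, hb i]

lemma mateHom_surjective [Module.Finite k M] :
    Function.Surjective (mateHom (k := k) (R := R) (S := S) (M := M)) := by
  intro y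
  let x : RepetitiveAlgebra k (TriMat R S M) :=
    { diag := Finsupp.ofSupportFinite
        (fun i => ⟨(y.diag (i + -1)).b,
          unEval (restrict (y.off (i + -1)) (inM k S R (DualBimod k M))), (y.diag i).a⟩)
        (Int.support_finite_of_finsupp y.diag y.off (-1) fun i h1 h2 _ h4 => by
          rw [h1, h2, h4]
          exact TriMat.ext rfl unEval_zero rfl)
      off := Finsupp.ofSupportFinite
        (fun i => functional k R S M (restrict (y.off (i + -1)) (inB k S R (DualBimod k M)))
          (y.diag i).m (restrict (y.off i) (inA k S R (DualBimod k M))))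
        (Int.support_finite_of_finsupp y.diag y.off (-1) fun i h1 _ h3 h4 => by
          refine DualBimod.ext fun z => ?_
          rw [functional_apply, h1, h3, h4]
          change (0 : k) + 0 + 0 = 0
          rw [add_zero, add_zero]) }
  have hd : ∀ i, x.diag i = ⟨(y.diag (i + -1)).b,
    unEval (restrict (y.off (i + -1)) (inM k S R (DualBimod k M))), (y.diag i).a⟩ := fun i => rfl
  have ho : ∀ i z, x.off i z = y.off (i + -1) (inB k S R (DualBimod k M) z.a) +
    (y.diag i).m z.m + y.off i (inA k S R (DualBimod k M) z.b) := fun i z => rfl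
  refine ⟨x, mate_ext (fun i => ?_) (fun i z => ?_)⟩
  · change (mate x).diag i = _
    rw [mate_diag_apply]
    refine TriMat.ext rfl (DualBimod.ext fun m => ?_) ?_
    · change x.off i (inM k R S M m) = _
      rw [ho]
      change y.off _ (inB k S R (DualBimod k M) 0) + _ + y.off _ (inA k S R (DualBimod k M) 0) = _
      rw [map_zero, map_zero, map_zero, map_zero, zero_add, add_zero]
      rfl
    · rw [hd (i + 1), add_neg_cancel_right]
  · change (mate x).off i z = _
    rw [mate_off_apply, ho, ho, hd, add_neg_cancel_right, apply_eq_add (y.off i) z]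
    change y.off _ (inB k S R (DualBimod k M) 0) + (y.diag i).m 0 +
      y.off i (inA k S R (DualBimod k M) z.a) +
      z.m (unEval (restrict (y.off i) (inM k S R (DualBimod k M)))) +
      (y.off i (inB k S R (DualBimod k M) z.b) + (y.diag (i + 1)).m 0 +
        y.off (i + 1) (inA k S R (DualBimod k M) 0)) = _
    rw [apply_unEval, restrict_apply, map_zero, map_zero, map_zero, map_zero, map_zero, map_zero]
    simp

end RepetitiveAlgebra

theorem mainTheorem6 (k : Type u) [Field k] :
    ¬ DerivedEquivalent (ExLambda k) (ExMate k) ∧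
    (∃ f : RepetitiveAlgebra k (ExLambda k) →ₙₐ[k] RepetitiveAlgebra k (ExMate k),
      Function.Bijective f) ∧
    Nonempty (ExMate k ≃ₐ[k] TriMat (TruncPoly k 3) (TruncPoly k 2) (SimpleBimod k 3 2)) ∧
    IsCartanMatrix k (ExLambda k) !![2, 0; 1, 3] ∧
    IsCartanMatrix k (ExMate k) !![3, 0; 1, 2] ∧
    ¬ IntCongruent !![2, 0; 1, 3] !![3, 0; 1, 2] ∧
    Module.Injective (TruncPoly k 2)ᵐᵒᵖ (TruncPoly k 2) ∧
    Module.Injective (TruncPoly k 3)ᵐᵒᵖ (TruncPoly k 3) ∧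
    ∀ d : ℕ, ¬ HasProjectiveDimensionLE
      (ModuleCat.of (TruncPoly k 3)ᵐᵒᵖ (SimpleBimod k 2 3)) d := by
  exact ⟨not_derivedEquivalent k,
    ⟨RepetitiveAlgebra.mateHom, RepetitiveAlgebra.mateHom_injective,
      RepetitiveAlgebra.mateHom_surjective⟩,
    ⟨mateSimpleBimodEquiv k 2 3⟩,
    (ExLambda.basicIdempotents k).isCartanMatrix _ (ExLambda.cartan k),
    (ExMate.basicIdempotents k).isCartanMatrix _ (ExMate.cartan k),
    not_intCongruent, TruncPoly.selfInjective, TruncPoly.selfInjective,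
    TruncPoly.not_hasProjectiveDimensionLE (by norm_num)⟩
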